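/- Let $n\ge 1$, let $\Omega\subset\mathbb R^n$ be a bounded domain, let $0<\alpha<\pi/4$, $\mathbb R_+=(0,\infty)$, and put $$\mathbb S_\alpha=\{z\in\mathbb C\setminus\{0\}:|\arg z|<\alpha\},\qquad \mathcal D_\alpha=\{\lambda\in\mathbb C:|\lambda|<\sin\alpha\}.$$ Let $s\in C^\infty(\mathbb R)$ be real-valued with $s(x)=0$ for $x\le 0$, $0\le s'\le 1$, and $s'(x)=1$ for $x\ge C_0$ with some $C_0>0$. For $r>0$, $\lambda\in\mathcal D_\alpha$ put $\kappa_{\lambda,r}(x,y)=(x+\lambda s(x-r),y)$. (For $x>0$ the point $x+\lambda s(x-r)$ lies in $\mathbb S_\alpha$.) The Hardy class $\mathfrak H(\mathbb S_\alpha)$ consists of all analytic functions $F:\mathbb S_\alpha\to L^2(\Omega)$ for which there is a constant $C_F$ with $\int_0^\infty\|F(e^{i\psi}x);L^2(\Omega)\|^2\,dx\le C_F$ for all $\psi\in(-\alpha,\alpha)$. Its norm is $\|F;\mathfrak H(\mathbb S_\alpha)\|=(\|F_-;L^2(\mathbb R_+\times\Omega)\|^2+\|F_+;L^2(\mathbb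 R_+\times\Omega)\|^2)^{1/2}$, where $F_\pm\in L^2(\mathbb R_+\times\Omega)$ are the boundary limits, $\int_0^\infty\|F(e^{i\psi}x)-F_\pm(x);L^2(\Omega)\|^2\,dx\to0$ as $\psi\to\pm\alpha$. We write $F\circ\kappa_{\lambda,r}$ for the function $(x,y)\mapsto F(x+\lambda s(x-r))(y)$ on $\mathbb R_+\times\Omega$. **Proposition.** Every $F\in\mathfrak H(\mathbb S_\alpha)$ has boundary limits $F_\pm$, and the following holds. 1. For every $r>0$ there is a constant $C_r$ such that for all $\lambda\in\mathcal D_\alpha$ and $F\in\mathfrak H(\mathbb S_\alpha)$ $$\int_0^\infty\|F(x+\lambda s(x-r));L^2(\Omega)\|^2\,dx\le C_r\|F;\mathfrak H(\mathbb S_\alpha)\|^2 .$$ 2. For all $\lambda\in\mathcal D_\alpha$ and $r>0$ the set $\{F\circ\kappa_{\lambda,r}:F\in\mathfrak H(\mathbb S_\alpha)\}$ is dense in $L^2(\mathbb R_+\times\Omega)$. 3. For all $F\in\mathfrak H(\mathbb S_\alpha)$ and $r>0$ the function $\mathcal D_\alpha\ni\lambda\mapsto F\circ\kappa_{\lambda,r}\in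 L^2(\mathbb R_+\times\Omega)$ is analytic. Moreover, let $\mathcal G\subset\mathbb R^{n+1}$ be a quasi-cylindrical domain: a domain with smooth boundary such that $\{(\zeta,\eta)\in\mathcal G:\zeta\le0\}$ is bounded and there is a diffeomorphism $\varkappa$ of $\mathbb R_+\times\overline\Omega$ onto a subset of $\mathbb R^{n+1}$ (smooth in both directions up to the lateral boundary) that maps $\mathbb R_+\times\Omega$ onto $\mathcal C=\{(\zeta,\eta)\in\mathcal G:\zeta>0\}$, maps $(0,R]\times\Omega$ to a bounded set for every $R$, and whose Jacobian matrix $\varkappa'(x,\cdot)$ tends to the identity matrix in $C^\infty(\overline\Omega)$ as $x\to+\infty$. Let $\mathcal H_\alpha(\mathcal G)$ be the space of all $f\in L^2(\mathcal G)$ such that $x\mapsto f\circ\varkappa(x,\cdot)\in L^2(\Omega)$ has an analytic continuation from $\mathbb R_+$ to an element of $\mathfrak H(\mathbb S_\alpha)$, denoted again by $f\circ\varkappa$, with the norm $\|f;\mathcal H_\alpha(\mathcal G)\|=\|f;L^2(\mathcal G)\|+\|f\circ\varkappa;\mathfrak H(\mathbb S_\alpha)\|$. For $f\in\mathcal H_\alpha(\mathcal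 G)$, $\lambda\in\mathcal D_\alpha$, $r>0$ let $f\circ\vartheta_{\lambda,r}$ be the function on $\mathcal G$ that equals $(f\circ\varkappa)\circ\kappa_{\lambda,r}\circ\varkappa^{-1}$ on $\mathcal C$ and $f$ on $\mathcal G\setminus\mathcal C$. Then: 1. For every $r>0$ there is a constant $C_r$ such that $\|f\circ\vartheta_{\lambda,r};L^2(\mathcal G)\|\le C_r\|f;\mathcal H_\alpha(\mathcal G)\|$ for all $f\in\mathcal H_\alpha(\mathcal G)$ and $\lambda\in\mathcal D_\alpha$. 2. For all $\lambda\in\mathcal D_\alpha$ and $r>0$ the set $\{f\circ\vartheta_{\lambda,r}:f\in\mathcal H_\alpha(\mathcal G)\}$ is dense in $L^2(\mathcal G)$. 3. For all $f\in\mathcal H_\alpha(\mathcal G)$ and $r>0$ the function $\mathcal D_\alpha\ni\lambda\mapsto f\circ\vartheta_{\lambda,r}\in L^2(\mathcal G)$ is analytic. -/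

import Mathlib

open MeasureTheory Set Filter Topology
open scoped ContDiff ENNReal NNReal

noncomputable section

namespace PML

/-- The cross-section space `ℝⁿ`. -/
abbrev E (n : ℕ) : Type := EuclideanSpace ℝ (Fin n)

/-- The complex Hilbert space `L²(Ω)`. -/
abbrev L2Section {n : ℕ} (Ω : Set (E n)) : Type :=
  Lp ℂ 2 (volume.restrict Ω)

/-- The complex Hilbert space `L²(A)` for a set `A ⊆ ℝ × ℝⁿ = ℝⁿ⁺¹`
(with Lebesgue measure). -/
abbrev L2Space {n : ℕ} (A : Set (ℝ × E n)) : Type :=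
  Lp ℂ 2 (volume.restrict A)

/-- The semi-cylinder `ℝ₊ × Ω`, where `ℝ₊ = (0, ∞)`. -/
def semiCylinder {n : ℕ} (Ω : Set (E n)) : Set (ℝ × E n) := Ioi 0 ×ˢ Ω

/-- The open sector `𝕊_α = {z ≠ 0 : |arg z| < α}`. -/
def sector (α : ℝ) : Set ℂ := {z | z ≠ 0 ∧ |z.arg| < α}

/-- The open disk `𝒟_α = {λ : |λ| < sin α}` of scaling parameters. -/
def scalingDisk (α : ℝ) : Set ℂ := Metric.ball 0 (Real.sin α)

/-- Smooth scaling functions: `s = 0` on `(-∞, 0]`, `0 ≤ s' ≤ 1`, and `s' = 1` on `[C, ∞)`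
for some `C > 0`. -/
structure IsScalingFunction (s : ℝ → ℝ) : Prop where
  smooth : ContDiff ℝ ∞ s
  eq_zero : ∀ x ≤ 0, s x = 0
  deriv_nonneg : ∀ x, 0 ≤ deriv s x
  deriv_le_one : ∀ x, deriv s x ≤ 1
  deriv_eq_one : ∃ C > 0, ∀ x ≥ C, deriv s x = 1

/-- The scaled axial coordinate `x + λ s(x - r)`. -/
def scaledPoint (s : ℝ → ℝ) (lam : ℂ) (r x : ℝ) : ℂ := (x : ℂ) + lam * (s (x - r) : ℂ)

/-- The Hardy class `𝔥(𝕊_α)`: analytic functions `F : 𝕊_α → L²(Ω)` whose `L²` norms along the rays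
`{e^{iψ} x : x > 0}`, `ψ ∈ (-α, α)`, are bounded uniformly in `ψ`.
Values of `F` outside the sector play no role. -/
structure MemHardy {n : ℕ} (Ω : Set (E n)) (α : ℝ) (F : ℂ → L2Section Ω) : Prop where
  analytic : AnalyticOnNhd ℂ F (sector α)
  bound : ∃ C : ℝ≥0, ∀ ψ ∈ Ioo (-α) α,
    ∫⁻ x in Ioi (0 : ℝ), ‖F (Complex.exp (ψ * Complex.I) * x)‖ₑ ^ 2 ≤ C

/-- `u ∈ L²(ℝ₊ × Ω)` is the limit of `(x, y) ↦ F(e^{iψ} x)(y)` in `L²(ℝ₊ × Ω)` as `ψ` tends to an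
end of `(-α, α)` along the filter `l`. -/
def IsBoundaryLimit {n : ℕ} (Ω : Set (E n)) (F : ℂ → L2Section Ω) (l : Filter ℝ)
    (u : L2Space (semiCylinder Ω)) : Prop :=
  Tendsto (fun ψ : ℝ => ∫⁻ x in Ioi (0 : ℝ), ∫⁻ y in Ω,
    ‖F (Complex.exp (ψ * Complex.I) * x) y - u (x, y)‖ₑ ^ 2) l (𝓝 0)

/-- The boundary limit of `F` along `l` (an arbitrary element if there is none). -/
def boundaryLimit {n : ℕ} (Ω : Set (E n)) (F : ℂ → L2Section Ω) (l : Filter ℝ) :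
    L2Space (semiCylinder Ω) :=
  Classical.epsilon (IsBoundaryLimit Ω F l)

/-- The norm `(‖F₋‖² + ‖F₊‖²)^{1/2}` of the Hardy class, where `F_±` are the boundary limits of
`F(e^{iψ} ·)` as `ψ → ±α`. -/
def hardyNorm {n : ℕ} (Ω : Set (E n)) (α : ℝ) (F : ℂ → L2Section Ω) : ℝ :=
  Real.sqrt (‖boundaryLimit Ω F (𝓝[>] (-α))‖ ^ 2 + ‖boundaryLimit Ω F (𝓝[<] α)‖ ^ 2)

/-- `u ∈ L²(ℝ₊ × Ω)` is the function `F ∘ κ_{λ,r}`, that is `u(x, ·) = F(x + λ s(x - r))` in `L²(Ω)`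
for almost every `x > 0`. -/
def IsCompKappa {n : ℕ} (Ω : Set (E n)) (s : ℝ → ℝ) (lam : ℂ) (r : ℝ) (F : ℂ → L2Section Ω)
    (u : L2Space (semiCylinder Ω)) : Prop :=
  ∀ᵐ x ∂(volume.restrict (Ioi (0 : ℝ))), ∀ᵐ y ∂(volume.restrict Ω),
    u (x, y) = F (scaledPoint s lam r x) y

/-- An open set lying locally on one side of its boundary, which is a smooth hypersurface. -/
def HasSmoothBoundary {n : ℕ} (G : Set (ℝ × E n)) : Prop :=
  ∀ p ∈ frontier G, ∃ U ∈ 𝓝 p, ∃ ρ : ℝ × E n → ℝ,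
    ContDiff ℝ ∞ ρ ∧ fderiv ℝ ρ p ≠ 0 ∧ G ∩ U = {q ∈ U | ρ q < 0}

/-- `G` is a quasi-cylindrical domain whose quasi-cylinder `𝒞 = {(ζ, η) ∈ G : ζ > 0}` is
parametrized by the diffeomorphism `ϰ` of `ℝ₊ × Ω̄`. -/
structure IsQuasiCylindrical {n : ℕ} (Ω : Set (E n)) (G : Set (ℝ × E n))
    (ϰ : ℝ × E n → ℝ × E n) : Prop where
  isOpen : IsOpen G
  isConnected : IsConnected G
  smoothBoundary : HasSmoothBoundary G
  /-- The part of `G` in `{ζ ≤ 0}` is bounded. -/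
  bounded_left : Bornology.IsBounded {p ∈ G | p.1 ≤ 0}
  /-- `ϰ` is smooth on `ℝ₊ × Ω̄`, up to the lateral boundary. -/
  smooth : ContDiffOn ℝ ∞ ϰ (Ioi 0 ×ˢ closure Ω)
  /-- `ϰ` is injective on `ℝ₊ × Ω̄` with smooth inverse. -/
  smooth_inv : ∃ ϰinv : ℝ × E n → ℝ × E n, LeftInvOn ϰinv ϰ (Ioi 0 ×ˢ closure Ω) ∧
    ContDiffOn ℝ ∞ ϰinv (ϰ '' (Ioi 0 ×ˢ closure Ω))
  /-- `ϰ` maps `ℝ₊ × Ω` onto the quasi-cylinder; by continuity, `ℝ₊ × Ω̄` is then mapped into the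
  closure of the quasi-cylinder. -/
  image_eq : ϰ '' semiCylinder Ω = {p ∈ G | 0 < p.1}
  /-- Bounded pieces of the semi-cylinder are mapped to bounded sets (the end `x → 0` of the
  semi-cylinder is not sent to infinity). -/
  bounded_image : ∀ R : ℝ, Bornology.IsBounded (ϰ '' (Ioc 0 R ×ˢ Ω))
  /-- The Jacobian matrix `ϰ'(x, ·)` tends to the identity in `C^∞(Ω̄)` as `x → +∞`: uniformly
  on `Ω` together with all its derivatives in `y`. -/
  tendsto_id : ∀ k : ℕ, TendstoUniformlyOn
    (fun (x : ℝ) (y : E n) =>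
      iteratedFDeriv ℝ k (fun y' : E n =>
        fderiv ℝ ϰ (x, y') - ContinuousLinearMap.id ℝ (ℝ × E n)) y)
    (fun _ => 0) atTop Ω

/-- `F ∈ 𝔥(𝕊_α)` is the analytic continuation of `x ↦ f ∘ ϰ(x, ·) ∈ L²(Ω)` from `ℝ₊`
to `𝕊_α`. -/
def IsHardyContinuation {n : ℕ} (Ω : Set (E n)) (α : ℝ) {G : Set (ℝ × E n)}
    (ϰ : ℝ × E n → ℝ × E n) (f : L2Space G) (F : ℂ → L2Section Ω) : Prop :=
  MemHardy Ω α F ∧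
    ∀ᵐ x ∂(volume.restrict (Ioi (0 : ℝ))), ∀ᵐ y ∂(volume.restrict Ω), f (ϰ (x, y)) = F (x : ℂ) y

/-- The space `ℋ_α(G)` of all `f ∈ L²(G)` such that `f ∘ ϰ` belongs to the Hardy class. -/
def HAlpha {n : ℕ} (Ω : Set (E n)) (α : ℝ) (G : Set (ℝ × E n))
    (ϰ : ℝ × E n → ℝ × E n) : Set (L2Space G) :=
  {f | ∃ F : ℂ → L2Section Ω, IsHardyContinuation Ω α ϰ f F}

/-- The analytic continuation of `f ∘ ϰ` for `f ∈ ℋ_α(G)` (on the sector, it is unique). -/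
def hardyContinuation {n : ℕ} (Ω : Set (E n)) (α : ℝ) {G : Set (ℝ × E n)}
    (ϰ : ℝ × E n → ℝ × E n) (f : L2Space G) : ℂ → L2Section Ω :=
  Classical.epsilon (IsHardyContinuation Ω α ϰ f)

/-- The norm `‖f; L²(G)‖ + ‖f ∘ ϰ; 𝔥(𝕊_α)‖` of `ℋ_α(G)`. -/
def hAlphaNorm {n : ℕ} (Ω : Set (E n)) (α : ℝ) {G : Set (ℝ × E n)}
    (ϰ : ℝ × E n → ℝ × E n) (f : L2Space G) : ℝ :=
  ‖f‖ + hardyNorm Ω α (hardyContinuation Ω α ϰ f)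

/-- `v ∈ L²(G)` is the function `f ∘ ϑ_{λ,r}` for `f ∈ ℋ_α(G)`. Outside the quasi-cylinder,
`ϑ_{λ,r}` is the identity, so `v = f`. On the quasi-cylinder
`ϑ_{λ,r} = ϰ ∘ κ_{λ,r} ∘ ϰ⁻¹`, so `v ∘ ϰ = (f ∘ ϰ) ∘ κ_{λ,r}`, where for non-real `λ` the function
`f ∘ ϰ` stands for its analytic continuation to the sector. -/
def IsCompTheta {n : ℕ} (Ω : Set (E n)) (α : ℝ) {G : Set (ℝ × E n)}
    (ϰ : ℝ × E n → ℝ × E n) (s : ℝ → ℝ) (lam : ℂ) (r : ℝ) (f v : L2Space G) : Prop :=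
  (∀ᵐ p ∂(volume.restrict {p ∈ G | p.1 ≤ 0}), v p = f p) ∧
    ∀ᵐ x ∂(volume.restrict (Ioi (0 : ℝ))), ∀ᵐ y ∂(volume.restrict Ω),
      v (ϰ (x, y)) = hardyContinuation Ω α ϰ f (scaledPoint s lam r x) y

end PML

end

noncomputable section

namespace PML

section Slices

variable {X Y : Type*} [MeasurableSpace X] [MeasurableSpace Y] {μ : Measure X} {ν : Measure Y}

theorem eLpNorm_two_sq {E : Type*} [NormedAddCommGroup E] (f : X → E) :
    eLpNorm f 2 μ ^ 2 = ∫⁻ x, ‖f x‖ₑ ^ 2 ∂μ := by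
  rw [eLpNorm_eq_lintegral_rpow_enorm_toReal (by simp) (by simp)]
  rw [← ENNReal.rpow_natCast, ← ENNReal.rpow_mul]
  simp

theorem enorm_Lp_two_sq {E : Type*} [NormedAddCommGroup E] (f : Lp E 2 μ) :
    ‖f‖ₑ ^ 2 = ∫⁻ x, ‖f x‖ₑ ^ 2 ∂μ := by
  rw [Lp.enorm_def, eLpNorm_two_sq]

theorem memLp_two_of_lintegral {E : Type*} [NormedAddCommGroup E] {f : X → E}
    (hf : AEStronglyMeasurable f μ) (h : ∫⁻ x, ‖f x‖ₑ ^ 2 ∂μ < ⊤) : MemLp f 2 μ := by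
  refine ⟨hf, ?_⟩
  rw [← eLpNorm_two_sq] at h
  by_contra h'
  simp only [not_lt, top_le_iff] at h'
  simp [h'] at h

theorem enorm_toLp_two_sq {E : Type*} [NormedAddCommGroup E] {f : X → E} (hf : MemLp f 2 μ) :
    ‖hf.toLp f‖ₑ ^ 2 = ∫⁻ x, ‖f x‖ₑ ^ 2 ∂μ := by
  rw [Lp.enorm_toLp, eLpNorm_two_sq]

/-- `u` is the function of two variables with slices `u(x, ·) = f x`. -/
def IsSlice (f : X → Lp ℂ 2 ν) (u : Lp ℂ 2 (μ.prod ν)) : Prop :=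
  ∀ᵐ x ∂μ, ∀ᵐ y ∂ν, u (x, y) = f x y

theorem IsSlice.congr {f g : X → Lp ℂ 2 ν} {u : Lp ℂ 2 (μ.prod ν)} (hf : IsSlice f u)
    (h : f =ᵐ[μ] g) : IsSlice g u := by
  filter_upwards [hf, h] with x h1 h2
  rw [← h2]; exact h1

variable [SFinite ν]

theorem lintegral_enorm_prod_sq (u : Lp ℂ 2 (μ.prod ν)) :
    ‖u‖ₑ ^ 2 = ∫⁻ x, ∫⁻ y, ‖u (x, y)‖ₑ ^ 2 ∂ν ∂μ := by
  rw [enorm_Lp_two_sq, lintegral_prod]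
  exact ((Lp.aestronglyMeasurable u).enorm.pow_const 2)

theorem IsSlice.lintegral_eq {f : X → Lp ℂ 2 ν} {u : Lp ℂ 2 (μ.prod ν)} (h : IsSlice f u) :
    ∫⁻ x, ‖f x‖ₑ ^ 2 ∂μ = ‖u‖ₑ ^ 2 := by
  rw [lintegral_enorm_prod_sq]
  refine lintegral_congr_ae ?_
  filter_upwards [h] with x hx
  rw [enorm_Lp_two_sq]
  refine lintegral_congr_ae ?_
  filter_upwards [hx] with y hy
  rw [hy]

theorem IsSlice.sub {f g : X → Lp ℂ 2 ν} {u v : Lp ℂ 2 (μ.prod ν)} (hf : IsSlice f u)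
    (hg : IsSlice g v) : IsSlice (fun x => f x - g x) (u - v) := by
  filter_upwards [hf, hg, Measure.ae_ae_of_ae_prod (Lp.coeFn_sub u v)] with x h1 h2 h3
  filter_upwards [h1, h2, h3, Lp.coeFn_sub (f x) (g x)] with y h1 h2 h3 h4
  rw [h3, h4]; simp [h1, h2]

theorem IsSlice.add {f g : X → Lp ℂ 2 ν} {u v : Lp ℂ 2 (μ.prod ν)} (hf : IsSlice f u)
    (hg : IsSlice g v) : IsSlice (fun x => f x + g x) (u + v) := by
  filter_upwards [hf, hg, Measure.ae_ae_of_ae_prod (Lp.coeFn_add u v)] with x h1 h2 h3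
  filter_upwards [h1, h2, h3, Lp.coeFn_add (f x) (g x)] with y h1 h2 h3 h4
  rw [h3, h4]; simp [h1, h2]

theorem IsSlice.smul {f : X → Lp ℂ 2 ν} {u : Lp ℂ 2 (μ.prod ν)} (c : ℂ) (hf : IsSlice f u) :
    IsSlice (fun x => c • f x) (c • u) := by
  filter_upwards [hf, Measure.ae_ae_of_ae_prod (Lp.coeFn_smul c u)] with x h1 h3
  filter_upwards [h1, h3, Lp.coeFn_smul c (f x)] with y h1 h3 h4
  rw [h3, h4]; simp [h1]

theorem IsSlice.unique {f : X → Lp ℂ 2 ν} {u v : Lp ℂ 2 (μ.prod ν)} (hu : IsSlice f u)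
    (hv : IsSlice f v) : u = v := by
  have h := (hu.sub hv).lintegral_eq
  simp only [sub_self, enorm_zero, ne_eq, OfNat.ofNat_ne_zero, not_false_eq_true, zero_pow,
    lintegral_zero] at h
  have := pow_eq_zero_iff (two_ne_zero) |>.1 h.symm
  exact sub_eq_zero.1 (enorm_eq_zero.1 this)

theorem exists_isSlice_indicator [SFinite μ] (c : Lp ℂ 2 ν) {s : Set X} (hs : MeasurableSet s)
    (hμs : μ s < ⊤) :
    ∃ u : Lp ℂ 2 (μ.prod ν), IsSlice (s.indicator fun _ => c) u := by
  have hm : MemLp (fun p : X × Y => s.indicator (fun _ => (1 : ℂ)) p.1 * c p.2) 2 (μ.prod ν) := by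
    apply memLp_two_of_lintegral
    · refine AEStronglyMeasurable.mul ?_ ?_
      · exact ((measurable_const.indicator hs).comp measurable_fst).aestronglyMeasurable
      · exact (Lp.aestronglyMeasurable c).comp_snd
    · rw [lintegral_prod]
      · calc ∫⁻ x, ∫⁻ y, ‖s.indicator (fun _ => (1 : ℂ)) x * c y‖ₑ ^ 2 ∂ν ∂μ
            ≤ ∫⁻ x, s.indicator (fun _ => ‖c‖ₑ ^ 2) x ∂μ := by
              refine lintegral_mono fun x => ?_
              by_cases hx : x ∈ s
              · simp [hx, enorm_Lp_two_sq]
              · simp [hx]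
          _ < ⊤ := by
              rw [lintegral_indicator hs, lintegral_const]
              exact ENNReal.mul_lt_top (by finiteness) (by simpa using hμs)
      · refine (AEStronglyMeasurable.enorm ?_).pow_const 2
        refine AEStronglyMeasurable.mul ?_ ?_
        · exact ((measurable_const.indicator hs).comp measurable_fst).aestronglyMeasurable
        · exact (Lp.aestronglyMeasurable c).comp_snd
  refine ⟨hm.toLp _, ?_⟩
  filter_upwards [Measure.ae_ae_of_ae_prod hm.coeFn_toLp] with x hx
  by_cases hxs : x ∈ s
  · filter_upwards [hx] with y hy
    rw [hy]; simp [hxs]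
  · filter_upwards [hx, Lp.coeFn_zero ℂ 2 ν] with y hy h0
    rw [hy]; simp only [hxs, not_false_eq_true, indicator_of_notMem, zero_mul]
    exact h0.symm

theorem isClosed_isSlice [SFinite μ] :
    IsClosed {f : Lp (Lp ℂ 2 ν) 2 μ | ∃ u : Lp ℂ 2 (μ.prod ν), IsSlice f u} := by
  apply IsSeqClosed.isClosed
  intro f g hf hfg
  choose u hu using hf
  have hsub : ∀ m n, ‖u m - u n‖ₑ = ‖f m - f n‖ₑ := by
    intro m n
    have h1 := ((hu m).sub (hu n)).lintegral_eq
    have h2 := enorm_Lp_two_sq (f m - f n)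
    rw [lintegral_congr_ae (g := fun x => ‖f m x - f n x‖ₑ ^ 2), h1] at h2
    · exact ((ENNReal.pow_right_strictMono two_ne_zero).injective h2).symm
    · filter_upwards [Lp.coeFn_sub (f m) (f n)] with x hx
      rw [hx]; rfl
  have hcau : CauchySeq u := by
    have hc := hfg.cauchySeq
    rw [Metric.cauchySeq_iff] at hc ⊢
    intro ε hε
    obtain ⟨N, hN⟩ := hc ε hε
    refine ⟨N, fun m hm n hn => ?_⟩
    have := hN m hm n hn
    rw [dist_eq_norm] at this ⊢
    rwa [← toReal_enorm, hsub, toReal_enorm]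
  obtain ⟨v, hv⟩ := cauchySeq_tendsto_of_complete hcau
  refine ⟨v, ?_⟩
  obtain ⟨φ, hφ, h1⟩ := (tendstoInMeasure_of_tendsto_Lp hfg).exists_seq_tendsto_ae
  -- the slices converge along a further subsequence
  let w : ℕ → X → ℝ≥0∞ := fun n x => ∫⁻ y, ‖(u n - v) (x, y)‖ₑ ^ 2 ∂ν
  have hwm : ∀ n, Measurable (w n) := fun n =>
    ((Lp.stronglyMeasurable (u n - v)).enorm.pow_const 2).lintegral_prod_right'
  have hw : ∀ n, ∫⁻ x, w n x ∂μ = ‖u n - v‖ₑ ^ 2 := fun n => (lintegral_enorm_prod_sq _).symm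
  have hlim : Tendsto (fun n => ∫⁻ x, w (φ n) x ∂μ) atTop (𝓝 0) := by
    simp_rw [hw]
    have : Tendsto (fun n => ‖u (φ n) - v‖ₑ) atTop (𝓝 0) := by
      have := (tendsto_iff_enorm_sub_tendsto_zero.1 hv).comp hφ.tendsto_atTop
      exact this
    simpa using ENNReal.Tendsto.pow (n := 2) this
  have h2 : ∀ᵐ x ∂μ, liminf (fun n => w (φ n) x) atTop = 0 := by
    have hle : ∫⁻ x, liminf (fun n => w (φ n) x) atTop ∂μ ≤ 0 :=
      (lintegral_liminf_le fun n => hwm (φ n)).trans_eq hlim.liminf_eq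
    have := (lintegral_eq_zero_iff (Measurable.liminf fun n => hwm (φ n))).1
      (le_antisymm hle zero_le)
    exact this
  have hall : ∀ᵐ x ∂μ, ∀ n, ∀ᵐ y ∂ν, u n (x, y) = f n x y := ae_all_iff.2 fun n => hu n
  have hall2 : ∀ᵐ x ∂μ, ∀ n, ∀ᵐ y ∂ν, (u n - v) (x, y) = u n (x, y) - v (x, y) :=
    ae_all_iff.2 fun n => Measure.ae_ae_of_ae_prod (Lp.coeFn_sub (u n) v)
  have hvm : ∀ᵐ x ∂μ, AEStronglyMeasurable (fun y => v (x, y)) ν :=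
    (Lp.aestronglyMeasurable v).prodMk_left
  filter_upwards [h1, h2, hall, hall2, hvm] with x h1 h2 h3 h4 h5
  have hz : ∫⁻ y, ‖v (x, y) - g x y‖ₑ ^ 2 ∂ν = 0 := by
    have hb : ∀ n, ∫⁻ y, ‖v (x, y) - g x y‖ₑ ^ 2 ∂ν ≤
        2 * (w (φ n) x + ‖f (φ n) x - g x‖ₑ ^ 2) := by
      intro n
      rw [enorm_Lp_two_sq, ← lintegral_add_right', ← lintegral_const_mul']
      · refine lintegral_mono_ae ?_
        filter_upwards [h3 (φ n), h4 (φ n), Lp.coeFn_sub (f (φ n) x) (g x)]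
          with y a b c
        rw [b, c, Pi.sub_apply, a]
        set p := f (φ n) x y
        calc ‖v (x, y) - g x y‖ₑ ^ 2 = ‖(p - g x y) - (p - v (x, y))‖ₑ ^ 2 := by congr 2; ring
          _ ≤ (‖p - g x y‖ₑ + ‖p - v (x, y)‖ₑ) ^ 2 := by gcongr; exact enorm_sub_le
          _ ≤ 2 * (‖p - v (x, y)‖ₑ ^ 2 + ‖p - g x y‖ₑ ^ 2) := by
            rw [add_comm]
            have := ENNReal.rpow_add_le_mul_rpow_add_rpow ‖p - v (x, y)‖ₑ ‖p - g x y‖ₑ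
              (p := 2) (by norm_num)
            norm_num at this
            exact this
      · simp
      · exact (Lp.aestronglyMeasurable _).enorm.pow_const 2
    by_contra hne
    set I := ∫⁻ y, ‖v (x, y) - g x y‖ₑ ^ 2 ∂ν
    have hpos : 0 < min (I / 8) 1 := by
      refine lt_min (ENNReal.div_pos hne (by simp)) one_pos
    have he : ∀ᶠ n in atTop, ‖f (φ n) x - g x‖ₑ ^ 2 < min (I / 8) 1 := by
      have h0 : Tendsto (fun n => ‖f (φ n) x - g x‖ₑ ^ 2) atTop (𝓝 0) := by
        simpa using ENNReal.Tendsto.pow (n := 2) (tendsto_iff_enorm_sub_tendsto_zero.1 h1)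
      exact h0.eventually (gt_mem_nhds hpos)
    have hf : ∃ᶠ n in atTop, w (φ n) x < min (I / 8) 1 :=
      frequently_lt_of_liminf_lt (by isBoundedDefault) (h2 ▸ hpos)
    obtain ⟨n, hn1, hn2⟩ := (hf.and_eventually he).exists
    have hI : I ≤ 2 * (I / 8 + I / 8) := (hb n).trans (by
      gcongr
      · exact hn1.le.trans (min_le_left _ _)
      · exact hn2.le.trans (min_le_left _ _))
    have hI1 : I ≠ ⊤ := by
      refine ne_top_of_le_ne_top ?_ (hb n)
      exact ENNReal.mul_ne_top (by simp) (ENNReal.add_ne_top.2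
        ⟨ne_top_of_lt hn1, ne_top_of_lt hn2⟩)
    have hIr := (ENNReal.toReal_le_toReal hI1 (by finiteness)).2 hI
    have hI0 : 0 < I.toReal := ENNReal.toReal_pos hne hI1
    rw [ENNReal.toReal_mul, ENNReal.toReal_add (by finiteness) (by finiteness),
      ENNReal.toReal_div] at hIr
    norm_num at hIr
    linarith
  rw [lintegral_eq_zero_iff'] at hz
  · filter_upwards [hz] with y hy
    simpa [sub_eq_zero] using hy
  · exact (h5.sub (Lp.aestronglyMeasurable _)).enorm.pow_const 2

theorem exists_isSlice [SFinite μ] (f : Lp (Lp ℂ 2 ν) 2 μ) :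
    ∃ u : Lp ℂ 2 (μ.prod ν), IsSlice f u := by
  refine Lp.induction (p := 2) ENNReal.ofNat_ne_top
    (fun f : Lp (Lp ℂ 2 ν) 2 μ => ∃ u : Lp ℂ 2 (μ.prod ν), IsSlice f u) ?_ ?_ isClosed_isSlice f
  · intro c s hs hμs
    obtain ⟨u, hu⟩ := exists_isSlice_indicator (μ := μ) c hs hμs
    refine ⟨u, hu.congr ?_⟩
    rw [Lp.simpleFunc.coe_indicatorConst]
    exact indicatorConstLp_coeFn.symm
  · rintro f g hf hg _ ⟨u, hu⟩ ⟨v, hv⟩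
    refine ⟨u + v, (hu.add hv).congr ?_⟩
    exact (Lp.coeFn_add _ _).symm

/-- The isometric embedding of `L²(X; L²(Y))` into `L²(X × Y)`. -/
def sliceEmbedding (μ : Measure X) (ν : Measure Y) [SFinite μ] [SFinite ν] :
    Lp (Lp ℂ 2 ν) 2 μ →ₗᵢ[ℂ] Lp ℂ 2 (μ.prod ν) where
  toFun f := (exists_isSlice f).choose
  map_add' f g := by
    refine (exists_isSlice (f + g)).choose_spec.unique ?_
    exact ((exists_isSlice f).choose_spec.add (exists_isSlice g).choose_spec).congr
      (Lp.coeFn_add _ _).symm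
  map_smul' c f := by
    refine (exists_isSlice (c • f)).choose_spec.unique ?_
    exact ((exists_isSlice f).choose_spec.smul c).congr (Lp.coeFn_smul c f).symm
  norm_map' f := by
    have := (exists_isSlice f).choose_spec.lintegral_eq
    rw [← enorm_Lp_two_sq] at this
    have := (ENNReal.pow_right_strictMono two_ne_zero).injective this
    rw [← toReal_enorm, ← toReal_enorm, this]
    rfl

theorem sliceEmbedding_isSlice [SFinite μ] (f : Lp (Lp ℂ 2 ν) 2 μ) :
    IsSlice f (sliceEmbedding μ ν f) :=
  (exists_isSlice f).choose_spec

end Slices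

end PML

namespace PML

section MidpointConvex

theorem le_add_of_midpoint_convex {μ : ℝ → ℝ} {a b B : ℝ} (hab : a ≤ b)
    (h0 : ∀ x ∈ Icc a b, 0 ≤ μ x) (hB : ∀ x ∈ Icc a b, μ x ≤ B)
    (hm : ∀ x ∈ Icc a b, ∀ y ∈ Icc a b, 2 * μ ((x + y) / 2) ≤ μ x + μ y) :
    ∀ x ∈ Icc a b, μ x ≤ μ a + μ b := by
  set M := sSup (μ '' Icc a b)
  have hbdd : BddAbove (μ '' Icc a b) := ⟨B, by rintro _ ⟨x, hx, rfl⟩; exact hB x hx⟩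
  have hle : ∀ x ∈ Icc a b, μ x ≤ M := fun x hx => le_csSup hbdd (mem_image_of_mem _ hx)
  have ha : a ∈ Icc a b := left_mem_Icc.2 hab
  have hb : b ∈ Icc a b := right_mem_Icc.2 hab
  have hhalf : ∀ x ∈ Icc a b, μ x ≤ (μ a + μ b + M) / 2 := by
    intro x hx
    rcases le_total x ((a + b) / 2) with h | h
    · have hy : 2 * x - a ∈ Icc a b := ⟨by linarith [hx.1], by linarith⟩
      have h1 := hm a ha _ hy
      rw [show (a + (2 * x - a)) / 2 = x by ring] at h1
      linarith [hle _ hy, h0 b hb]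
    · have hy : 2 * x - b ∈ Icc a b := ⟨by linarith, by linarith [hx.2]⟩
      have h1 := hm b hb _ hy
      rw [show (b + (2 * x - b)) / 2 = x by ring] at h1
      linarith [hle _ hy, h0 a ha]
  have hM : M ≤ (μ a + μ b + M) / 2 := by
    refine csSup_le ⟨_, mem_image_of_mem _ ha⟩ ?_
    rintro _ ⟨x, hx, rfl⟩
    exact hhalf x hx
  intro x hx
  linarith [hle x hx]

theorem exists_tendsto_of_midpoint_convex {μ : ℝ → ℝ} {a b B : ℝ} (hab : a < b)
    (h0 : ∀ x ∈ Ioo a b, 0 ≤ μ x) (hB : ∀ x ∈ Ioo a b, μ x ≤ B)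
    (hm : ∀ x ∈ Ioo a b, ∀ y ∈ Ioo a b, 2 * μ ((x + y) / 2) ≤ μ x + μ y) :
    ∃ L, Tendsto μ (𝓝[<] b) (𝓝 L) := by
  have hev : ∀ c < b, ∀ᶠ x in 𝓝[<] b, x ∈ Ioo c b := fun c hc => Ioo_mem_nhdsLT hc
  have hbd1 : (𝓝[<] b).IsBoundedUnder (· ≤ ·) μ :=
    ⟨B, by simpa using (hev a hab).mono hB⟩
  have hbd2 : (𝓝[<] b).IsBoundedUnder (· ≥ ·) μ :=
    ⟨0, by simpa using (hev a hab).mono h0⟩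
  refine ⟨limsup μ (𝓝[<] b), tendsto_of_le_liminf_of_limsup_le ?_ le_rfl hbd1 hbd2⟩
  by_contra! hlt
  set L := limsup μ (𝓝[<] b)
  set l := liminf μ (𝓝[<] b)
  set ε := (L - l) / 8
  have hε : 0 < ε := by simp only [ε]; linarith
  have h1 : ∀ᶠ x in 𝓝[<] b, μ x < L + ε :=
    eventually_lt_of_limsup_lt (by linarith) hbd1
  obtain ⟨c, hc, hcb⟩ := (mem_nhdsLT_iff_exists_Ioo_subset (a := b)).1 h1
  set c' := max a c
  have hc' : c' < b := max_lt hab hc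
  have h2 : ∃ᶠ x in 𝓝[<] b, L - ε < μ x :=
    frequently_lt_of_lt_limsup hbd2.isCobounded_flip (by linarith)
  obtain ⟨x, hx1, hx2⟩ := (h2.and_eventually (hev (b - (b - c') / 3) (by linarith))).exists
  have h3 : ∃ᶠ y in 𝓝[<] b, μ y < l + ε :=
    frequently_lt_of_liminf_lt hbd1.isCobounded_flip (by linarith)
  obtain ⟨y, hy1, hy2⟩ := (h3.and_eventually (hev x hx2.2)).exists
  have hca : a ≤ c' := le_max_left _ _
  have hcc : c ≤ c' := le_max_right _ _
  have hz1 : c' < 2 * x - y := by linarith [hx2.1, hy2.2]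
  have hz2 : 2 * x - y < b := by linarith [hy2.1, hx2.2]
  have h4 := hm (2 * x - y) ⟨by linarith, hz2⟩ y ⟨by linarith [hx2.1, hy2.1], hy2.2⟩
  rw [show (2 * x - y + y) / 2 = x by ring] at h4
  have h5 : μ (2 * x - y) < L + ε := hcb ⟨by linarith, hz2⟩
  have : L - l = 8 * ε := by simp only [ε]; ring
  linarith

variable {V : Type*} [NormedAddCommGroup V] [CompleteSpace V]

theorem exists_tendsto_left_of_parallelogram {g : ℝ → V} {a b B : ℝ} (hab : a < b)
    (hB : ∀ x ∈ Ioo a b, ‖g x‖ ^ 2 ≤ B)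
    (hm : ∀ x ∈ Ioo a b, ∀ y ∈ Ioo a b,
      ‖g x - g y‖ ^ 2 + 2 * ‖g ((x + y) / 2)‖ ^ 2 = ‖g x‖ ^ 2 + ‖g y‖ ^ 2) :
    ∃ v, Tendsto g (𝓝[<] b) (𝓝 v) := by
  obtain ⟨L, hL⟩ := exists_tendsto_of_midpoint_convex (μ := fun x => ‖g x‖ ^ 2) hab
    (fun x _ => by positivity) hB
    (fun x hx y hy => by have := hm x hx y hy; nlinarith [sq_nonneg ‖g x - g y‖])
  apply cauchy_map_iff_exists_tendsto.1
  rw [Metric.cauchy_iff]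
  refine ⟨inferInstance, fun ε hε => ?_⟩
  have h1 : ∀ᶠ x in 𝓝[<] b, ‖g x‖ ^ 2 ∈ Ioo (L - ε ^ 2 / 4) (L + ε ^ 2 / 4) :=
    hL (Ioo_mem_nhds (by nlinarith) (by nlinarith))
  obtain ⟨c, hc, hcb⟩ := (mem_nhdsLT_iff_exists_Ioo_subset (a := b)).1 h1
  have hc' : max a c < b := max_lt hab hc
  refine ⟨g '' Ioo (max a c) b, image_mem_map (Ioo_mem_nhdsLT hc'), ?_⟩
  rintro _ ⟨x, hx, rfl⟩ _ ⟨y, hy, rfl⟩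
  have hsub : ∀ z ∈ Ioo (max a c) b, z ∈ Ioo a b ∧ z ∈ Ioo c b := fun z hz =>
    ⟨⟨(le_max_left _ _).trans_lt hz.1, hz.2⟩, ⟨(le_max_right _ _).trans_lt hz.1, hz.2⟩⟩
  have hz : (x + y) / 2 ∈ Ioo (max a c) b := ⟨by linarith [hx.1, hy.1], by linarith [hx.2, hy.2]⟩
  have h2 := hm x (hsub x hx).1 y (hsub y hy).1
  have hx' := hcb (hsub x hx).2
  have hy' := hcb (hsub y hy).2
  have hz' := hcb (hsub _ hz).2
  rw [dist_eq_norm]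
  apply lt_of_pow_lt_pow_left₀ 2 hε.le
  simp only [mem_Ioo] at hx' hy' hz'
  linarith [hx'.2, hy'.2, hz'.1]

theorem exists_tendsto_right_of_parallelogram {g : ℝ → V} {a b B : ℝ} (hab : a < b)
    (hB : ∀ x ∈ Ioo a b, ‖g x‖ ^ 2 ≤ B)
    (hm : ∀ x ∈ Ioo a b, ∀ y ∈ Ioo a b,
      ‖g x - g y‖ ^ 2 + 2 * ‖g ((x + y) / 2)‖ ^ 2 = ‖g x‖ ^ 2 + ‖g y‖ ^ 2) :
    ∃ v, Tendsto g (𝓝[>] a) (𝓝 v) := by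
  have hn : ∀ x ∈ Ioo (-b) (-a), -x ∈ Ioo a b := fun x hx =>
    ⟨by linarith [hx.2], by linarith [hx.1]⟩
  obtain ⟨v, hv⟩ := exists_tendsto_left_of_parallelogram (g := fun x => g (-x))
    (neg_lt_neg hab) (fun x hx => hB _ (hn x hx)) (fun x hx y hy => by
      have := hm _ (hn x hx) _ (hn y hy)
      rwa [show (-x + -y) / 2 = -((x + y) / 2) by ring] at this)
  refine ⟨v, ?_⟩
  have ht : Tendsto (fun x : ℝ => -x) (𝓝[>] a) (𝓝[<] (-a)) := by
    exact tendsto_neg_nhdsGT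
  have := hv.comp ht
  simpa [Function.comp_def] using this

end MidpointConvex

section Strip

theorem integral_eq_integral_of_differentiableOn_strip {f : ℂ → ℂ} {y₁ y₂ : ℝ} (hy : y₁ ≤ y₂)
    (hf : DifferentiableOn ℂ f {z | z.im ∈ Icc y₁ y₂}) {C : ℝ≥0}
    (hC : ∀ y ∈ Icc y₁ y₂, ∫⁻ t : ℝ, ‖f (t + y * Complex.I)‖ₑ ≤ C) :
    ∫ t : ℝ, f (t + y₁ * Complex.I) = ∫ t : ℝ, f (t + y₂ * Complex.I) := by
  have hcont : ContinuousOn (fun p : ℝ × ℝ => f (p.1 + p.2 * Complex.I)) (univ ×ˢ Icc y₁ y₂) := by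
    refine hf.continuousOn.comp (by fun_prop) ?_
    rintro ⟨t, y⟩ ⟨_, h⟩
    simpa using h
  have hline : ∀ y ∈ Icc y₁ y₂, Continuous fun t : ℝ => f (t + y * Complex.I) := by
    intro y hy
    refine hcont.comp_continuous (f := fun t : ℝ => (t, y)) (by fun_prop) ?_
    intro t; exact ⟨mem_univ _, hy⟩
  have hint : ∀ y ∈ Icc y₁ y₂, Integrable fun t : ℝ => f (t + y * Complex.I) := by
    intro y hy
    refine ⟨(hline y hy).aestronglyMeasurable, ?_⟩
    exact (hC y hy).trans_lt ENNReal.coe_lt_top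
  have h1 : y₁ ∈ Icc y₁ y₂ := left_mem_Icc.2 hy
  have h2 : y₂ ∈ Icc y₁ y₂ := right_mem_Icc.2 hy
  set R : ℝ → ℂ := fun T => (∫ t in (-T)..T, f (t + y₁ * Complex.I)) -
    ∫ t in (-T)..T, f (t + y₂ * Complex.I)
  set E : ℝ → ℝ≥0∞ := fun T => ∫⁻ y in Icc y₁ y₂, ‖f (T + y * Complex.I)‖ₑ
  have hR : Tendsto R atTop (𝓝 ((∫ t : ℝ, f (t + y₁ * Complex.I)) -
      ∫ t : ℝ, f (t + y₂ * Complex.I))) :=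
    (intervalIntegral_tendsto_integral (hint _ h1) tendsto_neg_atTop_atBot tendsto_id).sub
      (intervalIntegral_tendsto_integral (hint _ h2) tendsto_neg_atTop_atBot tendsto_id)
  have hside : ∀ T : ℝ, ‖∫ y in y₁..y₂, f (T + y * Complex.I)‖ₑ ≤ E T := by
    intro T
    rw [intervalIntegral.integral_of_le hy]
    refine (enorm_integral_le_lintegral_enorm _).trans ?_
    exact lintegral_mono_set Ioc_subset_Icc_self
  have hRE : ∀ T, ‖R T‖ₑ ≤ E T + E (-T) := by
    intro T
    have h := Complex.integral_boundary_rect_eq_zero_of_differentiableOn f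
      ⟨-T, y₁⟩ ⟨T, y₂⟩ (hf.mono (by
        rintro z hz
        rw [Complex.mem_reProdIm] at hz
        simpa [uIcc_of_le hy] using hz.2))
    simp only [Complex.ofReal_neg] at h
    have hR' : R T = Complex.I • (∫ y in y₁..y₂, f (((-T : ℝ) : ℂ) + y * Complex.I)) -
        Complex.I • ∫ y in y₁..y₂, f ((T : ℂ) + y * Complex.I) := by
      simp only [R, Complex.ofReal_neg]
      linear_combination h
    rw [hR', add_comm]
    refine enorm_sub_le.trans ?_
    rw [enorm_smul, enorm_smul]
    have hI : ‖Complex.I‖ₑ = 1 := by rw [← ofReal_norm]; simp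
    rw [hI, one_mul, one_mul]
    exact add_le_add (hside _) (hside _)
  have hEint : ∫⁻ T : ℝ, E T < ⊤ := by
    have : ∫⁻ T : ℝ, E T = ∫⁻ y in Icc y₁ y₂, ∫⁻ T : ℝ, ‖f (T + y * Complex.I)‖ₑ := by
      refine lintegral_lintegral_swap ?_
      have : AEMeasurable (fun p : ℝ × ℝ => f (p.1 + p.2 * Complex.I))
          ((volume : Measure (ℝ × ℝ)).restrict (univ ×ˢ Icc y₁ y₂)) :=
        hcont.aemeasurable (MeasurableSet.univ.prod measurableSet_Icc)
      rw [Measure.volume_eq_prod, ← Measure.prod_restrict, Measure.restrict_univ] at this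
      exact this.enorm
    rw [this]
    calc ∫⁻ y in Icc y₁ y₂, ∫⁻ T : ℝ, ‖f (T + y * Complex.I)‖ₑ
        ≤ ∫⁻ y in Icc y₁ y₂, (C : ℝ≥0∞) := setLIntegral_mono measurable_const hC
      _ < ⊤ := by simp [ENNReal.mul_lt_top]
  by_contra hne
  set L := (∫ t : ℝ, f (t + y₁ * Complex.I)) - ∫ t : ℝ, f (t + y₂ * Complex.I)
  have hL : 0 < ‖L‖ := norm_pos_iff.2 (sub_ne_zero.2 hne)
  have hev : ∀ᶠ T in atTop, ‖L‖ / 2 < ‖R T‖ := hR.norm.eventually (lt_mem_nhds (by linarith))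
  obtain ⟨T₀, hT₀⟩ := eventually_atTop.1 hev
  have hEm : ∫⁻ T : ℝ, (E T + E (-T)) ≤ (∫⁻ T : ℝ, E T) + ∫⁻ T : ℝ, E T := by
    have hmeas : AEMeasurable E := by
      have : AEMeasurable (fun p : ℝ × ℝ => f (p.1 + p.2 * Complex.I))
          ((volume : Measure (ℝ × ℝ)).restrict (univ ×ˢ Icc y₁ y₂)) :=
        hcont.aemeasurable (MeasurableSet.univ.prod measurableSet_Icc)
      rw [Measure.volume_eq_prod, ← Measure.prod_restrict, Measure.restrict_univ] at this
      exact this.enorm.lintegral_prod_right'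
    rw [lintegral_add_left' hmeas, lintegral_neg_eq_self E]
  have htop : ∫⁻ T : ℝ, (E T + E (-T)) = ⊤ := by
    rw [eq_top_iff]
    calc ⊤ = ∫⁻ T in Ioi T₀, ENNReal.ofReal (‖L‖ / 2) := by
          rw [setLIntegral_const, Real.volume_Ioi, ENNReal.mul_top]
          simpa using hL
      _ ≤ ∫⁻ T in Ioi T₀, (E T + E (-T)) := by
          refine setLIntegral_mono' measurableSet_Ioi fun T hT => ?_
          refine le_trans ?_ (hRE T)
          rw [← ofReal_norm]
          exact ENNReal.ofReal_le_ofReal (hT₀ T (le_of_lt hT)).le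
      _ ≤ _ := setLIntegral_le_lintegral _ _
  rw [htop, top_le_iff] at hEm
  exact (ENNReal.add_lt_top.2 ⟨hEint, hEint⟩).ne hEm

end Strip
end PML

namespace PML

variable {H : Type*} [NormedAddCommGroup H]

/-- The open strip `{|Im w| < a}`. -/
def strip (a : ℝ) : Set ℂ := {w | |w.im| < a}

theorem isOpen_strip (a : ℝ) : IsOpen (strip a) :=
  isOpen_lt (by fun_prop) continuous_const

/-- The square of the `L²` norm of `G` along the horizontal line `Im w = ψ`. -/
def lineNormSq (G : ℂ → H) (ψ : ℝ) : ℝ≥0∞ := ∫⁻ t : ℝ, ‖G (t + ψ * Complex.I)‖ₑ ^ 2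

variable [InnerProductSpace ℂ H]

/-- The Hardy class of the strip `{|Im w| < a}`. -/
structure StripHardy (a : ℝ) (G : ℂ → H) : Prop where
  diff : DifferentiableOn ℂ G (strip a)
  bound : ∃ C : ℝ≥0, ∀ ψ, |ψ| < a → lineNormSq G ψ ≤ C

theorem line_mem_strip {a ψ : ℝ} (hψ : |ψ| < a) (t : ℝ) : (t + ψ * Complex.I : ℂ) ∈ strip a := by
  simpa [strip] using hψ

theorem StripHardy.mono {a b : ℝ} {G : ℂ → H} (h : StripHardy a G) (hba : b ≤ a) :
    StripHardy b G := by
  obtain ⟨C, hC⟩ := h.bound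
  exact ⟨h.diff.mono fun w hw => lt_of_lt_of_le hw hba, C, fun ψ hψ => hC ψ (hψ.trans_le hba)⟩

theorem StripHardy.continuous_line {a ψ : ℝ} {G : ℂ → H} (h : StripHardy a G) (hψ : |ψ| < a) :
    Continuous fun t : ℝ => G (t + ψ * Complex.I) :=
  h.diff.continuousOn.comp_continuous (by fun_prop) (line_mem_strip hψ)

theorem StripHardy.comp_neg {a : ℝ} {G : ℂ → H} (h : StripHardy a G) :
    StripHardy a fun w => G (-w) := by
  obtain ⟨C, hC⟩ := h.bound
  refine ⟨h.diff.comp (by fun_prop) (fun w hw => by simpa [strip] using hw), C, fun ψ hψ => ?_⟩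
  refine le_trans (le_of_eq ?_) (hC (-ψ) (by simpa using hψ))
  unfold lineNormSq
  rw [← lintegral_neg_eq_self]
  congr 1; ext t; congr 3; push_cast; ring_nf

theorem StripHardy.smul {a : ℝ} {G : ℂ → H} (h : StripHardy a G) {m : ℂ → ℂ}
    (hm : DifferentiableOn ℂ m (strip a)) {K : ℝ≥0} (hK : ∀ w ∈ strip a, ‖m w‖ ≤ K) :
    StripHardy a fun w => m w • G w := by
  obtain ⟨C, hC⟩ := h.bound
  refine ⟨hm.smul h.diff, K ^ 2 * C, fun ψ hψ => ?_⟩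
  unfold lineNormSq
  calc ∫⁻ t : ℝ, ‖m (t + ψ * Complex.I) • G (t + ψ * Complex.I)‖ₑ ^ 2
      ≤ ∫⁻ t : ℝ, (K : ℝ≥0∞) ^ 2 * ‖G (t + ψ * Complex.I)‖ₑ ^ 2 := by
        refine lintegral_mono fun t => ?_
        rw [enorm_smul, mul_pow]
        gcongr
        have := hK _ (line_mem_strip hψ t)
        rw [enorm_eq_nnnorm]
        exact_mod_cast this
    _ ≤ ((K ^ 2 * C : ℝ≥0) : ℝ≥0∞) := by
        rw [lintegral_const_mul' _ _ (by finiteness)]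
        push_cast
        gcongr
        exact hC ψ hψ

theorem hasDerivAt_innerSL_comp_conj {G : ℂ → H} {z c : ℂ} {G' : H}
    (h : HasDerivAt G G' (starRingEnd ℂ z + c)) :
    HasDerivAt (fun w => innerSL ℂ (G (starRingEnd ℂ w + c))) (innerSL ℂ G') z := by
  rw [hasDerivAt_iff_isLittleO, Asymptotics.isLittleO_iff] at h ⊢
  intro ε hε
  have ht : Tendsto (fun w => starRingEnd ℂ w + c) (𝓝 z) (𝓝 (starRingEnd ℂ z + c)) :=
    Continuous.tendsto (by fun_prop) z
  filter_upwards [ht.eventually (h hε)] with w hw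
  rw [add_sub_add_right_eq_sub, ← map_sub, RCLike.norm_conj] at hw
  refine le_trans (le_of_eq ?_) hw
  rw [← innerSL_apply_norm ℂ (_ - _ - (starRingEnd ℂ) (w - z) • G'), map_sub, map_sub, map_smulₛₗ]
  simp

/-- The sesquilinear contour shift: `∫ ⟪G(t + ip), G(t + iq)⟫ dt` only depends on `p + q`. -/
theorem StripHardy.integral_inner {a : ℝ} {G : ℂ → H} (h : StripHardy a G) {p q : ℝ}
    (hp : |p| < a) (hq : |q| < a) (hpq : p ≤ q) :
    ∫ t : ℝ, inner ℂ (G (t + p * Complex.I)) (G (t + q * Complex.I)) =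
      ∫ t : ℝ, inner ℂ (G (t + ((p + q) / 2 : ℝ) * Complex.I))
        (G (t + ((p + q) / 2 : ℝ) * Complex.I)) := by
  obtain ⟨C, hC⟩ := h.bound
  rw [abs_lt] at hp hq
  set c : ℝ := (p + q) / 2
  set f : ℂ → ℂ := fun w =>
    innerSL ℂ (G (starRingEnd ℂ w + c * Complex.I)) (G (w + c * Complex.I))
  have hη : 0 ≤ (q - p) / 2 := by linarith
  have hconj : ∀ t y : ℝ, starRingEnd ℂ (t + y * Complex.I) + c * Complex.I =
      t + (c - y : ℝ) * Complex.I := by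
    intro t y; simp; ring
  have hplus : ∀ t y : ℝ, (t + y * Complex.I + c * Complex.I : ℂ) =
      t + (c + y : ℝ) * Complex.I := by
    intro t y; push_cast; ring
  have hab : ∀ y ∈ Icc 0 ((q - p) / 2), |c - y| < a ∧ |c + y| < a := by
    intro y hy
    have := hy.1; have := hy.2
    simp only [abs_lt, c]
    refine ⟨⟨?_, ?_⟩, ⟨?_, ?_⟩⟩ <;> linarith
  have key := integral_eq_integral_of_differentiableOn_strip (f := f) hη (C := C + C) ?_ ?_
  · simp only [f, hconj, hplus, innerSL_apply_apply] at key
    simp only [sub_zero, add_zero] at key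
    rw [key]
    congr! 7 <;> simp only [c] <;> ring
  · intro z hz
    have hz1 := hab z.im hz
    have hd : ∀ w ∈ strip a, HasDerivAt G (deriv G w) w := fun w hw =>
      (h.diff.differentiableAt ((isOpen_strip a).mem_nhds hw)).hasDerivAt
    have hm1 : starRingEnd ℂ z + c * Complex.I ∈ strip a := by
      have : (starRingEnd ℂ z + c * Complex.I).im = c - z.im := by simp; ring
      show |_| < a
      rw [this]; exact hz1.1
    have hm2 : z + c * Complex.I ∈ strip a := by
      have : (z + c * Complex.I).im = c + z.im := by simp; ring
      show |_| < a
      rw [this]; exact hz1.2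
    have h1 := hasDerivAt_innerSL_comp_conj (hd _ hm1)
    have h2 : HasDerivAt (fun w => G (w + c * Complex.I)) (deriv G (z + c * Complex.I)) z := by
      have := (hd _ hm2).comp_add_const z (c * Complex.I)
      exact this
    exact (h1.clm_apply h2).differentiableAt.differentiableWithinAt
  · intro y hy
    have hy1 := hab y hy
    calc ∫⁻ t : ℝ, ‖f (t + y * Complex.I)‖ₑ
        ≤ ∫⁻ t : ℝ, (‖G (t + (c - y : ℝ) * Complex.I)‖ₑ ^ 2 +
            ‖G (t + (c + y : ℝ) * Complex.I)‖ₑ ^ 2) := by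
          refine lintegral_mono fun t => ?_
          simp only [f, hconj, hplus, innerSL_apply_apply]
          set u := G (t + (c - y : ℝ) * Complex.I)
          set v := G (t + (c + y : ℝ) * Complex.I)
          have h1 : ‖inner ℂ u v‖ ≤ ‖u‖ ^ 2 + ‖v‖ ^ 2 :=
            (norm_inner_le_norm u v).trans (by nlinarith [sq_nonneg (‖u‖ - ‖v‖)])
          rw [← ofReal_norm, ← ofReal_norm, ← ofReal_norm, ← ENNReal.ofReal_pow (by positivity),
            ← ENNReal.ofReal_pow (by positivity), ← ENNReal.ofReal_add (by positivity)
            (by positivity)]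
          exact ENNReal.ofReal_le_ofReal h1
      _ ≤ ((C + C : ℝ≥0) : ℝ≥0∞) := by
          rw [lintegral_add_left' ((h.continuous_line hy1.1).enorm.measurable.pow_const 2).aemeasurable]
          rw [ENNReal.coe_add]
          exact add_le_add (hC (c - y) hy1.1) (hC (c + y) hy1.2)

theorem StripHardy.memLp_line {a ψ : ℝ} {G : ℂ → H} (h : StripHardy a G) (hψ : |ψ| < a) :
    MemLp (fun t : ℝ => G (t + ψ * Complex.I)) 2 volume := by
  obtain ⟨C, hC⟩ := h.bound
  exact memLp_two_of_lintegral (h.continuous_line hψ).aestronglyMeasurable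
    ((hC ψ hψ).trans_lt ENNReal.coe_lt_top)

theorem StripHardy.parallelogram_of_le {a : ℝ} {G : ℂ → H} (h : StripHardy a G) {p q : ℝ}
    (hp : |p| < a) (hq : |q| < a) (hpq : p ≤ q) :
    (∫⁻ t : ℝ, ‖G (t + p * Complex.I) - G (t + q * Complex.I)‖ₑ ^ 2) +
      2 * lineNormSq G ((p + q) / 2) = lineNormSq G p + lineNormSq G q := by
  have hc : |(p + q) / 2| < a := by
    rw [abs_lt] at *; constructor <;> linarith [hp.1, hq.1, hp.2, hq.2]
  have mp := h.memLp_line hp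
  have mq := h.memLp_line hq
  have mc := h.memLp_line hc
  have hi := h.integral_inner hp hq hpq
  set P := mp.toLp _
  set Q := mq.toLp _
  set R := mc.toLp _
  have e1 : inner ℂ P Q = inner ℂ R R := by
    rw [L2.inner_def, L2.inner_def]
    rw [integral_congr_ae (g := fun t : ℝ => inner ℂ (G (t + p * Complex.I))
        (G (t + q * Complex.I))), hi]
    · refine integral_congr_ae ?_
      filter_upwards [mc.coeFn_toLp] with t ht
      rw [ht]
    · filter_upwards [mp.coeFn_toLp, mq.coeFn_toLp] with t h1 h2
      rw [h1, h2]
  have e2 : ‖P - Q‖ ^ 2 + 2 * ‖R‖ ^ 2 = ‖P‖ ^ 2 + ‖Q‖ ^ 2 := by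
    have h1 := norm_sub_sq (𝕜 := ℂ) P Q
    rw [e1, inner_self_eq_norm_sq] at h1
    linarith
  have e3 : ‖P - Q‖ₑ ^ 2 + 2 * ‖R‖ₑ ^ 2 = ‖P‖ₑ ^ 2 + ‖Q‖ₑ ^ 2 := by
    have h1 := congrArg ENNReal.ofReal e2
    rw [ENNReal.ofReal_add (by positivity) (by positivity),
      ENNReal.ofReal_add (by positivity) (by positivity), ENNReal.ofReal_mul (by positivity),
      ENNReal.ofReal_pow (by positivity), ENNReal.ofReal_pow (by positivity),
      ENNReal.ofReal_pow (by positivity), ENNReal.ofReal_pow (by positivity)] at h1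
    simpa [ofReal_norm] using h1
  have e4 : P - Q = (mp.sub mq).toLp _ := (MemLp.toLp_sub mp mq).symm
  rw [e4, enorm_toLp_two_sq, enorm_toLp_two_sq, enorm_toLp_two_sq, enorm_toLp_two_sq] at e3
  exact e3

theorem StripHardy.parallelogram {a : ℝ} {G : ℂ → H} (h : StripHardy a G) {p q : ℝ}
    (hp : |p| < a) (hq : |q| < a) :
    (∫⁻ t : ℝ, ‖G (t + p * Complex.I) - G (t + q * Complex.I)‖ₑ ^ 2) +
      2 * lineNormSq G ((p + q) / 2) = lineNormSq G p + lineNormSq G q := by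
  rcases le_total p q with hpq | hpq
  · exact h.parallelogram_of_le hp hq hpq
  · have := h.parallelogram_of_le hq hp hpq
    simp_rw [enorm_sub_rev (G (_ + p * Complex.I))]
    rw [add_comm p q, this, add_comm]

/-- The norm on a line between two symmetric lines is controlled by the outer lines. -/
theorem StripHardy.lineNormSq_le {a b ψ : ℝ} {G : ℂ → H} (h : StripHardy a G) (hb : b < a)
    (hψ : |ψ| ≤ b) : lineNormSq G ψ ≤ lineNormSq G (-b) + lineNormSq G b := by
  obtain ⟨C, hC⟩ := h.bound
  have hin : ∀ x ∈ Icc (-b) b, |x| < a := fun x hx => (abs_le.2 hx).trans_lt hb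
  have hfin : ∀ x ∈ Icc (-b) b, lineNormSq G x ≠ ⊤ := fun x hx =>
    ((hC x (hin x hx)).trans_lt ENNReal.coe_lt_top).ne
  have hb0 : -b ≤ b := by linarith [abs_nonneg ψ]
  have key := le_add_of_midpoint_convex (μ := fun x => (lineNormSq G x).toReal) (B := C) hb0
    (fun x _ => ENNReal.toReal_nonneg)
    (fun x hx => ENNReal.toReal_mono ENNReal.coe_ne_top (hC x (hin x hx)))
    (fun x hx y hy => by
      have h1 := h.parallelogram (hin x hx) (hin y hy)
      have h2 : 2 * lineNormSq G ((x + y) / 2) ≤ lineNormSq G x + lineNormSq G y :=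
        h1 ▸ le_add_self
      have h3 := ENNReal.toReal_mono (ENNReal.add_ne_top.2 ⟨hfin x hx, hfin y hy⟩) h2
      rw [ENNReal.toReal_add (hfin x hx) (hfin y hy), ENNReal.toReal_mul] at h3
      simpa using h3) ψ (abs_le.1 hψ)
  have hl := left_mem_Icc.2 hb0
  have hr := right_mem_Icc.2 hb0
  rw [← ENNReal.toReal_add (hfin _ hl) (hfin _ hr)] at key
  exact (ENNReal.toReal_le_toReal (hfin _ (abs_le.1 hψ))
    (ENNReal.add_ne_top.2 ⟨hfin _ hl, hfin _ hr⟩)).1 key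

/-- The sub-mean value property of `‖G‖²` on circles. -/
theorem enorm_sq_le_circle {G : ℂ → H} {c : ℂ} {r : ℝ} (hr : 0 < r)
    (hd : DifferentiableOn ℂ G (Metric.closedBall c r)) :
    ENNReal.ofReal (2 * Real.pi) * ‖G c‖ₑ ^ 2 ≤
      ∫⁻ θ in Ioo (-Real.pi) Real.pi, ‖G (c + Complex.polarCoord.symm (r, θ))‖ₑ ^ 2 := by
  have hpi := Real.pi_pos
  set q : ℂ → ℂ := fun w => inner ℂ (G c) (G w) ^ 2
  have hq : DifferentiableOn ℂ q (Metric.closedBall c r) := by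
    have : DifferentiableOn ℂ (fun w => innerSL ℂ (G c) (G w)) (Metric.closedBall c r) :=
      (innerSL ℂ (G c)).differentiable.comp_differentiableOn hd
    exact this.pow 2
  have hmean : Real.circleAverage q c r = q c := by
    apply DiffContOnCl.circleAverage
    rw [abs_of_pos hr]
    refine DifferentiableOn.diffContOnCl ?_
    rwa [closure_ball _ hr.ne']
  have hcirc : ∀ θ, circleMap c r θ = c + Complex.polarCoord.symm (r, θ) := by
    intro θ
    rw [circleMap, Complex.polarCoord_symm_apply, Complex.exp_mul_I]
    simp
  rw [Real.circleAverage_def] at hmean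
  have hper : ∫ θ in (0 : ℝ)..2 * Real.pi, q (circleMap c r θ) =
      ∫ θ in (-Real.pi)..Real.pi, q (circleMap c r θ) := by
    have hp : Function.Periodic (fun θ => q (circleMap c r θ)) (2 * Real.pi) := fun θ => by
      simp only [periodic_circleMap c r θ]
    have := hp.intervalIntegral_add_eq 0 (-Real.pi)
    rw [zero_add, show -Real.pi + 2 * Real.pi = Real.pi by ring] at this
    exact this
  have hqc : 2 * Real.pi * ‖G c‖ ^ 4 = ‖∫ θ in (-Real.pi)..Real.pi, q (circleMap c r θ)‖ := by
    have h1 : ‖q c‖ = ‖G c‖ ^ 4 := by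
      simp only [q, inner_self_eq_norm_sq_to_K, norm_pow]
      simp [← pow_mul]
    rw [← h1, ← hmean, ← hper, norm_smul]
    simp only [norm_inv, norm_mul, Real.norm_eq_abs, abs_of_pos hpi]
    norm_num
    field_simp
  by_cases h0 : G c = 0
  · simp [h0]
  have hle : ENNReal.ofReal (2 * Real.pi) * ‖G c‖ₑ ^ 4 ≤ ‖G c‖ₑ ^ 2 *
      ∫⁻ θ in Ioo (-Real.pi) Real.pi, ‖G (c + Complex.polarCoord.symm (r, θ))‖ₑ ^ 2 := by
    have h1 : ENNReal.ofReal (2 * Real.pi) * ‖G c‖ₑ ^ 4 =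
        ‖∫ θ in (-Real.pi)..Real.pi, q (circleMap c r θ)‖ₑ := by
      rw [← ofReal_norm (∫ θ in (-Real.pi)..Real.pi, q (circleMap c r θ)), ← hqc,
        ENNReal.ofReal_mul (p := 2 * Real.pi) (by positivity),
        ENNReal.ofReal_pow (by positivity), ofReal_norm]
    rw [h1, intervalIntegral.integral_of_le (by linarith), ← lintegral_const_mul' _ _ (by simp)]
    rw [integral_Ioc_eq_integral_Ioo]
    refine (enorm_integral_le_lintegral_enorm _).trans (lintegral_mono fun θ => ?_)
    simp only [q, enorm_pow, hcirc]
    rw [← mul_pow]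
    gcongr
    rw [← ofReal_norm, ← ofReal_norm, ← ofReal_norm, ← ENNReal.ofReal_mul (by positivity)]
    exact ENNReal.ofReal_le_ofReal (norm_inner_le_norm _ _)
  have hc0 : ‖G c‖ₑ ^ 2 ≠ 0 := by simpa using h0
  refine (ENNReal.mul_le_mul_iff_right hc0 (by simp)).1 ?_
  refine le_trans (le_of_eq ?_) hle
  ring

/-- Points are controlled by the norms on neighbouring lines. -/
theorem StripHardy.enorm_sq_le {a b δ : ℝ} {G : ℂ → H} (h : StripHardy a G) (hb : b < a)
    (hδ : 0 < δ) {w : ℂ} (hw : |w.im| + δ ≤ b) :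
    ‖G w‖ₑ ^ 2 ≤ ENNReal.ofReal (2 / (Real.pi * δ)) *
      (lineNormSq G (-b) + lineNormSq G b) := by
  have hpi := Real.pi_pos
  set S := strip δ
  have hS : MeasurableSet S := (isOpen_strip δ).measurableSet
  have hin : ∀ z ∈ S, w + z ∈ strip a := by
    intro z hz
    have hz' : |z.im| < δ := hz
    show |(w + z).im| < a
    rw [Complex.add_im]
    linarith [abs_add_le w.im z.im]
  set f : ℂ → ℝ≥0∞ := S.indicator fun z => ‖G (w + z)‖ₑ ^ 2
  have hf : Measurable f := by
    classical
    have h1 : ContinuousOn (fun z => ‖G (w + z)‖ₑ) S :=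
      (h.diff.continuousOn.comp (by fun_prop) hin).enorm
    have h2 := ContinuousOn.measurable_piecewise h1 (continuousOn_const (c := 0)) hS
    have h3 := h2.pow_const 2
    convert h3 using 1
    ext z
    by_cases hz : z ∈ S <;> simp [f, hz]
  have hupper : ∫⁻ z, f z ≤ ENNReal.ofReal (2 * δ) * (lineNormSq G (-b) + lineNormSq G b) := by
    have hf' : Measurable fun p : ℝ × ℝ => f (Complex.measurableEquivRealProd.symm p) :=
      hf.comp (MeasurableEquiv.measurable _)
    rw [← (Complex.volume_preserving_equiv_real_prod.symm).lintegral_comp hf,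
      Measure.volume_eq_prod, lintegral_prod_symm' _ hf']
    calc ∫⁻ y : ℝ, ∫⁻ x : ℝ, f (Complex.measurableEquivRealProd.symm (x, y))
        ≤ ∫⁻ y : ℝ, (Ioo (-δ) δ).indicator
            (fun _ => lineNormSq G (-b) + lineNormSq G b) y := by
          refine lintegral_mono fun y => ?_
          by_cases hy : y ∈ Ioo (-δ) δ
          · rw [indicator_of_mem hy]
            have hy' : |y| < δ := abs_lt.2 hy
            have h1 : |w.im + y| ≤ b := by linarith [abs_add_le w.im y]
            refine le_trans (le_of_eq ?_) (h.lineNormSq_le hb h1)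
            unfold lineNormSq
            rw [← lintegral_add_left_eq_self
              (fun x : ℝ => ‖G (x + (w.im + y : ℝ) * Complex.I)‖ₑ ^ 2) w.re]
            refine lintegral_congr fun x => ?_
            have hm : Complex.measurableEquivRealProd.symm (x, y) = x + y * Complex.I := by
              rw [Complex.measurableEquivRealProd_symm_apply]
              apply Complex.ext <;> simp
            have hmS : (x + y * Complex.I : ℂ) ∈ S := line_mem_strip hy' x
            simp only [f, hm, indicator_of_mem hmS]
            congr 3
            apply Complex.ext <;> simp
          · rw [indicator_of_notMem hy]
            rw [nonpos_iff_eq_zero, ← lintegral_zero (α := ℝ) (μ := volume)]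
            refine lintegral_congr fun x => ?_
            have : Complex.measurableEquivRealProd.symm (x, y) ∉ S := by
              intro hc
              have hc' : |(Complex.measurableEquivRealProd.symm (x, y)).im| < δ := hc
              rw [Complex.measurableEquivRealProd_symm_apply] at hc'
              exact hy (abs_lt.1 hc')
            exact indicator_of_notMem this _
      _ = ENNReal.ofReal (2 * δ) * (lineNormSq G (-b) + lineNormSq G b) := by
          rw [lintegral_indicator measurableSet_Ioo, setLIntegral_const, Real.volume_Ioo, mul_comm]
          congr 2; ring
  have hlower : ENNReal.ofReal (Real.pi * δ ^ 2) * ‖G w‖ₑ ^ 2 ≤ ∫⁻ z, f z := by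
    rw [← Complex.lintegral_comp_polarCoord_symm]
    have hpm : Measurable fun p : ℝ × ℝ => Complex.polarCoord.symm p := by
      have : (fun p : ℝ × ℝ => Complex.polarCoord.symm p) = fun p : ℝ × ℝ =>
          (p.1 : ℂ) * (Real.cos p.2 + Real.sin p.2 * Complex.I) := by
        ext p; rw [Complex.polarCoord_symm_apply]
      rw [this]; fun_prop
    have hg : Measurable fun p : ℝ × ℝ =>
        ENNReal.ofReal p.1 • f (Complex.polarCoord.symm p) :=
      (ENNReal.measurable_ofReal.comp measurable_fst).mul (hf.comp hpm)
    have htar : polarCoord.target = Ioi (0 : ℝ) ×ˢ Ioo (-Real.pi) Real.pi := rfl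
    rw [htar, Measure.volume_eq_prod, ← Measure.prod_restrict, lintegral_prod _ hg.aemeasurable]
    calc ENNReal.ofReal (Real.pi * δ ^ 2) * ‖G w‖ₑ ^ 2
        = ∫⁻ r in Ioo 0 δ, ENNReal.ofReal r * (ENNReal.ofReal (2 * Real.pi) * ‖G w‖ₑ ^ 2) := by
          rw [lintegral_mul_const' _ _ (by finiteness), ← mul_assoc]
          congr 1
          have h1 : IntegrableOn (fun r : ℝ => r) (Ioo 0 δ) :=
            (continuous_id.integrableOn_Icc (a := 0) (b := δ)).mono_set Ioo_subset_Icc_self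
          rw [← ofReal_integral_eq_lintegral_ofReal h1, ← integral_Ioc_eq_integral_Ioo,
            ← intervalIntegral.integral_of_le hδ.le, integral_id,
            ← ENNReal.ofReal_mul (by norm_num; positivity)]
          · congr 1; ring
          · filter_upwards [ae_restrict_mem measurableSet_Ioo] with r hr using hr.1.le
      _ ≤ ∫⁻ r in Ioo 0 δ, ∫⁻ θ in Ioo (-Real.pi) Real.pi,
            ENNReal.ofReal r • f (Complex.polarCoord.symm (r, θ)) := by
          refine setLIntegral_mono' measurableSet_Ioo fun r hr => ?_
          simp only [smul_eq_mul]
          rw [lintegral_const_mul' _ _ (by simp)]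
          gcongr
          have hball : Metric.closedBall w r ⊆ strip a := by
            intro z hz
            have h1 : z - w ∈ S := by
              show |(z - w).im| < δ
              refine (Complex.abs_im_le_norm _).trans_lt ?_
              rw [Metric.mem_closedBall, dist_eq_norm] at hz
              exact hz.trans_lt hr.2
            simpa using hin _ h1
          refine (enorm_sq_le_circle hr.1 (h.diff.mono hball)).trans (lintegral_mono fun θ => ?_)
          have hmS : Complex.polarCoord.symm (r, θ) ∈ S := by
            show |_| < δ
            refine (Complex.abs_im_le_norm _).trans_lt ?_
            rw [Complex.norm_polarCoord_symm, abs_of_pos hr.1]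
            exact hr.2
          simp only [f, indicator_of_mem hmS, le_refl]
      _ ≤ _ := lintegral_mono_set Ioo_subset_Ioi_self
  have hfin := hlower.trans hupper
  have e1 : ENNReal.ofReal (Real.pi * δ ^ 2) ≠ 0 := by
    simpa using (by positivity : 0 < Real.pi * δ ^ 2)
  refine (ENNReal.mul_le_mul_iff_right e1 (by simp)).1 (hfin.trans (le_of_eq ?_))
  rw [← mul_assoc, ← ENNReal.ofReal_mul (by positivity)]
  congr 2
  field_simp

end PML

namespace PML

variable {H : Type*} [NormedAddCommGroup H] [InnerProductSpace ℂ H]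

theorem StripHardy.enorm_sq_le_poisson_of_nonneg {a b : ℝ} {G : ℂ → H} (h : StripHardy a G)
    (hb : b < a) {w : ℂ} (h0 : 0 ≤ w.im) (hw : w.im < b) :
    ‖G w‖ₑ ^ 2 ≤ ENNReal.ofReal (8 / Real.pi) *
      ∫⁻ t : ℝ, ENNReal.ofReal ((b - w.im) / ((b - w.im) ^ 2 + (t - w.re) ^ 2)) *
        (‖G (t + (-b : ℝ) * Complex.I)‖ₑ ^ 2 + ‖G (t + b * Complex.I)‖ₑ ^ 2) := by
  have hpi := Real.pi_pos
  set δ := b - w.im with hδd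
  have hδ : 0 < δ := by linarith
  set p : ℂ := w.re + (2 * b - w.im : ℝ) * Complex.I
  set m : ℂ → ℂ := fun o => (-(2 * δ : ℝ) * Complex.I) / (o - p)
  have hbpos : 0 < b := by linarith
  set a' := min a (b + δ / 2)
  have hba' : b < a' := lt_min hb (by linarith)
  have hpim : p.im = 2 * b - w.im := by simp [p]
  have hpre : p.re = w.re := by simp [p]
  have hfar : ∀ o ∈ strip a', δ / 2 ≤ ‖o - p‖ := by
    intro o ho
    have h1 : |o.im| < b + δ / 2 := lt_of_lt_of_le ho (min_le_right _ _)
    have h2 : |(o - p).im| ≤ ‖o - p‖ := Complex.abs_im_le_norm _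
    rw [Complex.sub_im, hpim] at h2
    have := (abs_lt.1 h1).2
    have := neg_abs_le (o.im - (2 * b - w.im))
    linarith
  have hne : ∀ o ∈ strip a', o - p ≠ 0 := fun o ho hc => by
    have := hfar o ho
    rw [hc, norm_zero] at this
    linarith
  have hmd : DifferentiableOn ℂ m (strip a') :=
    DifferentiableOn.div (by fun_prop) (by fun_prop) hne
  have hnum : ‖-((2 * δ : ℝ) : ℂ) * Complex.I‖ = 2 * δ := by
    rw [norm_mul, norm_neg, Complex.norm_I, Complex.norm_real, Real.norm_eq_abs,
      abs_of_pos (by linarith), mul_one]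
  have hmb : ∀ o ∈ strip a', ‖m o‖ ≤ (4 : ℝ≥0) := by
    intro o ho
    have h1 := hfar o ho
    simp only [m]
    rw [norm_div, hnum, div_le_iff₀ (by linarith)]
    push_cast
    linarith
  have hG' := (h.mono (min_le_left a (b + δ / 2))).smul hmd hmb
  have hmw : m w = 1 := by
    have : w - p = -((2 * δ : ℝ) : ℂ) * Complex.I := by
      apply Complex.ext
      · simp [hpre]
      · simp [hpim, hδd]; ring
    simp only [m, this]
    refine div_self ?_
    rw [← norm_ne_zero_iff, hnum]
    linarith
  have key := hG'.enorm_sq_le hba' hδ (w := w) (by rw [abs_of_nonneg h0]; linarith)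
  simp only [hmw, one_smul] at key
  refine key.trans ?_
  have hline : ∀ y t : ℝ, δ ≤ |y - (2 * b - w.im)| → ‖m (t + y * Complex.I)‖ ^ 2 ≤
      4 * δ ^ 2 / (δ ^ 2 + (t - w.re) ^ 2) := by
    intro y t hy
    simp only [m]
    have hden : ‖(t + y * Complex.I - p : ℂ)‖ ^ 2 = (y - (2 * b - w.im)) ^ 2 + (t - w.re) ^ 2 := by
      rw [← Complex.normSq_eq_norm_sq, Complex.normSq_apply]
      simp [hpre, hpim]; ring
    rw [norm_div, hnum, div_pow, hden]
    have h1 : δ ^ 2 ≤ (y - (2 * b - w.im)) ^ 2 := by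
      rw [← sq_abs (y - _)]; gcongr
    rw [show (2 * δ) ^ 2 = 4 * δ ^ 2 by ring]
    gcongr
  have hside : ∀ y : ℝ, δ ≤ |y - (2 * b - w.im)| →
      lineNormSq (fun w => m w • G w) y ≤ ∫⁻ t : ℝ,
        ENNReal.ofReal (4 * δ ^ 2 / (δ ^ 2 + (t - w.re) ^ 2)) * ‖G (t + y * Complex.I)‖ₑ ^ 2 := by
    intro y hy
    refine lintegral_mono fun t => ?_
    simp only
    rw [enorm_smul, mul_pow]
    gcongr
    rw [← ofReal_norm, ← ENNReal.ofReal_pow (by positivity)]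
    exact ENNReal.ofReal_le_ofReal (hline y t hy)
  have h1 := hside (-b) (by rw [abs_of_nonpos] <;> linarith)
  have h2 := hside b (by rw [abs_of_nonpos] <;> linarith)
  refine (mul_le_mul_right (add_le_add h1 h2) _).trans (le_of_eq ?_)
  have hab : |-b| < a := by rw [abs_neg, abs_of_pos hbpos]; exact hb
  rw [← lintegral_add_left']
  · rw [← lintegral_const_mul' _ _ (by simp), ← lintegral_const_mul' _ _ (by simp)]
    refine lintegral_congr fun t => ?_
    rw [← mul_add, ← mul_assoc, ← mul_assoc, ← ENNReal.ofReal_mul (by positivity),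
      ← ENNReal.ofReal_mul (by positivity)]
    congr 2
    field_simp
    ring
  · have e1 : AEMeasurable fun t : ℝ =>
        ENNReal.ofReal (4 * δ ^ 2 / (δ ^ 2 + (t - w.re) ^ 2)) := by
      refine Measurable.aemeasurable ?_
      fun_prop
    exact e1.mul ((h.continuous_line hab).enorm.measurable.pow_const 2).aemeasurable

/-- A Poisson type majorant of `‖G‖²` on the strip `{|Im w| ≤ b}`. -/
theorem StripHardy.enorm_sq_le_poisson {a b : ℝ} {G : ℂ → H} (h : StripHardy a G)
    (hb : b < a) {w : ℂ} (hw : |w.im| < b) :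
    ‖G w‖ₑ ^ 2 ≤ ENNReal.ofReal (8 / Real.pi) *
      ∫⁻ t : ℝ, ENNReal.ofReal ((b - |w.im|) / ((b - |w.im|) ^ 2 + (t - w.re) ^ 2)) *
        (‖G (t + (-b : ℝ) * Complex.I)‖ₑ ^ 2 + ‖G (t + b * Complex.I)‖ₑ ^ 2) := by
  rcases le_total 0 w.im with h0 | h0
  · rw [abs_of_nonneg h0] at hw ⊢
    exact h.enorm_sq_le_poisson_of_nonneg hb h0 hw
  · rw [abs_of_nonpos h0] at hw ⊢
    have key := h.comp_neg.enorm_sq_le_poisson_of_nonneg hb (w := -w) (by simpa using h0)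
      (by simpa using hw)
    rw [neg_neg] at key
    refine key.trans (le_of_eq ?_)
    congr 1
    rw [← lintegral_neg_eq_self]
    refine lintegral_congr fun t => ?_
    have e1 : (-t - (-w).re) ^ 2 = (t - w.re) ^ 2 := by simp only [Complex.neg_re]; ring
    have e2 : -(((-t : ℝ) : ℂ) + (-b : ℝ) * Complex.I) = t + b * Complex.I := by push_cast; ring
    have e3 : -(((-t : ℝ) : ℂ) + b * Complex.I) = t + (-b : ℝ) * Complex.I := by push_cast; ring
    rw [e1, e2, e3, add_comm (‖G _‖ₑ ^ 2), Complex.neg_im]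

end PML

namespace PML

variable {H : Type*} [NormedAddCommGroup H] [InnerProductSpace ℂ H]

theorem lintegral_Ioi_eq_exp (f : ℝ → ℝ≥0∞) :
    ∫⁻ x in Ioi (0 : ℝ), f x = ∫⁻ t : ℝ, ENNReal.ofReal (Real.exp t) * f (Real.exp t) := by
  have h := lintegral_image_eq_lintegral_abs_deriv_mul (s := univ) (f := Real.exp)
    (f' := Real.exp) MeasurableSet.univ (fun x _ => (Real.hasDerivAt_exp x).hasDerivWithinAt)
    Real.exp_injective.injOn f
  rw [image_univ, Real.range_exp, Measure.restrict_univ] at h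
  rw [h]
  simp only [abs_of_pos (Real.exp_pos _)]

/-- The square of the `L²` norm of `F` along the ray `arg z = ψ`. -/
def rayNormSq (F : ℂ → H) (ψ : ℝ) : ℝ≥0∞ :=
  ∫⁻ x in Ioi (0 : ℝ), ‖F (Complex.exp (ψ * Complex.I) * x)‖ₑ ^ 2

/-- The Hardy class of the sector `𝕊_α` with values in a Hilbert space. -/
structure SectorHardy (α : ℝ) (F : ℂ → H) : Prop where
  analytic : AnalyticOnNhd ℂ F (sector α)
  bound : ∃ C : ℝ≥0, ∀ ψ ∈ Ioo (-α) α, rayNormSq F ψ ≤ C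

theorem MemHardy.sectorHardy {n : ℕ} {Ω : Set (E n)} {α : ℝ} {F : ℂ → L2Section Ω}
    (h : MemHardy Ω α F) : SectorHardy α F := ⟨h.analytic, h.bound⟩

theorem SectorHardy.memHardy {n : ℕ} {Ω : Set (E n)} {α : ℝ} {F : ℂ → L2Section Ω}
    (h : SectorHardy α F) : MemHardy Ω α F := ⟨h.analytic, h.bound⟩

/-- The function on the strip that corresponds to `F` under `z = exp w`. -/
def stripFun (F : ℂ → H) (w : ℂ) : H := Complex.exp (w / 2) • F (Complex.exp w)

theorem exp_mem_sector {α : ℝ} (hα : α ≤ Real.pi) {w : ℂ} (hw : w ∈ strip α) :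
    Complex.exp w ∈ sector α := by
  have hw' : |w.im| < α := hw
  refine ⟨Complex.exp_ne_zero _, ?_⟩
  have h1 := abs_lt.1 hw'
  have h2 := Complex.log_exp (x := w) (by linarith) (by linarith)
  have h3 := congrArg Complex.im h2
  rw [Complex.log_im] at h3
  rw [h3]
  exact hw

theorem log_mem_strip {α : ℝ} {z : ℂ} (hz : z ∈ sector α) : Complex.log z ∈ strip α := by
  show |_| < α
  rw [Complex.log_im]
  exact hz.2

theorem exp_mul_mem_sector {α ψ x : ℝ} (hα : α ≤ Real.pi) (hψ : ψ ∈ Ioo (-α) α) (hx : 0 < x) :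
    Complex.exp (ψ * Complex.I) * x ∈ sector α := by
  have h : Complex.exp (ψ * Complex.I) * x = Complex.exp (Real.log x + ψ * Complex.I) := by
    rw [Complex.exp_add, ← Complex.ofReal_exp, Real.exp_log hx, mul_comm]
  rw [h]
  exact exp_mem_sector hα (line_mem_strip (abs_lt.2 hψ) _)

theorem ofReal_mem_sector {α x : ℝ} (hα : 0 < α) (hx : 0 < x) : (x : ℂ) ∈ sector α :=
  ⟨by exact_mod_cast hx.ne', by rw [Complex.arg_ofReal_of_nonneg hx.le]; simpa using hα⟩

theorem stripFun_line (F : ℂ → H) (t ψ : ℝ) : stripFun F (t + ψ * Complex.I) =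
    (Real.exp (t / 2) : ℂ) • Complex.exp (ψ * Complex.I / 2) •
      F (Complex.exp (ψ * Complex.I) * (Real.exp t : ℝ)) := by
  rw [stripFun, smul_smul]
  congr 1
  · rw [Complex.ofReal_exp, ← Complex.exp_add]
    congr 1
    push_cast; ring
  · rw [Complex.ofReal_exp, ← Complex.exp_add, add_comm]

theorem enorm_exp_smul_sq (t : ℝ) (v : H) :
    ‖(Real.exp (t / 2) : ℂ) • v‖ₑ ^ 2 = ENNReal.ofReal (Real.exp t) * ‖v‖ₑ ^ 2 := by
  rw [enorm_smul, mul_pow]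
  congr 1
  rw [← ofReal_norm, ← ENNReal.ofReal_pow (by positivity), Complex.norm_real, Real.norm_eq_abs,
    abs_of_pos (Real.exp_pos _), ← Real.exp_nat_mul]
  congr 2
  push_cast; ring

theorem enorm_exp_I_smul (ψ : ℝ) (v : H) : ‖Complex.exp (ψ * Complex.I / 2) • v‖ₑ = ‖v‖ₑ := by
  rw [enorm_smul, ← ofReal_norm, show (ψ * Complex.I / 2 : ℂ) = (ψ / 2 : ℝ) * Complex.I by
    push_cast; ring, Complex.norm_exp_ofReal_mul_I]
  simp

theorem lineNormSq_stripFun (F : ℂ → H) (ψ : ℝ) : lineNormSq (stripFun F) ψ = rayNormSq F ψ := by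
  rw [rayNormSq, lintegral_Ioi_eq_exp, lineNormSq]
  refine lintegral_congr fun t => ?_
  rw [stripFun_line, enorm_exp_smul_sq, enorm_exp_I_smul]

theorem enorm_stripFun_log_sq (F : ℂ → H) {z : ℂ} (hz : z ≠ 0) :
    ‖stripFun F (Complex.log z)‖ₑ ^ 2 = ENNReal.ofReal ‖z‖ * ‖F z‖ₑ ^ 2 := by
  rw [stripFun, Complex.exp_log hz, enorm_smul, mul_pow]
  congr 1
  rw [← ofReal_norm, ← ENNReal.ofReal_pow (by positivity), Complex.norm_exp, ← Real.exp_nat_mul]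
  congr 1
  have : (Complex.log z / 2).re = Real.log ‖z‖ / 2 := by
    rw [← Complex.log_re]; simp
  rw [this]
  push_cast
  rw [mul_div_cancel₀ _ (two_ne_zero), Real.exp_log (norm_pos_iff.2 hz)]

theorem SectorHardy.stripHardy {α : ℝ} (hα : α ≤ Real.pi) {F : ℂ → H} (h : SectorHardy α F) :
    StripHardy α (stripFun F) := by
  obtain ⟨C, hC⟩ := h.bound
  refine ⟨?_, C, fun ψ hψ => ?_⟩
  · refine DifferentiableOn.smul (by fun_prop) ?_
    exact h.analytic.differentiableOn.comp (by fun_prop) fun w hw => exp_mem_sector hα hw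
  · rw [lineNormSq_stripFun]
    exact hC ψ (abs_lt.1 hψ)

theorem SectorHardy.continuousOn_ray {α ψ : ℝ} (hα : α ≤ Real.pi) {F : ℂ → H}
    (h : SectorHardy α F) (hψ : ψ ∈ Ioo (-α) α) :
    ContinuousOn (fun x : ℝ => F (Complex.exp (ψ * Complex.I) * x)) (Ioi 0) :=
  h.analytic.continuousOn.comp (by fun_prop) fun _ hx => exp_mul_mem_sector hα hψ hx

theorem SectorHardy.memLp_ray {α ψ : ℝ} (hα : α ≤ Real.pi) {F : ℂ → H}
    (h : SectorHardy α F) (hψ : ψ ∈ Ioo (-α) α) :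
    MemLp (fun x : ℝ => F (Complex.exp (ψ * Complex.I) * x)) 2 (volume.restrict (Ioi 0)) := by
  obtain ⟨C, hC⟩ := h.bound
  refine memLp_two_of_lintegral
    ((h.continuousOn_ray hα hψ).aestronglyMeasurable measurableSet_Ioi)
    ((hC ψ hψ).trans_lt ENNReal.coe_lt_top)

theorem SectorHardy.rayNormSq_le {α β ψ : ℝ} (hα : α ≤ Real.pi) {F : ℂ → H}
    (h : SectorHardy α F) (hβ : β < α) (hψ : |ψ| ≤ β) :
    rayNormSq F ψ ≤ rayNormSq F (-β) + rayNormSq F β := by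
  simp only [← lineNormSq_stripFun]
  exact (h.stripHardy hα).lineNormSq_le hβ hψ

theorem SectorHardy.parallelogram {α p q : ℝ} (hα : α ≤ Real.pi) {F : ℂ → H}
    (h : SectorHardy α F) (hp : p ∈ Ioo (-α) α) (hq : q ∈ Ioo (-α) α) :
    (∫⁻ x in Ioi (0 : ℝ), ‖Complex.exp (p * Complex.I / 2) • F (Complex.exp (p * Complex.I) * x) -
      Complex.exp (q * Complex.I / 2) • F (Complex.exp (q * Complex.I) * x)‖ₑ ^ 2) +
      2 * rayNormSq F ((p + q) / 2) = rayNormSq F p + rayNormSq F q := by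
  have key := (h.stripHardy hα).parallelogram (abs_lt.2 hp) (abs_lt.2 hq)
  simp only [lineNormSq_stripFun] at key
  rw [← key, lintegral_Ioi_eq_exp]
  congr 1
  refine lintegral_congr fun t => ?_
  rw [stripFun_line, stripFun_line, ← smul_sub, enorm_exp_smul_sq]

open Classical in
/-- The restriction of `F` to the ray `arg z = ψ` as an element of `L²(ℝ₊; H)`. -/
def rayLp (F : ℂ → H) (ψ : ℝ) : Lp H 2 (volume.restrict (Ioi (0 : ℝ))) :=
  if h : MemLp (fun x : ℝ => F (Complex.exp (ψ * Complex.I) * x)) 2 (volume.restrict (Ioi 0))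
  then h.toLp _ else 0

theorem SectorHardy.coeFn_rayLp {α ψ : ℝ} (hα : α ≤ Real.pi) {F : ℂ → H}
    (h : SectorHardy α F) (hψ : ψ ∈ Ioo (-α) α) :
    rayLp F ψ =ᵐ[volume.restrict (Ioi 0)] fun x : ℝ => F (Complex.exp (ψ * Complex.I) * x) := by
  rw [rayLp, dif_pos (h.memLp_ray hα hψ)]
  exact MemLp.coeFn_toLp _

theorem SectorHardy.enorm_rayLp_sq {α ψ : ℝ} (hα : α ≤ Real.pi) {F : ℂ → H}
    (h : SectorHardy α F) (hψ : ψ ∈ Ioo (-α) α) : ‖rayLp F ψ‖ₑ ^ 2 = rayNormSq F ψ := by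
  rw [enorm_Lp_two_sq]
  refine lintegral_congr_ae ?_
  filter_upwards [h.coeFn_rayLp hα hψ] with x hx
  rw [hx]

variable [CompleteSpace H]

theorem SectorHardy.exists_tendsto_rayLp {α : ℝ} (h0 : 0 < α) (hα : α ≤ Real.pi) {F : ℂ → H}
    (h : SectorHardy α F) :
    (∃ v, Tendsto (rayLp F) (𝓝[>] (-α)) (𝓝 v)) ∧ ∃ v, Tendsto (rayLp F) (𝓝[<] α) (𝓝 v) := by
  obtain ⟨C, hC⟩ := h.bound
  set g : ℝ → Lp H 2 (volume.restrict (Ioi (0 : ℝ))) :=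
    fun ψ => Complex.exp (ψ * Complex.I / 2) • rayLp F ψ
  have hgn : ∀ ψ ∈ Ioo (-α) α, ‖g ψ‖ₑ ^ 2 = rayNormSq F ψ := fun ψ hψ => by
    rw [← h.enorm_rayLp_sq hα hψ]
    congr 1
    have h1 : ‖Complex.exp (ψ * Complex.I / 2)‖ = 1 := by
      rw [show (ψ * Complex.I / 2 : ℂ) = (ψ / 2 : ℝ) * Complex.I by push_cast; ring,
        Complex.norm_exp_ofReal_mul_I]
    rw [← ofReal_norm, ← ofReal_norm, norm_smul, h1, one_mul]
  have hgc : ∀ ψ ∈ Ioo (-α) α, g ψ =ᵐ[volume.restrict (Ioi 0)] fun x : ℝ =>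
      Complex.exp (ψ * Complex.I / 2) • F (Complex.exp (ψ * Complex.I) * x) := fun ψ hψ => by
    filter_upwards [Lp.coeFn_smul (Complex.exp (ψ * Complex.I / 2)) (rayLp F ψ),
      h.coeFn_rayLp hα hψ] with x h1 h2
    rw [h1, Pi.smul_apply, h2]
  have hsq : ∀ v : Lp H 2 (volume.restrict (Ioi (0 : ℝ))), (‖v‖ₑ ^ 2).toReal = ‖v‖ ^ 2 := by
    intro v; simp
  have hB : ∀ ψ ∈ Ioo (-α) α, ‖g ψ‖ ^ 2 ≤ C := fun ψ hψ => by
    rw [← hsq, hgn ψ hψ]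
    exact ENNReal.toReal_mono ENNReal.coe_ne_top (hC ψ hψ)
  have hm : ∀ p ∈ Ioo (-α) α, ∀ q ∈ Ioo (-α) α,
      ‖g p - g q‖ ^ 2 + 2 * ‖g ((p + q) / 2)‖ ^ 2 = ‖g p‖ ^ 2 + ‖g q‖ ^ 2 := by
    intro p hp q hq
    have hpq : (p + q) / 2 ∈ Ioo (-α) α :=
      ⟨by linarith [hp.1, hq.1], by linarith [hp.2, hq.2]⟩
    have key := h.parallelogram hα hp hq
    have e : ‖g p - g q‖ₑ ^ 2 = ∫⁻ x in Ioi (0 : ℝ),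
        ‖Complex.exp (p * Complex.I / 2) • F (Complex.exp (p * Complex.I) * x) -
        Complex.exp (q * Complex.I / 2) • F (Complex.exp (q * Complex.I) * x)‖ₑ ^ 2 := by
      rw [enorm_Lp_two_sq]
      refine lintegral_congr_ae ?_
      filter_upwards [Lp.coeFn_sub (g p) (g q), hgc p hp, hgc q hq] with x h1 h2 h3
      rw [h1, Pi.sub_apply, h2, h3]
    rw [← e, ← hgn _ hpq, ← hgn _ hp, ← hgn _ hq] at key
    have := congrArg ENNReal.toReal key
    rw [ENNReal.toReal_add (by finiteness) (by finiteness),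
      ENNReal.toReal_add (by finiteness) (by finiteness), ENNReal.toReal_mul] at this
    simpa only [hsq, ENNReal.toReal_ofNat] using this
  have hback : ∀ ψ, rayLp F ψ = Complex.exp (-(ψ * Complex.I / 2)) • g ψ := by
    intro ψ
    simp only [g]
    rw [smul_smul, ← Complex.exp_add, neg_add_cancel, Complex.exp_zero, one_smul]
  have hcont : Continuous fun ψ : ℝ => Complex.exp (-(ψ * Complex.I / 2)) := by fun_prop
  have hlt : -α < α := by linarith
  constructor
  · obtain ⟨v, hv⟩ := exists_tendsto_right_of_parallelogram hlt hB hm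
    refine ⟨_, Tendsto.congr (fun ψ => (hback ψ).symm)
      (((hcont.tendsto (-α)).mono_left nhdsWithin_le_nhds).smul hv)⟩
  · obtain ⟨v, hv⟩ := exists_tendsto_left_of_parallelogram hlt hB hm
    refine ⟨_, Tendsto.congr (fun ψ => (hback ψ).symm)
      (((hcont.tendsto α).mono_left nhdsWithin_le_nhds).smul hv)⟩

end PML

namespace PML

section ScalingFunction

variable {s : ℝ → ℝ}

theorem IsScalingFunction.differentiable (hs : IsScalingFunction s) : Differentiable ℝ s :=
  hs.smooth.differentiable (by simp)

theorem IsScalingFunction.monotone (hs : IsScalingFunction s) : Monotone s :=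
  monotone_of_deriv_nonneg hs.differentiable hs.deriv_nonneg

theorem IsScalingFunction.sub_le (hs : IsScalingFunction s) {x y : ℝ} (hxy : x ≤ y) :
    s y - s x ≤ y - x := by
  have h : Monotone fun x => x - s x := by
    refine monotone_of_deriv_nonneg (differentiable_id.sub hs.differentiable) fun x => ?_
    have := ((hasDerivAt_id x).sub (hs.differentiable x).hasDerivAt).deriv
    rw [show (fun x => x - s x) = id - s from rfl, this]
    linarith [hs.deriv_le_one x]
  have := h hxy
  simp only at this
  linarith

theorem IsScalingFunction.nonneg (hs : IsScalingFunction s) (x : ℝ) : 0 ≤ s x := by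
  rcases le_total x 0 with h | h
  · rw [hs.eq_zero x h]
  · rw [← hs.eq_zero 0 le_rfl]; exact hs.monotone h

theorem IsScalingFunction.le_self (hs : IsScalingFunction s) {x : ℝ} (hx : 0 ≤ x) : s x ≤ x := by
  have := hs.sub_le hx
  rw [hs.eq_zero 0 le_rfl] at this
  linarith

theorem IsScalingFunction.exists_sub_le (hs : IsScalingFunction s) :
    ∃ C > 0, ∀ x ≥ 0, x - s x ≤ C := by
  obtain ⟨C, hC, h⟩ := hs.deriv_eq_one
  refine ⟨C, hC, fun x hx => ?_⟩
  rcases le_total x C with hxC | hxC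
  · linarith [hs.nonneg x]
  · have hconst : (fun x => x - s x) x = (fun x => x - s x) C := by
      refine Convex.is_const_of_fderivWithin_eq_zero (𝕜 := ℝ) (convex_Ici C)
        (differentiable_id.sub hs.differentiable).differentiableOn ?_ hxC self_mem_Ici
      intro y hy
      rw [fderivWithin_eq_fderiv ((uniqueDiffOn_Ici C) y hy)
        ((differentiable_id.sub hs.differentiable) y)]
      have := ((hasDerivAt_id y).sub (hs.differentiable y).hasDerivAt)
      rw [h y hy, sub_self] at this
      rw [show id - s = fun x => x - s x from rfl] at this
      exact this.hasFDerivAt.fderiv.trans (by ext; simp)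
    simp only at hconst
    linarith [hs.nonneg C]

theorem IsScalingFunction.shift_le (hs : IsScalingFunction s) {r x : ℝ} (hr : 0 ≤ r)
    (hx : 0 ≤ x) : s (x - r) ≤ x := by
  rcases le_total x r with h | h
  · rw [hs.eq_zero _ (by linarith)]; exact hx
  · linarith [hs.le_self (x := x - r) (by linarith)]

/-- The distances from the points of the curve `x + λ s(x - r)` to the sides of the sector vary
slowly. -/
theorem dist_compare (hs : IsScalingFunction s) {r C S μ M x y : ℝ} (hr : 0 < r)
    (hC : 0 < C) (hsC : ∀ x ≥ 0, x - s x ≤ C) (hS : 0 ≤ S) (hμ : |μ| ≤ S) (hM : 1 ≤ M)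
    (hx : r ≤ x) (hy : r ≤ y) (hxy : x ≤ M * y) :
    S * x - μ * s (x - r) ≤ M * (2 + (r + C) / r) * (S * y - μ * s (y - r)) := by
  have hμ' := abs_le.1 hμ
  have hq : 0 ≤ (r + C) / r := by positivity
  have hpos : ∀ z, r ≤ z → 0 ≤ S * z - μ * s (z - r) := by
    intro z hz
    have h1 := hs.shift_le hr.le (hr.le.trans hz)
    have h2 := hs.nonneg (z - r)
    nlinarith [mul_nonneg hS (sub_nonneg.2 h1), mul_nonneg (sub_nonneg.2 hμ'.2) h2]
  rcases le_total x y with h | h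
  · have h1 := hs.sub_le (x := x - r) (y := y - r) (by linarith)
    have h2 := hs.monotone (show x - r ≤ y - r by linarith)
    have h3 : S * x - μ * s (x - r) ≤ S * y - μ * s (y - r) := by
      nlinarith [mul_nonneg hS (sub_nonneg.2 h1),
        mul_nonneg (sub_nonneg.2 hμ'.2) (sub_nonneg.2 h2)]
    have h4 : 1 ≤ M * (2 + (r + C) / r) := by nlinarith
    nlinarith [hpos y hy]
  · rcases le_total 0 μ with h0 | h0
    · have h1 : x - s (x - r) ≤ r + C := by linarith [hsC (x - r) (by linarith)]
      have h2 : r ≤ y - s (y - r) := by linarith [hs.le_self (x := y - r) (by linarith)]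
      have h3 : S * x - μ * s (x - r) = (S - μ) * x + μ * (x - s (x - r)) := by ring
      have h4 : S * y - μ * s (y - r) = (S - μ) * y + μ * (y - s (y - r)) := by ring
      have hSμ : 0 ≤ S - μ := by linarith
      have hy0 : 0 ≤ y := by linarith
      calc S * x - μ * s (x - r) ≤ (S - μ) * (M * y) + μ * (r + C) := by
            rw [h3]; gcongr
        _ = M * ((S - μ) * y) + ((r + C) / r) * (μ * r) := by field_simp
        _ ≤ M * (2 + (r + C) / r) * ((S - μ) * y) + M * (2 + (r + C) / r) * (μ * r) := by
            have e1 : M ≤ M * (2 + (r + C) / r) := by nlinarith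
            have e2 : (r + C) / r ≤ M * (2 + (r + C) / r) := by nlinarith
            gcongr
        _ ≤ M * (2 + (r + C) / r) * (S * y - μ * s (y - r)) := by
            rw [h4, ← mul_add]
            gcongr
    · have h1 := hs.shift_le hr.le (hr.le.trans hx)
      have h2 := hs.nonneg (x - r)
      have h3 := hs.nonneg (y - r)
      have hy0 : 0 ≤ y := by linarith
      have h4 : S * x - μ * s (x - r) ≤ 2 * (S * x) := by
        nlinarith [mul_nonneg hS (sub_nonneg.2 h1), mul_nonneg (show 0 ≤ S + μ by linarith) h2]
      have h5 : S * y ≤ S * y - μ * s (y - r) := by nlinarith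
      calc S * x - μ * s (x - r) ≤ 2 * (S * (M * y)) := h4.trans (by gcongr)
        _ = M * 2 * (S * y) := by ring
        _ ≤ M * (2 + (r + C) / r) * (S * y - μ * s (y - r)) := by
            gcongr
            linarith

end ScalingFunction

section Curve

variable {s : ℝ → ℝ}

theorem scaledPoint_re (s : ℝ → ℝ) (lam : ℂ) (r x : ℝ) :
    (scaledPoint s lam r x).re = x + lam.re * s (x - r) := by simp [scaledPoint]

theorem scaledPoint_im (s : ℝ → ℝ) (lam : ℂ) (r x : ℝ) :
    (scaledPoint s lam r x).im = lam.im * s (x - r) := by simp [scaledPoint]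

theorem norm_scaledPoint_bounds (hs : IsScalingFunction s) {lam : ℂ} {r x : ℝ} (hr : 0 ≤ r)
    (hx : 0 ≤ x) : (1 - ‖lam‖) * x ≤ ‖scaledPoint s lam r x‖ ∧
      ‖scaledPoint s lam r x‖ ≤ (1 + ‖lam‖) * x := by
  have h1 := hs.shift_le hr hx
  have h2 := hs.nonneg (x - r)
  have h3 : ‖lam * (s (x - r) : ℂ)‖ ≤ ‖lam‖ * x := by
    rw [norm_mul, Complex.norm_real, Real.norm_eq_abs, abs_of_nonneg h2]
    gcongr
  have h4 : ‖(x : ℂ)‖ = x := by rw [Complex.norm_real, Real.norm_eq_abs, abs_of_nonneg hx]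
  constructor
  · have := norm_sub_le (scaledPoint s lam r x) (lam * (s (x - r) : ℂ))
    rw [scaledPoint, add_sub_cancel_right, h4] at this
    rw [scaledPoint]
    linarith
  · have := norm_add_le (x : ℂ) (lam * (s (x - r) : ℂ))
    rw [h4] at this
    rw [scaledPoint]
    linarith

theorem scaledPoint_re_ge (hs : IsScalingFunction s) {lam : ℂ} {r x : ℝ} (hr : 0 ≤ r)
    (hx : 0 ≤ x) : (1 - ‖lam‖) * x ≤ (scaledPoint s lam r x).re := by
  rw [scaledPoint_re]
  have h1 := hs.shift_le hr hx
  have h2 := hs.nonneg (x - r)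
  have h3 := abs_le.1 (Complex.abs_re_le_norm lam)
  nlinarith [mul_le_mul_of_nonneg_left h1 (norm_nonneg lam)]

theorem abs_im_rot_le (lam : ℂ) (β : ℝ) :
    |lam.im * Real.cos β - lam.re * Real.sin β| ≤ ‖lam‖ := by
  apply abs_le_of_sq_le_sq _ (norm_nonneg _)
  rw [← Complex.normSq_eq_norm_sq, Complex.normSq_apply]
  nlinarith [sq_nonneg (lam.im * Real.sin β + lam.re * Real.cos β), Real.sin_sq_add_cos_sq β]

theorem norm_mul_sin_sub_arg (z : ℂ) (β : ℝ) :
    ‖z‖ * Real.sin (β - z.arg) = z.re * Real.sin β - z.im * Real.cos β := by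
  rw [Real.sin_sub]
  linear_combination Real.sin β * Complex.norm_mul_cos_arg z -
    Real.cos β * Complex.norm_mul_sin_arg z

/-- The distance from the point of the curve to the upper side of the sector `𝕊_β`. -/
theorem norm_mul_sin_upper (s : ℝ → ℝ) (lam : ℂ) (r x β : ℝ) :
    ‖scaledPoint s lam r x‖ * Real.sin (β - (scaledPoint s lam r x).arg) =
      Real.sin β * x - (lam.im * Real.cos β - lam.re * Real.sin β) * s (x - r) := by
  rw [norm_mul_sin_sub_arg, scaledPoint_re, scaledPoint_im]; ring

/-- The distance from the point of the curve to the lower side of the sector `𝕊_β`. -/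
theorem norm_mul_sin_lower (s : ℝ → ℝ) (lam : ℂ) (r x β : ℝ) :
    ‖scaledPoint s lam r x‖ * Real.sin (β + (scaledPoint s lam r x).arg) =
      Real.sin β * x - (-lam.im * Real.cos β - lam.re * Real.sin β) * s (x - r) := by
  rw [Real.sin_add]
  have h1 := Complex.norm_mul_cos_arg (scaledPoint s lam r x)
  have h2 := Complex.norm_mul_sin_arg (scaledPoint s lam r x)
  rw [scaledPoint_re] at h1
  rw [scaledPoint_im] at h2
  linear_combination Real.sin β * h1 + Real.cos β * h2

theorem abs_arg_scaledPoint_lt (hs : IsScalingFunction s) {lam : ℂ} {r x β : ℝ} (hr : 0 ≤ r)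
    (hx : 0 < x) (hβ : 0 < β) (hβ' : β < Real.pi / 4) (hlam : ‖lam‖ < Real.sin β) :
    |(scaledPoint s lam r x).arg| < β := by
  have hlam1 : ‖lam‖ < 1 := hlam.trans_le (Real.sin_le_one _)
  have hre : 0 < (scaledPoint s lam r x).re :=
    lt_of_lt_of_le (mul_pos (by linarith) hx) (scaledPoint_re_ge hs hr hx.le)
  have harg := abs_lt.1 (Complex.abs_arg_lt_pi_div_two_iff.2 (Or.inl hre))
  have hn : 0 < ‖scaledPoint s lam r x‖ :=
    norm_pos_iff.2 fun h => by rw [h] at hre; simp at hre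
  have h1 := hs.shift_le hr hx.le
  have h2 := hs.nonneg (x - r)
  have hpos : ∀ μ : ℝ, |μ| ≤ ‖lam‖ → 0 < Real.sin β * x - μ * s (x - r) := by
    intro μ hμ
    have := (abs_le.1 hμ).2
    nlinarith [mul_le_mul_of_nonneg_left h1 (norm_nonneg lam)]
  have hup := hpos _ (abs_im_rot_le lam β)
  have hlo := hpos (-lam.im * Real.cos β - lam.re * Real.sin β) (by
    have := abs_im_rot_le (starRingEnd ℂ lam) β
    simpa using this)
  rw [← norm_mul_sin_upper s lam r x β] at hup
  rw [← norm_mul_sin_lower s lam r x β] at hlo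
  have hup' := pos_of_mul_pos_right hup hn.le
  have hlo' := pos_of_mul_pos_right hlo hn.le
  rw [abs_lt]
  constructor
  · by_contra! hc
    have := Real.sin_nonpos_of_nonpos_of_neg_pi_le (x := β + (scaledPoint s lam r x).arg)
      (by linarith) (by linarith)
    linarith
  · by_contra! hc
    have := Real.sin_nonpos_of_nonpos_of_neg_pi_le (x := β - (scaledPoint s lam r x).arg)
      (by linarith) (by linarith)
    linarith

theorem scaledPoint_mem_sector (hs : IsScalingFunction s) {lam : ℂ} {r x β : ℝ} (hr : 0 ≤ r)
    (hx : 0 < x) (hβ : 0 < β) (hβ' : β < Real.pi / 4) (hlam : ‖lam‖ < Real.sin β) :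
    scaledPoint s lam r x ∈ sector β := by
  refine ⟨?_, abs_arg_scaledPoint_lt hs hr hx hβ hβ' hlam⟩
  have hlam1 : ‖lam‖ < 1 := hlam.trans_le (Real.sin_le_one _)
  have := (norm_scaledPoint_bounds hs (lam := lam) hr hx.le).1
  rw [← norm_pos_iff]
  exact lt_of_lt_of_le (mul_pos (by linarith) hx) this

theorem sin_lt_three_quarters {β : ℝ} (hβ : 0 < β) (hβ' : β < Real.pi / 4) :
    Real.sin β < 3 / 4 := by
  have h1 : Real.sin β < Real.sin (Real.pi / 4) :=
    Real.sin_lt_sin_of_lt_of_le_pi_div_two (by linarith) (by linarith [Real.pi_pos]) hβ'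
  rw [Real.sin_pi_div_four] at h1
  nlinarith [Real.sq_sqrt (show (0 : ℝ) ≤ 2 by norm_num), Real.sqrt_nonneg 2]

theorem norm_scaledPoint_ge (hs : IsScalingFunction s) {lam : ℂ} {r x β : ℝ} (hr : 0 ≤ r)
    (hx : 0 ≤ x) (hβ : 0 < β) (hβ' : β < Real.pi / 4) (hlam : ‖lam‖ < Real.sin β) :
    x / 4 ≤ ‖scaledPoint s lam r x‖ := by
  have h := (norm_scaledPoint_bounds hs (lam := lam) hr hx).1
  nlinarith [sin_lt_three_quarters hβ hβ']

theorem norm_scaledPoint_le (hs : IsScalingFunction s) {lam : ℂ} {r x β : ℝ} (hr : 0 ≤ r)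
    (hx : 0 ≤ x) (hlam : ‖lam‖ < Real.sin β) :
    ‖scaledPoint s lam r x‖ ≤ 2 * x := by
  have h := (norm_scaledPoint_bounds hs (lam := lam) hr hx).2
  nlinarith [Real.sin_le_one β]

/-- The angular distance from the point of the curve to the boundary of `𝕊_β`. -/
def angularGap (s : ℝ → ℝ) (lam : ℂ) (r β x : ℝ) : ℝ := β - |(scaledPoint s lam r x).arg|

theorem norm_mul_sin_angularGap (hs : IsScalingFunction s) {lam : ℂ} {r x β : ℝ} (hr : 0 ≤ r)
    (hx : 0 < x) (hβ : 0 < β) (hβ' : β < Real.pi / 4) (hlam : ‖lam‖ < Real.sin β) :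
    ‖scaledPoint s lam r x‖ * Real.sin (angularGap s lam r β x) =
      min (Real.sin β * x - (lam.im * Real.cos β - lam.re * Real.sin β) * s (x - r))
        (Real.sin β * x - (-lam.im * Real.cos β - lam.re * Real.sin β) * s (x - r)) := by
  have harg := abs_lt.1 (abs_arg_scaledPoint_lt hs hr hx hβ hβ' hlam)
  rw [← norm_mul_sin_upper s lam r x β, ← norm_mul_sin_lower s lam r x β,
    ← mul_min_of_nonneg _ _ (norm_nonneg _), angularGap]
  congr 1
  set θ := (scaledPoint s lam r x).arg
  rcases le_total 0 θ with h | h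
  · rw [abs_of_nonneg h, min_eq_left]
    exact Real.sin_le_sin_of_le_of_le_pi_div_two (by linarith) (by linarith) (by linarith)
  · rw [abs_of_nonpos h, min_eq_right, sub_neg_eq_add]
    exact Real.sin_le_sin_of_le_of_le_pi_div_two (by linarith) (by linarith) (by linarith)

theorem angularGap_compare (hs : IsScalingFunction s) {lam : ℂ} {r C x y β : ℝ} (hr : 0 < r)
    (hC : 0 < C) (hsC : ∀ x ≥ 0, x - s x ≤ C) (hβ : 0 < β) (hβ' : β < Real.pi / 4)
    (hlam : ‖lam‖ < Real.sin β) (hx : r ≤ x) (hy : r ≤ y)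
    (hxy : |Real.log ‖scaledPoint s lam r x‖ - Real.log ‖scaledPoint s lam r y‖| ≤ 2) :
    angularGap s lam r β x ≤ 1024 * (2 + (r + C) / r) * angularGap s lam r β y := by
  have hx0 : 0 < x := hr.trans_le hx
  have hy0 : 0 < y := hr.trans_le hy
  set X := ‖scaledPoint s lam r x‖ with hXd
  set Y := ‖scaledPoint s lam r y‖ with hYd
  have hX1 := norm_scaledPoint_ge hs hr.le hx0.le hβ hβ' hlam
  have hY1 := norm_scaledPoint_ge hs hr.le hy0.le hβ hβ' hlam
  have hX2 := norm_scaledPoint_le hs hr.le hx0.le hlam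
  have hY2 := norm_scaledPoint_le hs hr.le hy0.le hlam
  rw [← hXd] at hX1 hX2
  rw [← hYd] at hY1 hY2
  have hX0 : 0 < X := by linarith
  have hY0 : 0 < Y := by linarith
  have he : Real.exp 2 ≤ 8 := by
    have h1 := Real.exp_one_lt_d9
    rw [show (2 : ℝ) = 1 + 1 by norm_num, Real.exp_add]
    nlinarith [Real.exp_pos 1]
  have hXY : X ≤ 8 * Y := by
    have h1 : Real.log X ≤ Real.log Y + 2 := by linarith [(abs_le.1 hxy).2]
    calc X = Real.exp (Real.log X) := (Real.exp_log hX0).symm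
      _ ≤ Real.exp (Real.log Y + 2) := Real.exp_le_exp.2 h1
      _ = Y * Real.exp 2 := by rw [Real.exp_add, Real.exp_log hY0]
      _ ≤ 8 * Y := by nlinarith
  have hYX : Y ≤ 8 * X := by
    have h1 : Real.log Y ≤ Real.log X + 2 := by linarith [(abs_le.1 hxy).1]
    calc Y = Real.exp (Real.log Y) := (Real.exp_log hY0).symm
      _ ≤ Real.exp (Real.log X + 2) := Real.exp_le_exp.2 h1
      _ = X * Real.exp 2 := by rw [Real.exp_add, Real.exp_log hX0]
      _ ≤ 8 * X := by nlinarith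
  have hM : x ≤ 64 * y := by linarith
  set Q := 2 + (r + C) / r with hQ
  have hQ0 : 0 < Q := by positivity
  have hsin0 : 0 ≤ Real.sin β := (norm_nonneg lam).trans hlam.le
  have hup := dist_compare hs hr hC hsC hsin0 ((abs_im_rot_le lam β).trans hlam.le)
    (by norm_num : (1 : ℝ) ≤ 64) hx hy hM
  have hlo := dist_compare hs hr hC hsC hsin0
    (μ := -lam.im * Real.cos β - lam.re * Real.sin β) (by
      have := abs_im_rot_le (starRingEnd ℂ lam) β
      simp only [Complex.conj_im, Complex.conj_re, Complex.norm_conj] at this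
      exact this.trans hlam.le) (by norm_num : (1 : ℝ) ≤ 64) hx hy hM
  have hmin : X * Real.sin (angularGap s lam r β x) ≤
      64 * Q * (Y * Real.sin (angularGap s lam r β y)) := by
    rw [hXd, hYd, norm_mul_sin_angularGap hs hr.le hx0 hβ hβ' hlam,
      norm_mul_sin_angularGap hs hr.le hy0 hβ hβ' hlam,
      mul_min_of_nonneg _ _ (by positivity)]
    exact min_le_min hup hlo
  set δx := angularGap s lam r β x
  set δy := angularGap s lam r β y
  have hδx : 0 < δx := sub_pos.2 (abs_arg_scaledPoint_lt hs hr.le hx0 hβ hβ' hlam)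
  have hδy : 0 < δy := sub_pos.2 (abs_arg_scaledPoint_lt hs hr.le hy0 hβ hβ' hlam)
  have hδx' : δx ≤ β := sub_le_self _ (abs_nonneg _)
  have h1 : 2 / Real.pi * δx ≤ Real.sin δx := Real.mul_le_sin hδx.le (by linarith)
  have h2 : Real.sin δy ≤ δy := Real.sin_le hδy.le
  have hpi := Real.pi_pos
  have hpi4 := Real.pi_le_four
  have h3 : δx / 2 ≤ 2 / Real.pi * δx := by
    have : 1 / 2 ≤ 2 / Real.pi := by rw [div_le_div_iff₀ (by norm_num) hpi]; linarith
    nlinarith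
  have h4 : X * (δx / 2) ≤ 64 * Q * (8 * X * δy) := by
    calc X * (δx / 2) ≤ X * Real.sin δx := by gcongr; linarith
      _ ≤ 64 * Q * (Y * Real.sin δy) := hmin
      _ ≤ 64 * Q * (8 * X * δy) := by
          have hδy' : δy ≤ β := sub_le_self _ (abs_nonneg _)
          have := Real.sin_nonneg_of_nonneg_of_le_pi hδy.le (by linarith)
          gcongr
  have h5 : X * δx ≤ X * (1024 * Q * δy) := by linarith
  exact le_of_mul_le_mul_left h5 hX0

end Curve
end PML

namespace PML

theorem lintegral_cauchy_kernel {D : ℝ} (hD : 0 < D) (t : ℝ) :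
    ∫⁻ τ : ℝ, ENNReal.ofReal (D / (D ^ 2 + (τ - t) ^ 2)) = ENNReal.ofReal Real.pi := by
  have e : ∀ x : ℝ, D / (D ^ 2 + x ^ 2) = D⁻¹ * (1 + (x / D) ^ 2)⁻¹ := by
    intro x; field_simp
  rw [lintegral_sub_right_eq_self (fun τ => ENNReal.ofReal (D / (D ^ 2 + τ ^ 2))) t,
    ← ofReal_integral_eq_lintegral_ofReal]
  · congr 1
    simp_rw [e]
    rw [integral_const_mul, Measure.integral_comp_div (fun x : ℝ => (1 + x ^ 2)⁻¹) D,
      integral_univ_inv_one_add_sq, smul_eq_mul, abs_of_pos hD, inv_mul_cancel_left₀ hD.ne']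
  · simp_rw [e]
    exact (integrable_inv_one_add_sq.comp_div hD.ne').const_mul _
  · exact Eventually.of_forall fun x => by positivity

variable {s : ℝ → ℝ}

theorem hasDerivAt_log_norm_scaledPoint (hs : IsScalingFunction s) {lam : ℂ} {r x β : ℝ}
    (hr : 0 ≤ r) (hx : 0 < x) (hβ : 0 < β) (hβ' : β < Real.pi / 4) (hlam : ‖lam‖ < Real.sin β) :
    ∃ d, HasDerivAt (fun x => Real.log ‖scaledPoint s lam r x‖) d x ∧ 1 / (64 * x) ≤ d := by
  have hn0 : 0 < ‖scaledPoint s lam r x‖ := by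
    have := norm_scaledPoint_ge hs hr hx.le hβ hβ' hlam
    linarith
  have hnsq : ∀ x, ‖scaledPoint s lam r x‖ ^ 2 =
      (x + lam.re * s (x - r)) ^ 2 + (lam.im * s (x - r)) ^ 2 := by
    intro x
    rw [← Complex.normSq_eq_norm_sq, Complex.normSq_apply, scaledPoint_re, scaledPoint_im]; ring
  have hfun : (fun x => Real.log ‖scaledPoint s lam r x‖) = fun x => 1 / 2 * Real.log
      ((x + lam.re * s (x - r)) ^ 2 + (lam.im * s (x - r)) ^ 2) := by
    ext x
    rw [← hnsq, Real.log_pow]; push_cast; ring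
  set σ := s (x - r) with hσ
  set σ' := deriv s (x - r)
  have h1 : HasDerivAt (fun x => s (x - r)) σ' x :=
    (hs.differentiable (x - r)).hasDerivAt.comp_sub_const x r
  have hN : HasDerivAt (fun x => (x + lam.re * s (x - r)) ^ 2 + (lam.im * s (x - r)) ^ 2)
      (2 * (x + lam.re * σ) * (1 + lam.re * σ') + 2 * (lam.im * σ) * (lam.im * σ')) x := by
    have h2 : HasDerivAt (fun x => x + lam.re * s (x - r)) (1 + lam.re * σ') x :=
      (hasDerivAt_id x).add (h1.const_mul lam.re)
    have h3 : HasDerivAt (fun x => lam.im * s (x - r)) (lam.im * σ') x := h1.const_mul lam.im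
    refine ((h2.fun_pow 2).fun_add (h3.fun_pow 2)).congr_deriv ?_
    push_cast
    ring
  have hpos : (x + lam.re * σ) ^ 2 + (lam.im * σ) ^ 2 ≠ 0 := by
    rw [hσ, ← hnsq]; positivity
  refine ⟨_, hfun ▸ (hN.log hpos).const_mul (1 / 2), ?_⟩
  have hN2 := hnsq x
  rw [← hσ] at hN2
  rw [← hN2]
  have hle := norm_scaledPoint_le hs hr hx.le hlam
  have ha := abs_le.1 (Complex.abs_re_le_norm lam)
  have h34 := sin_lt_three_quarters hβ hβ'
  have hσ0 : 0 ≤ σ := hs.nonneg _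
  have hσx : σ ≤ x := hs.shift_le hr hx.le
  have hσ'0 : 0 ≤ σ' := hs.deriv_nonneg _
  have hσ'1 : σ' ≤ 1 := hs.deriv_le_one _
  have e1 : x / 4 ≤ x + lam.re * σ := by nlinarith
  have e2 : 1 / 4 ≤ 1 + lam.re * σ' := by nlinarith
  have e3 : 0 ≤ (lam.im * σ) * (lam.im * σ') := by
    have : (lam.im * σ) * (lam.im * σ') = lam.im ^ 2 * (σ * σ') := by ring
    rw [this]; positivity
  have e4 : x / 16 ≤ (x + lam.re * σ) * (1 + lam.re * σ') := by nlinarith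
  have e5 : ‖scaledPoint s lam r x‖ ^ 2 ≤ 4 * x ^ 2 := by nlinarith
  rw [← mul_div_assoc, div_le_div_iff₀ (by positivity) (by positivity)]
  nlinarith

/-- The Schur test for the Poisson type kernel along the curve. -/
theorem lintegral_poisson_curve_le (hs : IsScalingFunction s) {lam : ℂ} {r C β : ℝ} (hr : 0 < r)
    (hC : 0 < C) (hsC : ∀ x ≥ 0, x - s x ≤ C) (hβ : 0 < β) (hβ' : β < Real.pi / 4)
    (hlam : ‖lam‖ < Real.sin β) (t : ℝ) :
    ∫⁻ x in Ici r, ENNReal.ofReal (‖scaledPoint s lam r x‖⁻¹ * (angularGap s lam r β x /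
      (angularGap s lam r β x ^ 2 + (t - Real.log ‖scaledPoint s lam r x‖) ^ 2))) ≤
    ENNReal.ofReal (256 * ((1024 * (2 + (r + C) / r)) ^ 2 + 2) * Real.pi) := by
  set K : ℝ := 1024 * (2 + (r + C) / r)
  have hK1 : 1 ≤ K := by
    have : 0 ≤ (r + C) / r := by positivity
    simp only [K]; linarith
  set τ : ℝ → ℝ := fun x => Real.log ‖scaledPoint s lam r x‖ with hτ
  set δ := angularGap s lam r β with hδ
  have hpos : ∀ x ∈ Ici r, 0 < x := fun x hx => hr.trans_le hx
  have hδ0 : ∀ x ∈ Ici r, 0 < δ x := fun x hx =>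
    sub_pos.2 (abs_arg_scaledPoint_lt hs hr.le (hpos x hx) hβ hβ' hlam)
  have hδ1 : ∀ x, δ x ≤ 1 := fun x => by
    have : δ x ≤ β := sub_le_self _ (abs_nonneg _)
    linarith [Real.pi_le_four]
  choose! d hd hd' using fun x (hx : x ∈ Ici r) =>
    hasDerivAt_log_norm_scaledPoint hs hr.le (hpos x hx) hβ hβ' hlam
  have hd0 : ∀ x ∈ Ici r, 0 < d x := fun x hx =>
    lt_of_lt_of_le (by have := hpos x hx; positivity) (hd' x hx)
  -- a kernel with frozen scale
  obtain ⟨D, hD, hker⟩ : ∃ D > 0, ∀ x ∈ Ici r, δ x / (δ x ^ 2 + (t - τ x) ^ 2) ≤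
      K ^ 2 * (D / (D ^ 2 + (τ x - t) ^ 2)) + 2 * (1 / (1 ^ 2 + (τ x - t) ^ 2)) := by
    have hout : ∀ x ∈ Ici r, 1 < |τ x - t| →
        δ x / (δ x ^ 2 + (t - τ x) ^ 2) ≤ 2 * (1 / (1 ^ 2 + (τ x - t) ^ 2)) := by
      intro x hx hfar
      have h1 : 1 < (τ x - t) ^ 2 := by
        rw [← sq_abs]; nlinarith
      have := hδ0 x hx
      have := hδ1 x
      rw [← sub_sq_comm (τ x) t, mul_one_div, div_le_div_iff₀ (by positivity) (by positivity)]
      nlinarith [sq_nonneg (δ x)]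
    by_cases hex : ∃ x₁ ∈ Ici r, |τ x₁ - t| ≤ 1
    · obtain ⟨x₁, hx₁, hnear⟩ := hex
      have hD1 := hδ0 x₁ hx₁
      refine ⟨δ x₁ / K, by positivity, fun x hx => ?_⟩
      rcases le_or_gt |τ x - t| 1 with hin | hfar
      · have hclose : |τ x - τ x₁| ≤ 2 := by
          have := abs_sub_le (τ x) t (τ x₁)
          rw [abs_sub_comm t] at this
          linarith
        have h1 : δ x ≤ K * δ x₁ :=
          angularGap_compare hs hr hC hsC hβ hβ' hlam hx hx₁ hclose
        have h2 : δ x₁ ≤ K * δ x :=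
          angularGap_compare hs hr hC hsC hβ hβ' hlam hx₁ hx (by rwa [abs_sub_comm])
        have h3 : δ x₁ / K ≤ δ x := by rw [div_le_iff₀ (by positivity)]; linarith
        have hx0 := hδ0 x hx
        calc δ x / (δ x ^ 2 + (t - τ x) ^ 2)
            ≤ (K * δ x₁) / ((δ x₁ / K) ^ 2 + (τ x - t) ^ 2) := by
              rw [← sub_sq_comm (τ x) t]
              gcongr
          _ = K ^ 2 * (δ x₁ / K / ((δ x₁ / K) ^ 2 + (τ x - t) ^ 2)) := by field_simp
          _ ≤ _ := le_add_of_nonneg_right (by positivity)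
      · exact (hout x hx hfar).trans (le_add_of_nonneg_left (by positivity))
    · push Not at hex
      exact ⟨1, one_pos, fun x hx => (hout x hx (hex x hx)).trans
        (le_add_of_nonneg_left (by positivity))⟩
  set k : ℝ → ℝ≥0∞ := fun u => ENNReal.ofReal (256 * K ^ 2) *
    ENNReal.ofReal (D / (D ^ 2 + (u - t) ^ 2)) +
      ENNReal.ofReal (256 * 2) * ENNReal.ofReal (1 / (1 ^ 2 + (u - t) ^ 2))
  have hmono : StrictMonoOn τ (Ici r) := by
    refine strictMonoOn_of_deriv_pos (convex_Ici r)
      (fun x hx => (hd x hx).continuousAt.continuousWithinAt) fun x hx => ?_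
    have hx' : x ∈ Ici r := interior_subset hx
    rw [(hd x hx').deriv]
    exact hd0 x hx'
  calc _ ≤ ∫⁻ x in Ici r, ENNReal.ofReal |d x| * k (τ x) := by
        refine setLIntegral_mono' measurableSet_Ici fun x hx => ?_
        have hx0 := hpos x hx
        have h1 : ‖scaledPoint s lam r x‖⁻¹ ≤ 256 * d x := by
          have h2 := norm_scaledPoint_ge hs hr.le hx0.le hβ hβ' hlam
          calc ‖scaledPoint s lam r x‖⁻¹ ≤ (x / 4)⁻¹ := by gcongr
            _ = 256 * (1 / (64 * x)) := by field_simp; norm_num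
            _ ≤ 256 * d x := by gcongr; exact hd' x hx
        have hdx := hd0 x hx
        rw [abs_of_pos hdx]
        simp only [k]
        rw [← ENNReal.ofReal_mul (by positivity), ← ENNReal.ofReal_mul (by positivity),
          ← ENNReal.ofReal_add (by positivity) (by positivity), ← ENNReal.ofReal_mul hdx.le]
        refine ENNReal.ofReal_le_ofReal ?_
        have hx1 := hδ0 x hx
        calc _ ≤ (256 * d x) * (K ^ 2 * (D / (D ^ 2 + (τ x - t) ^ 2)) +
              2 * (1 / (1 ^ 2 + (τ x - t) ^ 2))) :=
              mul_le_mul h1 (hker x hx) (by positivity) (by positivity)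
          _ = _ := by ring
    _ = ∫⁻ u in τ '' Ici r, k u :=
        (lintegral_image_eq_lintegral_abs_deriv_mul measurableSet_Ici
          (fun x hx => (hd x hx).hasDerivWithinAt) hmono.injOn k).symm
    _ ≤ ∫⁻ u, k u := setLIntegral_le_lintegral _ _
    _ = _ := by
        simp only [k]
        rw [lintegral_add_left (by fun_prop), lintegral_const_mul' _ _ ENNReal.ofReal_ne_top,
          lintegral_const_mul' _ _ ENNReal.ofReal_ne_top, lintegral_cauchy_kernel hD,
          lintegral_cauchy_kernel one_pos, ← ENNReal.ofReal_mul (by positivity),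
          ← ENNReal.ofReal_mul (by positivity), ← ENNReal.ofReal_add (by positivity)
          (by positivity)]
        congr 1; ring

end PML

namespace PML

variable {H : Type*} [NormedAddCommGroup H] [InnerProductSpace ℂ H] {s : ℝ → ℝ}

theorem continuous_scaledPoint (hs : IsScalingFunction s) (r : ℝ) :
    Continuous fun p : ℂ × ℝ => scaledPoint s p.1 r p.2 := by
  have := hs.smooth.continuous
  unfold scaledPoint
  fun_prop

theorem SectorHardy.lintegral_curve_Ici_le {α β r C : ℝ} {F : ℂ → H} {lam : ℂ}
    (hs : IsScalingFunction s) (hα : α ≤ Real.pi) (h : SectorHardy α F) (hr : 0 < r) (hC : 0 < C)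
    (hsC : ∀ x ≥ 0, x - s x ≤ C) (hβ : 0 < β) (hβ' : β < Real.pi / 4) (hβα : β < α)
    (hlam : ‖lam‖ < Real.sin β) :
    ∫⁻ x in Ici r, ‖F (scaledPoint s lam r x)‖ₑ ^ 2 ≤
      ENNReal.ofReal (8 / Real.pi) * (ENNReal.ofReal (256 * ((1024 * (2 + (r + C) / r)) ^ 2 + 2) *
        Real.pi) * (rayNormSq F (-β) + rayNormSq F β)) := by
  have hS := h.stripHardy hα
  set G := stripFun F
  have hab : |-β| < α := by rwa [abs_neg, abs_of_pos hβ]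
  have hab' : |β| < α := by rwa [abs_of_pos hβ]
  set B : ℝ → ℝ≥0∞ := fun t =>
    ‖G (t + (-β : ℝ) * Complex.I)‖ₑ ^ 2 + ‖G (t + β * Complex.I)‖ₑ ^ 2
  have hBm : Measurable B :=
    ((hS.continuous_line hab).enorm.measurable.pow_const 2).add
      ((hS.continuous_line hab').enorm.measurable.pow_const 2)
  have hBint : ∫⁻ t, B t = rayNormSq F (-β) + rayNormSq F β := by
    rw [← lineNormSq_stripFun, ← lineNormSq_stripFun]
    exact lintegral_add_left ((hS.continuous_line hab).enorm.measurable.pow_const 2) _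
  set k : ℝ → ℝ → ℝ≥0∞ := fun x t => ENNReal.ofReal (‖scaledPoint s lam r x‖⁻¹ *
    (angularGap s lam r β x /
      (angularGap s lam r β x ^ 2 + (t - Real.log ‖scaledPoint s lam r x‖) ^ 2)))
  have hkm : Measurable (Function.uncurry k) := by
    have h1 : Measurable fun p : ℝ × ℝ => scaledPoint s lam r p.1 :=
      ((continuous_scaledPoint hs r).comp (by fun_prop : Continuous fun p : ℝ × ℝ =>
        (lam, p.1))).measurable
    have h2 : Measurable fun p : ℝ × ℝ => angularGap s lam r β p.1 := by
      have := (Complex.measurable_arg.comp h1).norm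
      exact measurable_const.sub this
    have h3 : Measurable fun p : ℝ × ℝ => ‖scaledPoint s lam r p.1‖ := h1.norm
    have h4 := Real.measurable_log.comp h3
    refine ENNReal.measurable_ofReal.comp (h3.inv.mul (h2.div ((h2.pow_const 2).add
      ((measurable_snd.sub h4).pow_const 2))))
  calc ∫⁻ x in Ici r, ‖F (scaledPoint s lam r x)‖ₑ ^ 2
      ≤ ∫⁻ x in Ici r, ENNReal.ofReal (8 / Real.pi) * ∫⁻ t, k x t * B t := by
        refine setLIntegral_mono' measurableSet_Ici fun x hx => ?_
        have hx0 : 0 < x := hr.trans_le hx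
        have hm := scaledPoint_mem_sector hs hr.le hx0 hβ hβ' hlam
        have hz : 0 < ‖scaledPoint s lam r x‖ := norm_pos_iff.2 hm.1
        have h1 := enorm_stripFun_log_sq F hm.1
        have h2 := hS.enorm_sq_le_poisson hβα (w := Complex.log (scaledPoint s lam r x))
          (log_mem_strip hm)
        rw [h1] at h2
        have h3 : ‖F (scaledPoint s lam r x)‖ₑ ^ 2 =
            ENNReal.ofReal (‖scaledPoint s lam r x‖⁻¹) *
              (ENNReal.ofReal ‖scaledPoint s lam r x‖ * ‖F (scaledPoint s lam r x)‖ₑ ^ 2) := by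
          rw [← mul_assoc, ← ENNReal.ofReal_mul (by positivity), inv_mul_cancel₀ hz.ne']
          simp
        rw [h3]
        refine (mul_le_mul_right h2 _).trans (le_of_eq ?_)
        rw [mul_left_comm]
        congr 1
        rw [← lintegral_const_mul' _ _ ENNReal.ofReal_ne_top]
        refine lintegral_congr fun t => ?_
        rw [← mul_assoc, ← ENNReal.ofReal_mul (by positivity), Complex.log_im, Complex.log_re]
        rfl
    _ = ENNReal.ofReal (8 / Real.pi) * ∫⁻ t, ∫⁻ x in Ici r, k x t * B t := by
        rw [lintegral_const_mul' _ _ ENNReal.ofReal_ne_top]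
        congr 1
        refine lintegral_lintegral_swap ?_
        exact (hkm.mul (hBm.comp measurable_snd)).aemeasurable
    _ ≤ _ := by
        gcongr
        rw [← hBint, ← lintegral_const_mul _ hBm]
        refine lintegral_mono fun t => ?_
        have hk1 : Measurable fun x => k x t := hkm.comp measurable_prodMk_right
        rw [lintegral_mul_const _ hk1]
        gcongr
        exact lintegral_poisson_curve_le hs hr hC hsC hβ hβ' hlam t

theorem SectorHardy.lintegral_curve_le (hs : IsScalingFunction s) {r : ℝ} (hr : 0 < r) :
    ∃ K : ℝ≥0, ∀ {H : Type*} [NormedAddCommGroup H] [InnerProductSpace ℂ H] {α β : ℝ}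
      {F : ℂ → H} {lam : ℂ}, α ≤ Real.pi → SectorHardy α F → 0 < β → β < Real.pi / 4 → β < α →
      ‖lam‖ < Real.sin β → ∫⁻ x in Ioi (0 : ℝ), ‖F (scaledPoint s lam r x)‖ₑ ^ 2 ≤
        K * (rayNormSq F (-β) + rayNormSq F β) := by
  obtain ⟨C, hC, hsC⟩ := hs.exists_sub_le
  refine ⟨1 + Real.toNNReal (8 / Real.pi) * Real.toNNReal
    (256 * ((1024 * (2 + (r + C) / r)) ^ 2 + 2) * Real.pi), ?_⟩
  intro H _ _ α β F lam hα h hβ hβ' hβα hlam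
  have h1 := h.lintegral_curve_Ici_le hs hα hr hC hsC hβ hβ' hβα hlam
  rw [← Ioo_union_Ici_eq_Ioi hr, lintegral_union measurableSet_Ici
    (by rw [Set.disjoint_left]; intro x hx hx'; exact not_le.2 hx.2 hx')]
  push_cast
  rw [add_mul, one_mul, mul_assoc]
  refine add_le_add ?_ h1
  refine le_trans ?_ (h.rayNormSq_le hα hβα (ψ := 0) (by simpa using hβ.le))
  calc ∫⁻ x in Ioo 0 r, ‖F (scaledPoint s lam r x)‖ₑ ^ 2
      = ∫⁻ x in Ioo 0 r, ‖F (Complex.exp ((0 : ℝ) * Complex.I) * x)‖ₑ ^ 2 := by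
        refine setLIntegral_congr_fun measurableSet_Ioo fun x hx => ?_
        simp [scaledPoint, hs.eq_zero (x - r) (by linarith [hx.2])]
    _ ≤ _ := lintegral_mono_set Ioo_subset_Ioi_self

/-- The uniform estimate along the curves `x + λ s(x - r)` by the boundary limits. -/
theorem SectorHardy.lintegral_curve_le_limit (hs : IsScalingFunction s) {r : ℝ} (hr : 0 < r) :
    ∃ K : ℝ≥0, ∀ {H : Type*} [NormedAddCommGroup H] [InnerProductSpace ℂ H] {α : ℝ}
      {F : ℂ → H} {lam : ℂ} {u v : Lp H 2 (volume.restrict (Ioi (0 : ℝ)))}, 0 < α →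
      α < Real.pi / 4 → SectorHardy α F → ‖lam‖ < Real.sin α →
      Tendsto (rayLp F) (𝓝[>] (-α)) (𝓝 u) → Tendsto (rayLp F) (𝓝[<] α) (𝓝 v) →
      ∫⁻ x in Ioi (0 : ℝ), ‖F (scaledPoint s lam r x)‖ₑ ^ 2 ≤ K * (‖u‖ₑ ^ 2 + ‖v‖ₑ ^ 2) := by
  obtain ⟨K, hK⟩ := SectorHardy.lintegral_curve_le hs hr
  refine ⟨K, ?_⟩
  intro H _ _ α F lam u v hα hα' h hlam hu hv
  have hpi : α ≤ Real.pi := by linarith [Real.pi_pos]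
  have ht : Tendsto (fun β : ℝ => -β) (𝓝[<] α) (𝓝[>] (-α)) := tendsto_neg_nhdsLT
  have hlim : Tendsto (fun β => (K : ℝ≥0∞) * (‖rayLp F (-β)‖ₑ ^ 2 + ‖rayLp F β‖ₑ ^ 2)) (𝓝[<] α)
      (𝓝 (K * (‖u‖ₑ ^ 2 + ‖v‖ₑ ^ 2))) := by
    refine ENNReal.Tendsto.const_mul ?_ (Or.inr ENNReal.coe_ne_top)
    exact (ENNReal.Tendsto.pow (hu.comp ht).enorm).add (ENNReal.Tendsto.pow hv.enorm)
  refine ge_of_tendsto hlim ?_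
  have h1 : ∀ᶠ β in 𝓝[<] α, ‖lam‖ < Real.sin β :=
    (Real.continuous_sin.tendsto α).mono_left nhdsWithin_le_nhds |>.eventually (lt_mem_nhds hlam)
  filter_upwards [h1, Ioo_mem_nhdsLT hα] with β hlamβ hβ
  rw [h.enorm_rayLp_sq hpi ⟨by linarith [hβ.2], by linarith [hβ.1]⟩,
    h.enorm_rayLp_sq hpi ⟨by linarith [hβ.1], hβ.2⟩]
  exact hK hpi h hβ.1 (hβ.2.trans hα') hβ.2 hlamβ

end PML

namespace PML

section AnalyticFamily

variable {X : Type*} [MeasurableSpace X] {μ : Measure X} {H : Type*} [NormedAddCommGroup H]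
  [NormedSpace ℂ H]

theorem enorm_circleAverage_sq_le (f : ℂ → H) (c : ℂ) (R : ℝ) :
    ‖Real.circleAverage f c R‖ₑ ^ 2 ≤ ENNReal.ofReal (2 * Real.pi)⁻¹ *
      ∫⁻ θ in Ioc 0 (2 * Real.pi), ‖f (circleMap c R θ)‖ₑ ^ 2 := by
  have hpi := Real.pi_pos
  by_cases hf : AEStronglyMeasurable (fun θ => f (circleMap c R θ))
      (volume.restrict (Ioc 0 (2 * Real.pi)))
  swap
  · have : ¬ IntervalIntegrable (fun θ => f (circleMap c R θ)) volume 0 (2 * Real.pi) := by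
      rw [intervalIntegrable_iff_integrableOn_Ioc_of_le (by positivity)]
      exact fun h => hf h.aestronglyMeasurable
    rw [Real.circleAverage_def, intervalIntegral.integral_undef this]
    simp
  have h1 : ‖Real.circleAverage f c R‖ₑ ≤ ENNReal.ofReal (2 * Real.pi)⁻¹ *
      ∫⁻ θ in Ioc 0 (2 * Real.pi), ‖f (circleMap c R θ)‖ₑ := by
    rw [Real.circleAverage_def, enorm_smul, intervalIntegral.integral_of_le (by positivity)]
    gcongr
    · rw [← ofReal_norm, Real.norm_eq_abs, abs_of_pos (by positivity)]
    · exact enorm_integral_le_lintegral_enorm _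
  have h2 : (∫⁻ θ in Ioc 0 (2 * Real.pi), ‖f (circleMap c R θ)‖ₑ) ^ 2 ≤
      ENNReal.ofReal (2 * Real.pi) * ∫⁻ θ in Ioc 0 (2 * Real.pi), ‖f (circleMap c R θ)‖ₑ ^ 2 := by
    have h3 := eLpNorm_le_eLpNorm_mul_rpow_measure_univ (p := 1) (q := 2) (by norm_num) hf
    rw [eLpNorm_one_eq_lintegral_enorm] at h3
    have h4 := pow_le_pow_left' h3 2
    rw [mul_pow, eLpNorm_two_sq, ← ENNReal.rpow_natCast _ 2, ← ENNReal.rpow_natCast (_ ^ _) 2,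
      ← ENNReal.rpow_mul] at h4
    norm_num at h4
    rw [ENNReal.ofReal_mul (by norm_num), ENNReal.ofReal_ofNat]
    exact h4.trans_eq (mul_comm _ _)
  calc _ ≤ (ENNReal.ofReal (2 * Real.pi)⁻¹ *
        ∫⁻ θ in Ioc 0 (2 * Real.pi), ‖f (circleMap c R θ)‖ₑ) ^ 2 := pow_le_pow_left' h1 2
    _ ≤ ENNReal.ofReal (2 * Real.pi)⁻¹ ^ 2 * (ENNReal.ofReal (2 * Real.pi) *
        ∫⁻ θ in Ioc 0 (2 * Real.pi), ‖f (circleMap c R θ)‖ₑ ^ 2) := by rw [mul_pow]; gcongr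
    _ = _ := by
        rw [sq, ← mul_assoc, mul_assoc (ENNReal.ofReal (2 * Real.pi)⁻¹),
          ← ENNReal.ofReal_mul (by positivity), inv_mul_cancel₀ (by positivity)]
        simp

variable [SFinite μ]

theorem lintegral_circleAverage_smul_le {g : X → ℂ → H} {c : ℂ} {R : ℝ} {M : ℝ≥0∞}
    (hmeas : AEStronglyMeasurable (fun p : X × ℝ => g p.1 (circleMap c R p.2))
      (μ.prod (volume.restrict (Ioc 0 (2 * Real.pi)))))
    (hM : ∀ θ : ℝ, ∫⁻ x, ‖g x (circleMap c R θ)‖ₑ ^ 2 ∂μ ≤ M) {φ : ℂ → ℂ} {K : ℝ}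
    (hK : ∀ θ : ℝ, ‖φ (circleMap c R θ)‖ ≤ K) :
    ∫⁻ x, ‖Real.circleAverage (fun z => φ z • g x z) c R‖ₑ ^ 2 ∂μ ≤
      ENNReal.ofReal K ^ 2 * M := by
  have hpi := Real.pi_pos
  calc ∫⁻ x, ‖Real.circleAverage (fun z => φ z • g x z) c R‖ₑ ^ 2 ∂μ
      ≤ ∫⁻ x, ENNReal.ofReal (2 * Real.pi)⁻¹ * (ENNReal.ofReal K ^ 2 *
        ∫⁻ θ in Ioc 0 (2 * Real.pi), ‖g x (circleMap c R θ)‖ₑ ^ 2) ∂μ := by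
        refine lintegral_mono fun x => (enorm_circleAverage_sq_le _ c R).trans ?_
        gcongr
        rw [← lintegral_const_mul' _ _ (by finiteness)]
        refine lintegral_mono fun θ => ?_
        simp only
        rw [enorm_smul, mul_pow]
        gcongr
        rw [← ofReal_norm]
        exact ENNReal.ofReal_le_ofReal (hK θ)
    _ = ENNReal.ofReal (2 * Real.pi)⁻¹ * (ENNReal.ofReal K ^ 2 *
        ∫⁻ θ in Ioc 0 (2 * Real.pi), ∫⁻ x, ‖g x (circleMap c R θ)‖ₑ ^ 2 ∂μ) := by
        rw [lintegral_const_mul' _ _ ENNReal.ofReal_ne_top,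
          lintegral_const_mul' _ _ (by finiteness), lintegral_lintegral_swap]
        exact hmeas.enorm.pow_const 2
    _ ≤ ENNReal.ofReal (2 * Real.pi)⁻¹ * (ENNReal.ofReal K ^ 2 *
        ∫⁻ θ in Ioc 0 (2 * Real.pi), M) := by
        gcongr with θ
        exact hM θ
    _ = _ := by
        rw [setLIntegral_const, Real.volume_Ioc, sub_zero, ← mul_assoc, mul_comm M, ← mul_assoc,
          mul_right_comm (ENNReal.ofReal _), ← ENNReal.ofReal_mul (by positivity),
          inv_mul_cancel₀ (by positivity)]
        simp

variable [CompleteSpace H]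

/-- A pointwise holomorphic family which is bounded in `L²` is holomorphic as an `L²`-valued
function. -/
theorem differentiableOn_Lp_of_pointwise {g : X → ℂ → H} {Λ : Set ℂ} (hΛ : IsOpen Λ) {M : ℝ≥0∞}
    (hMtop : M ≠ ⊤)
    (hdiff : ∀ᵐ x ∂μ, DifferentiableOn ℂ (g x) Λ)
    (hmeas : ∀ c R, 0 < R → Metric.closedBall c R ⊆ Λ →
      AEStronglyMeasurable (fun p : X × ℝ => g p.1 (circleMap c R p.2))
        (μ.prod (volume.restrict (Ioc 0 (2 * Real.pi)))))
    (hM : ∀ z ∈ Λ, ∫⁻ x, ‖g x z‖ₑ ^ 2 ∂μ ≤ M) {U : ℂ → Lp H 2 μ}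
    (hU : ∀ z ∈ Λ, U z =ᵐ[μ] fun x => g x z) : DifferentiableOn ℂ U Λ := by
  intro c hc
  obtain ⟨R, hR, hball⟩ := Metric.nhds_basis_closedBall.mem_iff.1 (hΛ.mem_nhds hc)
  have hm := hmeas c R hR hball
  have hcirc : ∀ θ, circleMap c R θ ∈ Λ := fun θ =>
    hball (Metric.sphere_subset_closedBall (circleMap_mem_sphere c hR.le θ))
  have hMc : ∀ θ, ∫⁻ x, ‖g x (circleMap c R θ)‖ₑ ^ 2 ∂μ ≤ M := fun θ => hM _ (hcirc θ)
  have hnorm : ∀ θ, ‖circleMap c R θ - c‖ = R := fun θ => by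
    rw [circleMap_sub_center, norm_circleMap_zero, abs_of_pos hR]
  set D : X → H := fun x => Real.circleAverage (fun z => (z - c)⁻¹ • g x z) c R
  have hDm : AEStronglyMeasurable D μ := by
    simp only [D, Real.circleAverage_def]
    refine AEStronglyMeasurable.const_smul ?_ _
    simp only [intervalIntegral.integral_of_le Real.two_pi_pos.le]
    refine AEStronglyMeasurable.integral_prod_right' (f := fun p : X × ℝ =>
      (circleMap c R p.2 - c)⁻¹ • g p.1 (circleMap c R p.2)) ?_
    refine AEStronglyMeasurable.smul ?_ hm
    have : Measurable fun p : X × ℝ => (circleMap c R p.2 - c)⁻¹ :=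
      (((continuous_circleMap c R).measurable.comp measurable_snd).sub_const c).inv
    exact this.aestronglyMeasurable
  have hDL : MemLp D 2 μ := by
    refine memLp_two_of_lintegral hDm ?_
    refine (lintegral_circleAverage_smul_le hm hMc (φ := fun z => (z - c)⁻¹) (K := R⁻¹)
      fun θ => ?_).trans_lt ?_
    · rw [norm_inv, hnorm]
    · exact ENNReal.mul_lt_top (by finiteness) hMtop.lt_top
  have hrem : ∀ w, ‖w - c‖ ≤ R / 2 →
      ‖U w - U c - (w - c) • hDL.toLp D‖ ≤ 2 * ‖w - c‖ ^ 2 / R ^ 2 * M.toReal.sqrt := by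
    intro w hw
    have hwball : w ∈ Metric.ball c R := by
      rw [Metric.mem_ball, dist_eq_norm]; linarith
    have hwΛ : w ∈ Λ := hball (Metric.ball_subset_closedBall hwball)
    set φ : ℂ → ℂ := fun z => (w - c) ^ 2 / ((z - c) * (z - w))
    have hden : ∀ θ, R / 2 ≤ ‖circleMap c R θ - w‖ := fun θ => by
      have h1 := norm_sub_norm_le (circleMap c R θ - c) (w - c)
      rw [hnorm, sub_sub_sub_cancel_right] at h1
      linarith
    have hφ : ∀ θ, ‖φ (circleMap c R θ)‖ ≤ 2 * ‖w - c‖ ^ 2 / R ^ 2 := fun θ => by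
      simp only [φ]
      rw [norm_div, norm_mul, norm_pow, hnorm]
      calc ‖w - c‖ ^ 2 / (R * ‖circleMap c R θ - w‖) ≤ ‖w - c‖ ^ 2 / (R * (R / 2)) := by
            gcongr; exact hden θ
        _ = _ := by field_simp
    have hpt : (U w - U c - (w - c) • hDL.toLp D : Lp H 2 μ) =ᵐ[μ]
        fun x => Real.circleAverage (fun z => φ z • g x z) c R := by
      filter_upwards [hdiff, hU w hwΛ, hU c hc, Lp.coeFn_sub (U w - U c) ((w - c) • hDL.toLp D),
        Lp.coeFn_sub (U w) (U c), Lp.coeFn_smul (w - c) (hDL.toLp D), hDL.coeFn_toLp]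
        with x hx h1 h2 h3 h4 h5 h6
      rw [h3, Pi.sub_apply, h4, Pi.sub_apply, h5, Pi.smul_apply, h6, h1, h2]
      have hdc : DiffContOnCl ℂ (g x) (Metric.ball c |R|) := by
        rw [abs_of_pos hR]
        refine DifferentiableOn.diffContOnCl ?_
        rw [closure_ball _ hR.ne']
        exact hx.mono hball
      have hcont : ContinuousOn (g x) (Metric.sphere c R) :=
        hx.continuousOn.mono (Metric.sphere_subset_closedBall.trans hball)
      have hsub : ∀ z ∈ Metric.sphere c R, z - c ≠ 0 ∧ z - w ≠ 0 := by
        intro z hz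
        rw [Metric.mem_sphere, dist_eq_norm] at hz
        refine ⟨fun h0 => by rw [h0, norm_zero] at hz; linarith, fun h0 => ?_⟩
        have := sub_eq_zero.1 h0
        rw [this] at hz
        linarith
      have hci : ∀ ψ : ℂ → ℂ, ContinuousOn ψ (Metric.sphere c R) →
          CircleIntegrable (fun z => ψ z • g x z) c R := fun ψ hψ =>
        (hψ.smul hcont).circleIntegrable hR.le
      have e1 := hdc.circleAverage_smul_div (w := w) (by rwa [abs_of_pos hR])
      have e2 := hdc.circleAverage
      have e3 : D x = Real.circleAverage (fun z => (z - c)⁻¹ • g x z) c R := rfl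
      have i1 := hci (fun z => (z - c) / (z - w)) (ContinuousOn.div (by fun_prop) (by fun_prop)
        fun z hz => (hsub z hz).2)
      have i2 : CircleIntegrable (g x) c R := hcont.circleIntegrable hR.le
      have i3 := hci (fun z => (z - c)⁻¹) (ContinuousOn.inv₀ (by fun_prop)
        fun z hz => (hsub z hz).1)
      rw [← e1, ← e2, e3, ← Real.circleAverage_fun_smul, ← Real.circleAverage_fun_sub i1 i2,
        ← Real.circleAverage_fun_sub]
      · refine Real.circleAverage_congr_sphere fun z hz => ?_
        rw [abs_of_pos hR] at hz
        obtain ⟨n1, n2⟩ := hsub z hz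
        have e : φ z = (z - c) / (z - w) - 1 - (w - c) * (z - c)⁻¹ := by
          simp only [φ]
          field_simp
          ring
        rw [e]
        module
      · exact i1.sub i2
      · exact ContinuousOn.circleIntegrable hR.le (ContinuousOn.const_smul
          (ContinuousOn.smul (ContinuousOn.inv₀ (by fun_prop) fun z hz => (hsub z hz).1) hcont) _)
    have hle : ‖U w - U c - (w - c) • hDL.toLp D‖ₑ ^ 2 ≤
        ENNReal.ofReal (2 * ‖w - c‖ ^ 2 / R ^ 2) ^ 2 * M := by
      rw [enorm_Lp_two_sq, lintegral_congr_ae (hpt.mono fun x hx => by simp only [hx]; rfl)]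
      exact lintegral_circleAverage_smul_le hm hMc hφ
    have h7 := ENNReal.toReal_mono (ENNReal.mul_ne_top (by finiteness) hMtop) hle
    rw [ENNReal.toReal_mul, ENNReal.toReal_pow, ENNReal.toReal_pow, toReal_enorm,
      ENNReal.toReal_ofReal (by positivity)] at h7
    apply le_of_sq_le_sq _ (by positivity)
    rw [mul_pow, Real.sq_sqrt ENNReal.toReal_nonneg]
    exact h7
  have hder : HasDerivAt U (hDL.toLp D) c := by
    rw [hasDerivAt_iff_isLittleO, Asymptotics.isLittleO_iff]
    intro ε hε
    set K := 2 / R ^ 2 * M.toReal.sqrt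
    have hK : 0 ≤ K := by positivity
    have h1 : ∀ᶠ w in 𝓝 c, ‖w - c‖ < min (R / 2) (ε / (K + 1)) := by
      have : Metric.ball c (min (R / 2) (ε / (K + 1))) ∈ 𝓝 c :=
        Metric.ball_mem_nhds _ (lt_min (by positivity) (by positivity))
      filter_upwards [this] with w hw
      rwa [Metric.mem_ball, dist_eq_norm] at hw
    filter_upwards [h1] with w hw
    have hw1 := hw.le.trans (min_le_left _ _)
    have hw2 := hw.le.trans (min_le_right _ _)
    refine (hrem w hw1).trans ?_
    have h2 : ‖w - c‖ * K ≤ ε := by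
      calc ‖w - c‖ * K ≤ ε / (K + 1) * (K + 1) := by gcongr; linarith
        _ = ε := by field_simp
    calc 2 * ‖w - c‖ ^ 2 / R ^ 2 * M.toReal.sqrt = (‖w - c‖ * K) * ‖w - c‖ := by
          simp only [K]; ring
      _ ≤ ε * ‖w - c‖ := by gcongr
  exact hder.differentiableAt.differentiableWithinAt

end AnalyticFamily
end PML

namespace PML

theorem tendsto_enorm_sub_sq_iff {V ι : Type*} [NormedAddCommGroup V] {l : Filter ι} {f : ι → V}
    {v : V} : Tendsto (fun i => ‖f i - v‖ₑ ^ 2) l (𝓝 0) ↔ Tendsto f l (𝓝 v) := by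
  rw [tendsto_iff_enorm_sub_tendsto_zero]
  constructor
  · intro h
    have := h.ennrpow_const (1 / 2)
    have e : ∀ a : ℝ≥0∞, (a ^ 2) ^ (1 / 2 : ℝ) = a := fun a => by
      rw [← ENNReal.rpow_natCast, ← ENNReal.rpow_mul]
      simp
    simp only [e] at this
    rwa [ENNReal.zero_rpow_of_pos (by norm_num)] at this
  · intro h
    simpa using ENNReal.Tendsto.pow (n := 2) h

section Curve

variable {H : Type*} [NormedAddCommGroup H] [InnerProductSpace ℂ H] {s : ℝ → ℝ} {α r : ℝ}
  {F : ℂ → H} {lam : ℂ}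

theorem scaledPoint_mem_sector_of_mem_disk (hs : IsScalingFunction s) (hα : 0 < α)
    (hα' : α < Real.pi / 4) (hr : 0 < r) (hlam : lam ∈ scalingDisk α) {x : ℝ} (hx : 0 < x) :
    scaledPoint s lam r x ∈ sector α :=
  scaledPoint_mem_sector hs hr.le hx hα hα' (by simpa [scalingDisk] using hlam)

theorem SectorHardy.continuousOn_curve (hs : IsScalingFunction s) (hα : 0 < α)
    (hα' : α < Real.pi / 4) (hr : 0 < r) (h : SectorHardy α F) (hlam : lam ∈ scalingDisk α) :
    ContinuousOn (fun x => F (scaledPoint s lam r x)) (Ioi 0) :=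
  h.analytic.continuousOn.comp ((continuous_scaledPoint hs r).comp
    (by fun_prop : Continuous fun x : ℝ => (lam, x))).continuousOn
    fun _ hx => scaledPoint_mem_sector_of_mem_disk hs hα hα' hr hlam hx

variable [CompleteSpace H]

theorem SectorHardy.exists_bound_curve (hs : IsScalingFunction s) (hα : 0 < α)
    (hα' : α < Real.pi / 4) (hr : 0 < r) (h : SectorHardy α F) :
    ∃ M : ℝ≥0, ∀ lam ∈ scalingDisk α,
      ∫⁻ x in Ioi (0 : ℝ), ‖F (scaledPoint s lam r x)‖ₑ ^ 2 ≤ M := by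
  obtain ⟨K, hK⟩ := SectorHardy.lintegral_curve_le_limit hs hr
  obtain ⟨⟨u, hu⟩, ⟨v, hv⟩⟩ := h.exists_tendsto_rayLp hα (by linarith [Real.pi_pos])
  refine ⟨K * (‖u‖₊ ^ 2 + ‖v‖₊ ^ 2), fun lam hlam => ?_⟩
  push_cast
  exact hK hα hα' h (by simpa [scalingDisk] using hlam) hu hv

theorem SectorHardy.memLp_curve (hs : IsScalingFunction s) (hα : 0 < α)
    (hα' : α < Real.pi / 4) (hr : 0 < r) (h : SectorHardy α F) (hlam : lam ∈ scalingDisk α) :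
    MemLp (fun x => F (scaledPoint s lam r x)) 2 (volume.restrict (Ioi (0 : ℝ))) := by
  obtain ⟨M, hM⟩ := h.exists_bound_curve hs hα hα' hr
  exact memLp_two_of_lintegral
    ((h.continuousOn_curve hs hα hα' hr hlam).aestronglyMeasurable measurableSet_Ioi)
    ((hM lam hlam).trans_lt ENNReal.coe_lt_top)

open Classical in
/-- The function `x ↦ F(x + λ s(x - r))` as an element of `L²(ℝ₊; H)`. -/
def curveLp (F : ℂ → H) (s : ℝ → ℝ) (r : ℝ) (lam : ℂ) : Lp H 2 (volume.restrict (Ioi (0 : ℝ))) :=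
  if h : MemLp (fun x => F (scaledPoint s lam r x)) 2 (volume.restrict (Ioi (0 : ℝ)))
  then h.toLp _ else 0

theorem SectorHardy.coeFn_curveLp (hs : IsScalingFunction s) (hα : 0 < α)
    (hα' : α < Real.pi / 4) (hr : 0 < r) (h : SectorHardy α F) (hlam : lam ∈ scalingDisk α) :
    curveLp F s r lam =ᵐ[volume.restrict (Ioi 0)] fun x => F (scaledPoint s lam r x) := by
  rw [curveLp, dif_pos (h.memLp_curve hs hα hα' hr hlam)]
  exact MemLp.coeFn_toLp _

theorem SectorHardy.enorm_curveLp_sq (hs : IsScalingFunction s) (hα : 0 < α)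
    (hα' : α < Real.pi / 4) (hr : 0 < r) (h : SectorHardy α F) (hlam : lam ∈ scalingDisk α) :
    ‖curveLp F s r lam‖ₑ ^ 2 = ∫⁻ x in Ioi (0 : ℝ), ‖F (scaledPoint s lam r x)‖ₑ ^ 2 := by
  rw [enorm_Lp_two_sq]
  refine lintegral_congr_ae ?_
  filter_upwards [h.coeFn_curveLp hs hα hα' hr hlam] with x hx
  rw [hx]

theorem SectorHardy.differentiableOn_curveLp (hs : IsScalingFunction s) (hα : 0 < α)
    (hα' : α < Real.pi / 4) (hr : 0 < r) (h : SectorHardy α F) :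
    DifferentiableOn ℂ (curveLp F s r) (scalingDisk α) := by
  obtain ⟨M, hM⟩ := h.exists_bound_curve hs hα hα' hr
  refine differentiableOn_Lp_of_pointwise (g := fun x lam => F (scaledPoint s lam r x))
    Metric.isOpen_ball ENNReal.coe_ne_top ?_ ?_ hM
    (fun lam hlam => h.coeFn_curveLp hs hα hα' hr hlam)
  · filter_upwards [ae_restrict_mem measurableSet_Ioi] with x hx
    refine h.analytic.differentiableOn.comp ?_
      fun lam hlam => scaledPoint_mem_sector_of_mem_disk hs hα hα' hr hlam hx
    unfold scaledPoint
    fun_prop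
  · intro c R hR hball
    have hc : ContinuousOn (fun p : ℝ × ℝ => F (scaledPoint s (circleMap c R p.2) r p.1))
        (Ioi 0 ×ˢ univ) := by
      refine h.analytic.continuousOn.comp ((continuous_scaledPoint hs r).comp
        (((continuous_circleMap c R).comp continuous_snd).prodMk continuous_fst)).continuousOn ?_
      rintro ⟨x, θ⟩ ⟨hx, -⟩
      exact scaledPoint_mem_sector_of_mem_disk hs hα hα' hr
        (hball (Metric.sphere_subset_closedBall (circleMap_mem_sphere c hR.le θ))) hx
    have h1 := hc.aestronglyMeasurable (μ := volume) (measurableSet_Ioi.prod MeasurableSet.univ)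
    rw [Measure.volume_eq_prod, ← Measure.prod_restrict, Measure.restrict_univ] at h1
    exact h1.mono_measure (Measure.prod_mono le_rfl Measure.restrict_le_self)

end Curve

section Cylinder

variable {n : ℕ} {Ω : Set (E n)}

theorem volume_restrict_semiCylinder (Ω : Set (E n)) :
    (volume : Measure (ℝ × E n)).restrict (semiCylinder Ω) =
      ((volume : Measure ℝ).restrict (Ioi 0)).prod (volume.restrict Ω) := by
  rw [semiCylinder, Measure.volume_eq_prod, Measure.prod_restrict]

theorem exists_cylinderEmbedding (Ω : Set (E n)) :
    ∃ J : Lp (L2Section Ω) 2 (volume.restrict (Ioi (0 : ℝ))) →ₗᵢ[ℂ] L2Space (semiCylinder Ω),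
      ∀ f, ∀ᵐ x ∂(volume.restrict (Ioi (0 : ℝ))), ∀ᵐ y ∂(volume.restrict Ω), J f (x, y) = f x y := by
  have key : ∀ m : Measure (ℝ × E n),
      m = ((volume : Measure ℝ).restrict (Ioi 0)).prod (volume.restrict Ω) →
      ∃ J : Lp (L2Section Ω) 2 (volume.restrict (Ioi (0 : ℝ))) →ₗᵢ[ℂ] Lp ℂ 2 m,
      ∀ f, ∀ᵐ x ∂(volume.restrict (Ioi (0 : ℝ))), ∀ᵐ y ∂(volume.restrict Ω),
        J f (x, y) = f x y := by
    rintro m rfl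
    exact ⟨sliceEmbedding _ _, sliceEmbedding_isSlice⟩
  exact key _ (volume_restrict_semiCylinder Ω)

/-- The isometric embedding of `L²(ℝ₊; L²(Ω))` into `L²(ℝ₊ × Ω)`. -/
def cylinderEmbedding (Ω : Set (E n)) :
    Lp (L2Section Ω) 2 (volume.restrict (Ioi (0 : ℝ))) →ₗᵢ[ℂ] L2Space (semiCylinder Ω) :=
  (exists_cylinderEmbedding Ω).choose

theorem cylinderEmbedding_ae (f : Lp (L2Section Ω) 2 (volume.restrict (Ioi (0 : ℝ)))) :
    ∀ᵐ x ∂(volume.restrict (Ioi (0 : ℝ))), ∀ᵐ y ∂(volume.restrict Ω),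
      cylinderEmbedding Ω f (x, y) = f x y :=
  (exists_cylinderEmbedding Ω).choose_spec f

theorem ae_ae_of_ae_semiCylinder {p : ℝ × E n → Prop}
    (h : ∀ᵐ z ∂(volume.restrict (semiCylinder Ω)), p z) :
    ∀ᵐ x ∂(volume.restrict (Ioi (0 : ℝ))), ∀ᵐ y ∂(volume.restrict Ω), p (x, y) := by
  rw [volume_restrict_semiCylinder] at h
  exact Measure.ae_ae_of_ae_prod h

theorem enorm_semiCylinder_sq (u : L2Space (semiCylinder Ω)) :
    ‖u‖ₑ ^ 2 = ∫⁻ x in Ioi (0 : ℝ), ∫⁻ y in Ω, ‖u (x, y)‖ₑ ^ 2 := by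
  have key : ∀ m : Measure (ℝ × E n),
      m = ((volume : Measure ℝ).restrict (Ioi 0)).prod (volume.restrict Ω) → ∀ u : Lp ℂ 2 m,
      ‖u‖ₑ ^ 2 = ∫⁻ x in Ioi (0 : ℝ), ∫⁻ y in Ω, ‖u (x, y)‖ₑ ^ 2 := by
    rintro m rfl u
    rw [enorm_Lp_two_sq, lintegral_prod _ ((Lp.aestronglyMeasurable u).enorm.pow_const 2)]
  exact key _ (volume_restrict_semiCylinder Ω) u

variable {α : ℝ} {F : ℂ → L2Section Ω}

theorem MemHardy.lintegral_sub_eq (hα : α ≤ Real.pi) (h : MemHardy Ω α F) {ψ : ℝ}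
    (hψ : ψ ∈ Ioo (-α) α) (u : L2Space (semiCylinder Ω)) :
    ∫⁻ x in Ioi (0 : ℝ), ∫⁻ y in Ω, ‖F (Complex.exp (ψ * Complex.I) * x) y - u (x, y)‖ₑ ^ 2 =
      ‖cylinderEmbedding Ω (rayLp F ψ) - u‖ₑ ^ 2 := by
  rw [enorm_semiCylinder_sq]
  refine lintegral_congr_ae ?_
  filter_upwards [cylinderEmbedding_ae (rayLp F ψ), h.sectorHardy.coeFn_rayLp hα hψ,
    ae_ae_of_ae_semiCylinder (Lp.coeFn_sub (cylinderEmbedding Ω (rayLp F ψ)) u)] with x h1 h2 h3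
  refine lintegral_congr_ae ?_
  filter_upwards [h1, h3] with y h1 h3
  rw [h3, Pi.sub_apply, h1, h2]

theorem MemHardy.isBoundaryLimit_iff (hα : α ≤ Real.pi) (h : MemHardy Ω α F) {l : Filter ℝ}
    (hl : Ioo (-α) α ∈ l) (u : L2Space (semiCylinder Ω)) :
    IsBoundaryLimit Ω F l u ↔ Tendsto (fun ψ => cylinderEmbedding Ω (rayLp F ψ)) l (𝓝 u) := by
  rw [← tendsto_enorm_sub_sq_iff, IsBoundaryLimit]
  refine tendsto_congr' ?_
  filter_upwards [hl] with ψ hψ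
  exact h.lintegral_sub_eq hα hψ u

theorem MemHardy.exists_limits (hα0 : 0 < α) (hα : α ≤ Real.pi) (h : MemHardy Ω α F) :
    ∃ u v, Tendsto (rayLp F) (𝓝[>] (-α)) (𝓝 u) ∧ Tendsto (rayLp F) (𝓝[<] α) (𝓝 v) ∧
      IsBoundaryLimit Ω F (𝓝[>] (-α)) (cylinderEmbedding Ω u) ∧
      IsBoundaryLimit Ω F (𝓝[<] α) (cylinderEmbedding Ω v) ∧
      hardyNorm Ω α F ^ 2 = ‖u‖ ^ 2 + ‖v‖ ^ 2 := by
  obtain ⟨⟨u, hu⟩, ⟨v, hv⟩⟩ := h.sectorHardy.exists_tendsto_rayLp hα0 hα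
  have hlt : -α < α := by linarith
  have hl1 : Ioo (-α) α ∈ 𝓝[>] (-α) := Ioo_mem_nhdsGT hlt
  have hl2 : Ioo (-α) α ∈ 𝓝[<] α := Ioo_mem_nhdsLT hlt
  have hJ := (cylinderEmbedding Ω).continuous
  have hu' := (hJ.tendsto u).comp hu
  have hv' := (hJ.tendsto v).comp hv
  have b1 := (h.isBoundaryLimit_iff hα hl1 _).2 hu'
  have b2 := (h.isBoundaryLimit_iff hα hl2 _).2 hv'
  have c1 : boundaryLimit Ω F (𝓝[>] (-α)) = cylinderEmbedding Ω u :=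
    tendsto_nhds_unique ((h.isBoundaryLimit_iff hα hl1 _).1
      (Classical.epsilon_spec (p := IsBoundaryLimit Ω F (𝓝[>] (-α))) ⟨_, b1⟩)) hu'
  have c2 : boundaryLimit Ω F (𝓝[<] α) = cylinderEmbedding Ω v :=
    tendsto_nhds_unique ((h.isBoundaryLimit_iff hα hl2 _).1
      (Classical.epsilon_spec (p := IsBoundaryLimit Ω F (𝓝[<] α)) ⟨_, b2⟩)) hv'
  refine ⟨u, v, hu, hv, b1, b2, ?_⟩
  rw [hardyNorm, Real.sq_sqrt (by positivity), c1, c2, LinearIsometry.norm_map,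
    LinearIsometry.norm_map]

variable {s : ℝ → ℝ}

theorem exists_const_lintegral_le_hardyNorm (hs : IsScalingFunction s) (hα : 0 < α)
    (hα' : α < Real.pi / 4) {r : ℝ} (hr : 0 < r) :
    ∃ C : ℝ, ∀ lam ∈ scalingDisk α, ∀ F : ℂ → L2Section Ω, MemHardy Ω α F →
      ∫⁻ x in Ioi (0 : ℝ), ‖F (scaledPoint s lam r x)‖ₑ ^ 2 ≤
        ENNReal.ofReal (C * hardyNorm Ω α F ^ 2) := by
  obtain ⟨K, hK⟩ := SectorHardy.lintegral_curve_le_limit hs hr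
  refine ⟨K, fun lam hlam F h => ?_⟩
  obtain ⟨u, v, hu, hv, -, -, hn⟩ := h.exists_limits hα (by linarith [Real.pi_pos])
  refine (hK hα hα' h.sectorHardy (by simpa [scalingDisk] using hlam) hu hv).trans_eq ?_
  rw [hn, ENNReal.ofReal_mul (by positivity), ENNReal.ofReal_add (by positivity) (by positivity),
    ENNReal.ofReal_pow (by positivity), ENNReal.ofReal_pow (by positivity), ofReal_norm,
    ofReal_norm, ENNReal.ofReal_coe_nnreal]

/-- `F ∘ κ_{λ,r}` as an element of `L²(ℝ₊ × Ω)`. -/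
def compKappa (Ω : Set (E n)) (F : ℂ → L2Section Ω) (s : ℝ → ℝ) (r : ℝ) (lam : ℂ) :
    L2Space (semiCylinder Ω) :=
  cylinderEmbedding Ω (curveLp F s r lam)

theorem MemHardy.isCompKappa (hs : IsScalingFunction s) (hα : 0 < α) (hα' : α < Real.pi / 4)
    {r : ℝ} (hr : 0 < r) (h : MemHardy Ω α F) {lam : ℂ} (hlam : lam ∈ scalingDisk α) :
    IsCompKappa Ω s lam r F (compKappa Ω F s r lam) := by
  filter_upwards [cylinderEmbedding_ae (curveLp F s r lam),
    h.sectorHardy.coeFn_curveLp hs hα hα' hr hlam] with x h1 h2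
  filter_upwards [h1] with y h1
  rw [compKappa, h1, h2]

theorem MemHardy.analyticOnNhd_compKappa (hs : IsScalingFunction s) (hα : 0 < α)
    (hα' : α < Real.pi / 4) {r : ℝ} (hr : 0 < r) (h : MemHardy Ω α F) :
    AnalyticOnNhd ℂ (compKappa Ω F s r) (scalingDisk α) := by
  refine DifferentiableOn.analyticOnNhd ?_ Metric.isOpen_ball
  exact (cylinderEmbedding Ω).toContinuousLinearMap.differentiable.comp_differentiableOn
    (h.sectorHardy.differentiableOn_curveLp hs hα hα' hr)

theorem MemHardy.norm_compKappa_sq (hs : IsScalingFunction s) (hα : 0 < α)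
    (hα' : α < Real.pi / 4) {r : ℝ} (hr : 0 < r) (h : MemHardy Ω α F) {lam : ℂ}
    (hlam : lam ∈ scalingDisk α) : ‖compKappa Ω F s r lam‖ₑ ^ 2 =
      ∫⁻ x in Ioi (0 : ℝ), ‖F (scaledPoint s lam r x)‖ₑ ^ 2 := by
  rw [← h.sectorHardy.enorm_curveLp_sq hs hα hα' hr hlam, compKappa]
  congr 1
  rw [← ofReal_norm, ← ofReal_norm, LinearIsometry.norm_map]

end Cylinder
end PML

namespace PML

/-- A `C¹` curve `γ` in the plane, with bounded nonzero velocity in the right half-plane, whose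
chords have arguments in `[-π/4 + c, π/4 - c]`. -/
structure IsSlantedCurve (γ γ' : ℝ → ℂ) (κ K : ℝ) : Prop where
  hasDerivAt : ∀ x, HasDerivAt γ (γ' x) x
  continuous_deriv : Continuous γ'
  kappa_pos : 0 < κ
  norm_deriv_le : ∀ x, ‖γ' x‖ ≤ K
  re_deriv_pos : ∀ x, 0 < (γ' x).re
  re_deriv_sq : ∀ x, κ ≤ ((γ' x) ^ 2).re
  re_chord_sq : ∀ x y, κ * (y - x) ^ 2 ≤ ((γ y - γ x) ^ 2).re

section Curve

variable {γ γ' : ℝ → ℂ} {κ K : ℝ}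

theorem IsSlantedCurve.continuous (h : IsSlantedCurve γ γ' κ K) : Continuous γ :=
  continuous_iff_continuousAt.2 fun x => (h.hasDerivAt x).continuousAt

theorem IsSlantedCurve.norm_exp_le (h : IsSlantedCurve γ γ' κ K) {δ : ℝ} (x y : ℝ) :
    ‖Complex.exp (-((γ y - γ x) / δ) ^ 2)‖ ≤ Real.exp (-κ * ((y - x) / δ) ^ 2) := by
  rw [Complex.norm_exp, Real.exp_le_exp, div_pow, ← neg_div, ← Complex.ofReal_pow,
    Complex.div_ofReal_re, Complex.neg_re, div_pow, ← mul_div_assoc]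
  gcongr
  linarith [h.re_chord_sq x y]

theorem IsSlantedCurve.norm_exp_le_one (h : IsSlantedCurve γ γ' κ K) {δ : ℝ} (x y : ℝ) :
    ‖Complex.exp (-((γ y - γ x) / δ) ^ 2)‖ ≤ 1 := by
  refine (h.norm_exp_le x y).trans ?_
  rw [Real.exp_le_one_iff]
  nlinarith [h.kappa_pos, sq_nonneg ((y - x) / δ)]

/-- The mollification of `χ` by Gaussians along the curve. -/
def curveMollify (γ γ' : ℝ → ℂ) (χ : ℝ → ℂ) (δ x : ℝ) : ℂ :=
  δ⁻¹ * ∫ y, Complex.exp (-((γ y - γ x) / δ) ^ 2) * (γ' y * χ y)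

theorem curveMollify_eq (γ γ' χ : ℝ → ℂ) {δ : ℝ} (hδ : 0 < δ) (x : ℝ) :
    curveMollify γ γ' χ δ x = ∫ t : ℝ, Complex.exp (-((γ (x + δ * t) - γ x) / δ) ^ 2) *
      (γ' (x + δ * t) * χ (x + δ * t)) := by
  have h := Measure.integral_comp_mul_left
    (fun y => Complex.exp (-((γ (x + y) - γ x) / δ) ^ 2) * (γ' (x + y) * χ (x + y))) δ
  rw [h, integral_add_left_eq_self
    (fun y => Complex.exp (-((γ y - γ x) / δ) ^ 2) * (γ' y * χ y)) x, curveMollify,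
    abs_of_pos (inv_pos.2 hδ), Complex.real_smul]

variable {χ : ℝ → ℂ} {M : ℝ}

theorem IsSlantedCurve.norm_integrand_le (h : IsSlantedCurve γ γ' κ K) (hM : ∀ x, ‖χ x‖ ≤ M)
    {δ : ℝ} (hδ : 0 < δ) (x t : ℝ) : ‖Complex.exp (-((γ (x + δ * t) - γ x) / δ) ^ 2) *
      (γ' (x + δ * t) * χ (x + δ * t))‖ ≤ Real.exp (-κ * t ^ 2) * (K * M) := by
  have hK : 0 ≤ K := (norm_nonneg _).trans (h.norm_deriv_le 0)
  rw [norm_mul, norm_mul]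
  have h1 := h.norm_exp_le (δ := δ) x (x + δ * t)
  rw [show (x + δ * t - x) / δ = t by field_simp; ring] at h1
  gcongr
  · exact h.norm_deriv_le _
  · exact hM _

theorem IsSlantedCurve.norm_curveMollify_le (h : IsSlantedCurve γ γ' κ K) (hM : ∀ x, ‖χ x‖ ≤ M)
    {δ : ℝ} (hδ : 0 < δ) (x : ℝ) :
    ‖curveMollify γ γ' χ δ x‖ ≤ ∫ t : ℝ, Real.exp (-κ * t ^ 2) * (K * M) := by
  rw [curveMollify_eq γ γ' χ hδ]
  exact norm_integral_le_of_norm_le ((integrable_exp_neg_mul_sq h.kappa_pos).mul_const _)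
    (ae_of_all _ fun t => h.norm_integrand_le hM hδ x t)

theorem integral_gaussian_sq {q : ℂ} (hq : 0 < q.re) (hq2 : 0 < (q ^ 2).re) :
    ∫ t : ℝ, Complex.exp (-((t : ℂ) * q) ^ 2) = (Real.sqrt Real.pi : ℂ) / q := by
  have h := integral_gaussian_complex hq2
  have hre : 0 < ((Real.sqrt Real.pi : ℂ) / q).re := by
    rw [div_eq_mul_inv, Complex.re_ofReal_mul, Complex.inv_re]
    have : q ≠ 0 := by rintro rfl; simp at hq
    have := Complex.normSq_pos.2 this
    have := Real.sqrt_pos.2 Real.pi_pos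
    positivity
  have e : (Real.pi : ℂ) / q ^ 2 = ((Real.sqrt Real.pi : ℂ) / q) ^ 2 := by
    rw [div_pow, ← Complex.ofReal_pow, Real.sq_sqrt Real.pi_pos.le]
  rw [e, one_div, Complex.sq_cpow_two_inv hre] at h
  rw [← h]
  congr 1
  ext t
  congr 1
  ring

theorem IsSlantedCurve.tendsto_curveMollify (h : IsSlantedCurve γ γ' κ K) (hχ : Continuous χ)
    (hM : ∀ x, ‖χ x‖ ≤ M) (x : ℝ) :
    Tendsto (fun δ => curveMollify γ γ' χ δ x) (𝓝[>] 0) (𝓝 (Real.sqrt Real.pi * χ x)) := by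
  have hlim : (∫ t : ℝ, Complex.exp (-((t : ℂ) * γ' x) ^ 2) * (γ' x * χ x)) =
      Real.sqrt Real.pi * χ x := by
    have h0 : γ' x ≠ 0 := by
      intro h0
      have := h.re_deriv_pos x
      simp [h0] at this
    rw [integral_mul_const, integral_gaussian_sq (h.re_deriv_pos x)
      (h.kappa_pos.trans_le (h.re_deriv_sq x))]
    field_simp
  rw [← hlim]
  have hev : ∀ᶠ δ : ℝ in 𝓝[>] 0, 0 < δ := self_mem_nhdsWithin
  refine Tendsto.congr' (hev.mono fun δ hδ => (curveMollify_eq γ γ' χ hδ x).symm) ?_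
  have hcont : ∀ t : ℝ, Tendsto (fun δ : ℝ => x + δ * t) (𝓝[>] 0) (𝓝 x) := fun t => by
    have : Continuous fun δ : ℝ => x + δ * t := by fun_prop
    simpa using (this.tendsto 0).mono_left nhdsWithin_le_nhds
  refine tendsto_integral_filter_of_dominated_convergence
    (fun t => Real.exp (-κ * t ^ 2) * (K * M)) ?_ ?_
    ((integrable_exp_neg_mul_sq h.kappa_pos).mul_const _) (ae_of_all _ fun t => ?_)
  · refine Eventually.of_forall fun δ => Continuous.aestronglyMeasurable ?_
    have h1 := h.continuous
    have h2 := h.continuous_deriv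
    fun_prop
  · filter_upwards [hev] with δ hδ
    exact ae_of_all _ fun t => h.norm_integrand_le hM hδ x t
  · refine Tendsto.mul ?_ (((h.continuous_deriv.tendsto x).comp (hcont t)).mul
      ((hχ.tendsto x).comp (hcont t)))
    refine (Complex.continuous_exp.tendsto _).comp (Tendsto.neg (Tendsto.pow ?_ 2))
    have hd : HasDerivAt (fun δ : ℝ => γ (x + δ * t)) ((t : ℂ) * γ' x) 0 := by
      have h1 : HasDerivAt (fun δ : ℝ => x + δ * t) t 0 := by
        simpa using ((hasDerivAt_id (0 : ℝ)).mul_const t).const_add x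
      have h2 : HasDerivAt γ (γ' x) (x + 0 * t) := by simpa using h.hasDerivAt x
      have h3 := h2.scomp (0 : ℝ) h1
      rwa [Complex.real_smul] at h3
    have h3 := hd.tendsto_slope_zero_right
    refine h3.congr fun δ => ?_
    simp [Complex.real_smul, div_eq_inv_mul]

end Curve

section Density

variable {n : ℕ} {Ω : Set (E n)} {γ γ' : ℝ → ℂ} {κ K : ℝ}

theorem ae_eq_zero_of_gaussian_integrals (hΩ : IsOpen Ω) (h : IsSlantedCurve γ γ' κ K)
    {w : ℝ × E n → ℂ} (hw : IntegrableOn w (semiCylinder Ω))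
    (h0 : ∀ δ > 0, ∀ x', ∀ g : E n → ℂ, Continuous g → HasCompactSupport g →
      ∫ p in semiCylinder Ω, w p * (Complex.exp (-((γ x' - γ p.1) / (δ : ℝ)) ^ 2) * g p.2) = 0) :
    ∀ᵐ p ∂(volume.restrict (semiCylinder Ω)), w p = 0 := by
  have hopen : IsOpen (semiCylinder Ω) := isOpen_Ioi.prod hΩ
  rw [ae_restrict_iff' hopen.measurableSet]
  refine hopen.ae_eq_zero_of_integral_contDiff_smul_eq_zero hw.locallyIntegrableOn ?_
  intro χ hχ hsupp hsub
  obtain ⟨M, hM⟩ := hχ.continuous.bounded_above_of_compact_support hsupp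
  have hcs : IsCompact (Prod.fst '' tsupport χ) := hsupp.isCompact.image continuous_fst
  have hy : ∀ y, HasCompactSupport fun z : E n => (χ (y, z) : ℂ) := fun y => by
    refine HasCompactSupport.intro (hsupp.isCompact.image continuous_snd) fun z hz => ?_
    have : χ (y, z) = 0 := by
      by_contra hne
      exact hz ⟨(y, z), subset_tsupport _ hne, rfl⟩
    simp [this]
  have hMol : ∀ δ > 0, ∫ p in semiCylinder Ω,
      w p * curveMollify γ γ' (fun y => χ (y, p.2)) δ p.1 = 0 := by
    intro δ hδ
    set Φ : (ℝ × E n) × ℝ → ℂ := fun q => w q.1 *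
      (Complex.exp (-((γ q.2 - γ q.1.1) / δ) ^ 2) * (γ' q.2 * χ (q.2, q.1.2))) with hΦ
    have hint : Integrable Φ ((volume.restrict (semiCylinder Ω)).prod volume) := by
      have hind : Integrable (indicator (Prod.fst '' tsupport χ) fun _ : ℝ => K * M) :=
        (integrable_indicator_iff hcs.measurableSet).2
          (integrableOn_const hcs.measure_lt_top.ne)
      refine (hw.norm.mul_prod hind).mono' ?_ (ae_of_all _ fun q => ?_)
      · have h1 := h.continuous
        have h2 := h.continuous_deriv
        have h3 := hχ.continuous
        exact hw.aestronglyMeasurable.comp_fst.mul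
          (Continuous.aestronglyMeasurable (by fun_prop))
      · simp only [hΦ, norm_mul]
        gcongr
        by_cases hq : q.2 ∈ Prod.fst '' tsupport χ
        · rw [indicator_of_mem hq]
          have hK : 0 ≤ K := (norm_nonneg _).trans (h.norm_deriv_le 0)
          calc _ ≤ 1 * (K * M) := by
                gcongr
                · exact h.norm_exp_le_one _ _
                · exact h.norm_deriv_le _
                · rw [Complex.norm_real]; exact hM _
            _ = K * M := one_mul _
        · have : χ (q.2, q.1.2) = 0 := by
            by_contra hne
            exact hq ⟨_, subset_tsupport _ hne, rfl⟩
          simp [this, indicator_of_notMem hq]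
    have hswap := integral_integral_swap (f := fun p y => Φ (p, y)) hint
    have hz : ∀ y, ∫ p in semiCylinder Ω, Φ (p, y) = 0 := fun y => by
      have := h0 δ hδ y (fun z => (χ (y, z) : ℂ))
        (Complex.continuous_ofReal.comp (hχ.continuous.comp (by fun_prop))) (hy y)
      rw [← mul_zero (γ' y), ← this, ← integral_const_mul]
      congr 1
      ext p
      simp only [hΦ]
      ring
    simp only [hz, integral_zero] at hswap
    rw [← mul_zero ((δ : ℂ)⁻¹), ← hswap, ← integral_const_mul]
    congr 1
    ext p
    simp only [hΦ, integral_const_mul, curveMollify, Complex.ofReal_inv]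
    ring
  have hchi : ∀ p : ℝ × E n, ∀ x, ‖(χ (x, p.2) : ℂ)‖ ≤ M := fun p x => by
    rw [Complex.norm_real]; exact hM _
  have hlim : Tendsto (fun δ => ∫ p in semiCylinder Ω,
      w p * curveMollify γ γ' (fun y => χ (y, p.2)) δ p.1) (𝓝[>] 0)
      (𝓝 (∫ p in semiCylinder Ω, w p * (Real.sqrt Real.pi * χ p))) := by
    refine tendsto_integral_filter_of_dominated_convergence
      (fun p => ‖w p‖ * ∫ t : ℝ, Real.exp (-κ * t ^ 2) * (K * M)) ?_ ?_ (hw.norm.mul_const _) ?_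
    · refine Eventually.of_forall fun δ => hw.aestronglyMeasurable.mul ?_
      refine AEStronglyMeasurable.const_mul ?_ _
      have h1 := h.continuous
      have h2 := h.continuous_deriv
      have h3 := hχ.continuous
      have hc : Continuous fun q : (ℝ × E n) × ℝ =>
        Complex.exp (-((γ q.2 - γ q.1.1) / δ) ^ 2) * (γ' q.2 * χ (q.2, q.1.2)) := by fun_prop
      exact (hc.stronglyMeasurable.integral_prod_right (ν := volume)).aestronglyMeasurable
    · filter_upwards [self_mem_nhdsWithin] with δ hδ
      refine ae_of_all _ fun p => ?_
      rw [norm_mul]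
      gcongr
      exact h.norm_curveMollify_le (hchi p) hδ _
    · refine ae_of_all _ fun p => Tendsto.const_mul _ ?_
      exact h.tendsto_curveMollify
        (Complex.continuous_ofReal.comp (hχ.continuous.comp (by fun_prop))) (hchi p) p.1
  have hzero : ∫ p in semiCylinder Ω, w p * (Real.sqrt Real.pi * χ p) = 0 := by
    refine tendsto_nhds_unique hlim (Tendsto.congr' ?_ tendsto_const_nhds)
    filter_upwards [self_mem_nhdsWithin] with δ hδ
    exact (hMol δ hδ).symm
  have hpi : (Real.sqrt Real.pi : ℂ) ≠ 0 :=
    Complex.ofReal_ne_zero.2 (Real.sqrt_pos.2 Real.pi_pos).ne'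
  have hzero2 : ∫ p in semiCylinder Ω, χ p • w p = 0 := by
    refine (mul_eq_zero.1 (?_ : (Real.sqrt Real.pi : ℂ) * _ = 0)).resolve_left hpi
    rw [← integral_const_mul, ← hzero]
    congr 1
    ext p
    rw [Complex.real_smul]
    ring
  rw [← hzero2, setIntegral_eq_integral_of_forall_compl_eq_zero]
  intro p hp
  rw [image_eq_zero_of_notMem_tsupport fun hp' => hp (hsub hp'), zero_smul]

end Density

section Scaling

variable {s : ℝ → ℝ} {α r : ℝ} {lam : ℂ}

theorem isSlantedCurve_scaledPoint (hs : IsScalingFunction s) (hα' : α < Real.pi / 4)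
    (hα : 0 < α) (hlam : lam ∈ scalingDisk α) :
    ∃ κ K, IsSlantedCurve (scaledPoint s lam r) (fun x => 1 + lam * ((deriv s (x - r) : ℝ) : ℂ)) κ K := by
  have hlam' : ‖lam‖ < Real.sin α := by simpa [scalingDisk] using hlam
  have hsin : Real.sin α ^ 2 < 1 / 2 := by
    have h1 : Real.sin α < Real.sin (Real.pi / 4) :=
      Real.sin_lt_sin_of_lt_of_le_pi_div_two (by linarith) (by linarith [Real.pi_pos]) hα'
    rw [Real.sin_pi_div_four] at h1
    have h0 := Real.sin_pos_of_pos_of_lt_pi hα (by linarith [Real.pi_pos])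
    nlinarith [Real.sq_sqrt (show (0 : ℝ) ≤ 2 by norm_num), Real.sqrt_nonneg 2]
  have hab : |lam.re| + |lam.im| < 1 := by
    have h1 : |lam.re| ^ 2 + |lam.im| ^ 2 = ‖lam‖ ^ 2 := by
      rw [sq_abs, sq_abs, ← Complex.normSq_eq_norm_sq, Complex.normSq_apply]; ring
    have h2 : ‖lam‖ ^ 2 < 1 / 2 :=
      (pow_lt_pow_left₀ hlam' (norm_nonneg _) two_ne_zero).trans hsin
    nlinarith [sq_nonneg (|lam.re| - |lam.im|), abs_nonneg lam.re, abs_nonneg lam.im]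
  set k := 1 - (|lam.re| + |lam.im|) with hk
  have hk0 : 0 < k := by linarith
  have key : ∀ a b : ℝ, |b| ≤ |a| → k ^ 2 * a ^ 2 ≤ (((a : ℂ) + lam * b) ^ 2).re := by
    intro a b hba
    have e : (((a : ℂ) + lam * b) ^ 2).re = |a + lam.re * b| ^ 2 - |lam.im * b| ^ 2 := by
      rw [sq_abs, sq_abs]
      simp [sq]
    have h1 : |a| - |lam.re| * |a| ≤ |a + lam.re * b| := by
      have := abs_sub_abs_le_abs_sub a (-(lam.re * b))
      rw [abs_neg, abs_mul, sub_neg_eq_add] at this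
      nlinarith [mul_le_mul_of_nonneg_left hba (abs_nonneg lam.re)]
    have h2 : |lam.im * b| ≤ |lam.im| * |a| := by
      rw [abs_mul]
      exact mul_le_mul_of_nonneg_left hba (abs_nonneg _)
    have h3 : k * |a| ≤ |a + lam.re * b| - |lam.im * b| := by
      rw [hk]; nlinarith
    have h4 : 0 ≤ k * |a| := by positivity
    rw [e, ← sq_abs a]
    nlinarith [abs_nonneg (lam.im * b)]
  have hd0 := hs.deriv_nonneg
  have hd1 := hs.deriv_le_one
  have hda : ∀ x, |deriv s x| ≤ 1 := fun x => abs_le.2 ⟨by linarith [hd0 x], hd1 x⟩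
  refine ⟨k ^ 2, 1 + ‖lam‖, ?_, ?_, by positivity, ?_, ?_, ?_, ?_⟩
  · intro x
    have h1 : HasDerivAt (fun x => s (x - r)) (deriv s (x - r)) x :=
      HasDerivAt.comp_sub_const x r (hs.differentiable _).hasDerivAt
    exact (hasDerivAt_id x).ofReal_comp.add (h1.ofReal_comp.const_mul lam)
  · have : Continuous (deriv s) := hs.smooth.continuous_deriv (by simp)
    fun_prop
  · intro x
    refine (norm_add_le _ _).trans ?_
    rw [norm_one, norm_mul, Complex.norm_real, Real.norm_eq_abs]
    nlinarith [hda (x - r), norm_nonneg lam]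
  · intro x
    simp only [Complex.add_re, Complex.one_re, Complex.re_mul_ofReal]
    have h1 : |lam.re * deriv s (x - r)| ≤ |lam.re| := by
      rw [abs_mul]
      nlinarith [hda (x - r), abs_nonneg lam.re]
    have h2 := (abs_le.1 h1).1
    linarith [abs_nonneg lam.im]
  · intro x
    simpa using key 1 (deriv s (x - r)) (by simpa using hda (x - r))
  · intro x y
    have h1 : |s (y - r) - s (x - r)| ≤ |y - x| := by
      rcases le_total x y with hxy | hxy
      · have h2 := hs.sub_le (show x - r ≤ y - r by linarith)
        have h3 := hs.monotone (show x - r ≤ y - r by linarith)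
        rw [abs_of_nonneg (by linarith), abs_of_nonneg (by linarith)]
        linarith
      · have h2 := hs.sub_le (show y - r ≤ x - r by linarith)
        have h3 := hs.monotone (show y - r ≤ x - r by linarith)
        rw [abs_of_nonpos (by linarith), abs_of_nonpos (by linarith)]
        linarith
    have := key (y - x) _ h1
    convert this using 2
    simp only [scaledPoint]
    push_cast
    ring

end Scaling
end PML

namespace PML

/-- Entire functions that decay exponentially in the sector `𝕊_α`, `α < π/4`. -/
def gaussTest (c : ℂ) (δ : ℝ) (z : ℂ) : ℂ := Complex.exp (-z) * Complex.exp (-((c - z) / δ) ^ 2)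

theorem re_sq_ge_of_mem_sector {α : ℝ} (hα' : α < Real.pi / 4) {z : ℂ} (hz : z ∈ sector α) :
    Real.cos (2 * α) * ‖z‖ ^ 2 ≤ (z ^ 2).re := by
  have h1 : (z ^ 2).re = ‖z‖ ^ 2 * Real.cos (2 * z.arg) := by
    rw [Real.cos_two_mul']
    have h2 := Complex.norm_mul_cos_arg z
    have h3 := Complex.norm_mul_sin_arg z
    rw [mul_sub, ← mul_pow, ← mul_pow, h2, h3]
    simp [sq]
  rw [h1, mul_comm]
  gcongr
  rw [← Real.cos_abs (2 * z.arg), abs_mul, abs_two]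
  have := hz.2
  exact Real.cos_le_cos_of_nonneg_of_le_pi (by positivity) (by linarith [Real.pi_pos]) (by linarith)

theorem exists_bound_gaussTest {α : ℝ} (hα : 0 < α) (hα' : α < Real.pi / 4) (c : ℂ) (δ : ℝ) :
    ∃ C : ℝ, 0 ≤ C ∧ ∀ z ∈ sector α, ‖gaussTest c δ z‖ ≤ C * Real.exp (-z.re) := by
  set k := Real.cos (2 * α)
  have hk : 0 < k := Real.cos_pos_of_mem_Ioo ⟨by linarith [Real.pi_pos], by linarith⟩
  refine ⟨Real.exp ((‖c‖ ^ 2 / k + ‖c‖ ^ 2) / δ ^ 2), (Real.exp_pos _).le, fun z hz => ?_⟩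
  rw [gaussTest, norm_mul, Complex.norm_exp, Complex.norm_exp, Complex.neg_re, mul_comm]
  gcongr
  rw [div_pow, ← neg_div, ← Complex.ofReal_pow, Complex.div_ofReal_re, Complex.neg_re]
  gcongr
  have h1 : ((c - z) ^ 2).re = (z ^ 2).re - 2 * (c * z).re + (c ^ 2).re := by
    rw [show (c - z) ^ 2 = z ^ 2 - (c * z + c * z) + c ^ 2 by ring]
    simp only [Complex.add_re, Complex.sub_re]
    ring
  have h2 : (c * z).re ≤ ‖c‖ * ‖z‖ := (Complex.re_le_norm _).trans_eq (norm_mul _ _)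
  have h3 : -‖c‖ ^ 2 ≤ (c ^ 2).re := by
    have := (abs_le.1 (Complex.abs_re_le_norm (c ^ 2))).1
    rwa [norm_pow] at this
  have h4 := re_sq_ge_of_mem_sector hα' hz
  have h5 : 2 * (‖c‖ * ‖z‖) ≤ k * ‖z‖ ^ 2 + ‖c‖ ^ 2 / k := by
    rw [← sub_nonneg]
    have : k * ‖z‖ ^ 2 + ‖c‖ ^ 2 / k - 2 * (‖c‖ * ‖z‖) = (k * ‖z‖ - ‖c‖) ^ 2 / k := by
      field_simp
      ring
    rw [this]
    positivity
  rw [h1]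
  linarith

theorem differentiable_gaussTest (c : ℂ) (δ : ℝ) : Differentiable ℂ (gaussTest c δ) := by
  unfold gaussTest
  fun_prop

theorem lintegral_exp_neg_lt_top {k : ℝ} (hk : 0 < k) :
    ∫⁻ x in Ioi (0 : ℝ), ENNReal.ofReal (Real.exp (-(k * x))) < ⊤ := by
  have h := (integrableOn_exp_mul_Ioi (neg_neg_of_pos hk) 0).lintegral_lt_top
  simpa [neg_mul] using h

theorem sectorHardy_gaussTest_smul {H : Type*} [NormedAddCommGroup H] [InnerProductSpace ℂ H]
    {α : ℝ} (hα : 0 < α) (hα' : α < Real.pi / 4) (c : ℂ) (δ : ℝ) (h : H) :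
    SectorHardy α fun z => gaussTest c δ z • h := by
  obtain ⟨C, hC0, hC⟩ := exists_bound_gaussTest hα hα' c δ
  have hcos : 0 < Real.cos α := Real.cos_pos_of_mem_Ioo ⟨by linarith [Real.pi_pos], by linarith⟩
  have hfin : (∫⁻ x in Ioi (0 : ℝ), ENNReal.ofReal ((C * ‖h‖) ^ 2) *
      ENNReal.ofReal (Real.exp (-(2 * Real.cos α * x)))) < ⊤ := by
    rw [lintegral_const_mul' _ _ ENNReal.ofReal_ne_top]
    exact ENNReal.mul_lt_top ENNReal.ofReal_lt_top (lintegral_exp_neg_lt_top (by positivity))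
  refine ⟨fun z _ => ?_, (∫⁻ x in Ioi (0 : ℝ), ENNReal.ofReal ((C * ‖h‖) ^ 2) *
      ENNReal.ofReal (Real.exp (-(2 * Real.cos α * x)))).toNNReal, fun ψ hψ => ?_⟩
  · exact ((differentiable_gaussTest c δ).analyticAt z).smul analyticAt_const
  · rw [ENNReal.coe_toNNReal hfin.ne]
    refine setLIntegral_mono' measurableSet_Ioi fun x hx => ?_
    have hx : 0 < x := hx
    have h1 := hC _ (exp_mul_mem_sector (by linarith [Real.pi_pos]) hψ hx)
    have hre : (Complex.exp (ψ * Complex.I) * x).re = Real.cos ψ * x := by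
      rw [Complex.re_mul_ofReal, Complex.exp_ofReal_mul_I_re]
    have hcos' : Real.cos α ≤ Real.cos ψ := by
      rw [← Real.cos_abs ψ]
      exact Real.cos_le_cos_of_nonneg_of_le_pi (abs_nonneg _) (by linarith [Real.pi_pos])
        (abs_lt.2 hψ).le
    rw [← ofReal_norm, ← ENNReal.ofReal_pow (by positivity), ← ENNReal.ofReal_mul (by positivity)]
    refine ENNReal.ofReal_le_ofReal ?_
    rw [norm_smul, show -(2 * Real.cos α * x) = (2 : ℕ) * -(Real.cos α * x) by push_cast; ring,
      Real.exp_nat_mul, ← mul_pow, mul_right_comm]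
    gcongr
    refine h1.trans ?_
    rw [hre]
    gcongr

section Density

variable {n : ℕ} {Ω : Set (E n)} {s : ℝ → ℝ} {α r : ℝ} {lam : ℂ}

theorem ae_eq_zero_of_gaussTest_integrals (hs : IsScalingFunction s) (hα : 0 < α)
    (hα' : α < Real.pi / 4) (hlam : lam ∈ scalingDisk α) (hΩ : IsOpen Ω) {w : ℝ × E n → ℂ}
    (hw : IntegrableOn (fun p => Complex.exp (-scaledPoint s lam r p.1) * w p) (semiCylinder Ω))
    (h0 : ∀ δ > 0, ∀ c, ∀ g : E n → ℂ, Continuous g → HasCompactSupport g →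
      ∫ p in semiCylinder Ω, w p * (gaussTest c δ (scaledPoint s lam r p.1) * g p.2) = 0) :
    ∀ᵐ p ∂(volume.restrict (semiCylinder Ω)), w p = 0 := by
  obtain ⟨κ, K, h⟩ := isSlantedCurve_scaledPoint (r := r) hs hα' hα hlam
  refine (ae_eq_zero_of_gaussian_integrals hΩ h hw fun δ hδ x' g hg hg' => ?_).mono fun p hp =>
    (mul_eq_zero.1 hp).resolve_left (Complex.exp_ne_zero _)
  rw [← h0 δ hδ (scaledPoint s lam r x') g hg hg']
  congr 1
  ext p
  rw [gaussTest]
  ring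

theorem ae_semiCylinder_of_ae_ae {u v : ℝ × E n → ℂ}
    (hu : AEStronglyMeasurable u (volume.restrict (semiCylinder Ω)))
    (hv : AEStronglyMeasurable v (volume.restrict (semiCylinder Ω)))
    (h : ∀ᵐ x ∂(volume.restrict (Ioi (0 : ℝ))), ∀ᵐ y ∂(volume.restrict Ω), u (x, y) = v (x, y)) :
    u =ᵐ[volume.restrict (semiCylinder Ω)] v := by
  have hm := (hu.sub hv).enorm
  have hz : ∫⁻ p in semiCylinder Ω, ‖(u - v) p‖ₑ = 0 := by
    rw [volume_restrict_semiCylinder] at hm ⊢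
    rw [lintegral_prod _ hm]
    refine (lintegral_congr_ae ?_).trans lintegral_zero
    filter_upwards [h] with x hx
    refine (lintegral_congr_ae ?_).trans lintegral_zero
    filter_upwards [hx] with y hy
    simp [hy]
  rw [lintegral_eq_zero_iff' hm] at hz
  filter_upwards [hz] with p hp
  rw [← sub_eq_zero]
  simpa using hp

theorem SectorHardy.add_smul {H : Type*} [NormedAddCommGroup H] [InnerProductSpace ℂ H]
    {F G : ℂ → H} (hα : α ≤ Real.pi) (hF : SectorHardy α F) (hG : SectorHardy α G) (a : ℂ) :
    SectorHardy α fun z => F z + a • G z := by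
  obtain ⟨C, hC⟩ := hF.bound
  obtain ⟨D, hD⟩ := hG.bound
  refine ⟨hF.analytic.add (analyticOnNhd_const.smul hG.analytic),
    2 * (C + ‖a‖₊ ^ 2 * D), fun ψ hψ => ?_⟩
  have hpt : ∀ u v : H, ‖u + a • v‖ₑ ^ 2 ≤ 2 * (‖u‖ₑ ^ 2 + (‖a‖₊ ^ 2 : ℝ≥0) * ‖v‖ₑ ^ 2) := by
    intro u v
    have h1 : ‖u + a • v‖₊ ^ 2 ≤ 2 * (‖u‖₊ ^ 2 + ‖a‖₊ ^ 2 * ‖v‖₊ ^ 2) := by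
      rw [← NNReal.coe_le_coe]
      push_cast
      have h2 := norm_add_le u (a • v)
      rw [norm_smul] at h2
      nlinarith [sq_nonneg (‖u‖ - ‖a‖ * ‖v‖), norm_nonneg (u + a • v)]
    simp only [enorm_eq_nnnorm]
    exact_mod_cast h1
  have hm : AEMeasurable (fun x : ℝ => ‖F (Complex.exp (ψ * Complex.I) * x)‖ₑ ^ 2)
      (volume.restrict (Ioi 0)) :=
    ((hF.continuousOn_ray hα hψ).aestronglyMeasurable measurableSet_Ioi).enorm.pow_const 2
  calc rayNormSq (fun z => F z + a • G z) ψ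
      ≤ ∫⁻ x in Ioi (0 : ℝ), 2 * (‖F (Complex.exp (ψ * Complex.I) * x)‖ₑ ^ 2 +
        (‖a‖₊ ^ 2 : ℝ≥0) * ‖G (Complex.exp (ψ * Complex.I) * x)‖ₑ ^ 2) :=
        lintegral_mono fun x => hpt _ _
    _ = 2 * (rayNormSq F ψ + (‖a‖₊ ^ 2 : ℝ≥0) * rayNormSq G ψ) := by
        rw [lintegral_const_mul' _ _ (by simp), lintegral_add_left' hm,
          lintegral_const_mul' _ _ (by simp)]
        rfl
    _ ≤ 2 * (C + (‖a‖₊ ^ 2 : ℝ≥0) * D) := by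
        gcongr
        · exact hC ψ hψ
        · exact hD ψ hψ
    _ = _ := by push_cast; rfl

theorem IsCompKappa.add_smul {F G : ℂ → L2Section Ω} {u v : L2Space (semiCylinder Ω)}
    (hu : IsCompKappa Ω s lam r F u) (hv : IsCompKappa Ω s lam r G v) (a : ℂ) :
    IsCompKappa Ω s lam r (fun z => F z + a • G z) (u + a • v) := by
  filter_upwards [hu, hv, ae_ae_of_ae_semiCylinder (Lp.coeFn_add u (a • v)),
    ae_ae_of_ae_semiCylinder (Lp.coeFn_smul a v)] with x h1 h2 h3 h4
  filter_upwards [h1, h2, h3, h4, Lp.coeFn_add (F (scaledPoint s lam r x))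
    (a • G (scaledPoint s lam r x)), Lp.coeFn_smul a (G (scaledPoint s lam r x))]
    with y h1 h2 h3 h4 h5 h6
  rw [h3, h5, Pi.add_apply, Pi.add_apply, h4, h6, Pi.smul_apply, Pi.smul_apply, h1, h2]

theorem dense_of_inner_eq_zero {H : Type*} [NormedAddCommGroup H] [InnerProductSpace ℂ H]
    [CompleteSpace H] {S : Set H} (h0 : (0 : H) ∈ S)
    (hadd : ∀ u ∈ S, ∀ v ∈ S, ∀ a : ℂ, u + a • v ∈ S)
    (h : ∀ g : H, (∀ v ∈ S, inner ℂ g v = 0) → g = 0) : Dense S := by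
  let K : Submodule ℂ H :=
    { carrier := S
      zero_mem' := h0
      add_mem' := fun {u v} hu hv => by simpa using hadd u hu v hv 1
      smul_mem' := fun a v hv => by simpa using hadd 0 h0 v hv a }
  change Dense (K : Set H)
  rw [Submodule.dense_iff_topologicalClosure_eq_top, Submodule.topologicalClosure_eq_top_iff,
    Submodule.eq_bot_iff]
  intro g hg
  exact h g fun v hv => Submodule.inner_left_of_mem_orthogonal (K := K) hv hg

theorem continuous_scaledPoint_right (hs : IsScalingFunction s) (lam : ℂ) (r : ℝ) :
    Continuous (scaledPoint s lam r) :=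
  (continuous_scaledPoint hs r).comp (by fun_prop : Continuous fun x : ℝ => (lam, x))

theorem lintegral_exp_scaledPoint_lt_top (hs : IsScalingFunction s) (hr : 0 ≤ r) (hlam : ‖lam‖ < 1)
    (hΩ : volume Ω < ⊤) :
    ∫⁻ p in semiCylinder Ω, ‖Complex.exp (-scaledPoint s lam r p.1)‖ₑ ^ 2 < ⊤ := by
  have hmono : ∫⁻ p in semiCylinder Ω, ‖Complex.exp (-scaledPoint s lam r p.1)‖ₑ ^ 2 ≤
      ∫⁻ p in semiCylinder Ω, ENNReal.ofReal (Real.exp (-(2 * (1 - ‖lam‖) * p.1))) := by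
    rw [volume_restrict_semiCylinder, lintegral_prod _ (by
      have := continuous_scaledPoint_right hs lam r
      exact Continuous.aemeasurable (by fun_prop)), lintegral_prod _ (by
      exact Measurable.aemeasurable (by fun_prop))]
    refine setLIntegral_mono' measurableSet_Ioi fun x hx => lintegral_mono fun y => ?_
    have := scaledPoint_re_ge hs (lam := lam) hr (le_of_lt hx)
    rw [← ofReal_norm, ← ENNReal.ofReal_pow (by positivity), Complex.norm_exp, ← Real.exp_nat_mul]
    refine ENNReal.ofReal_le_ofReal (Real.exp_le_exp.2 ?_)
    push_cast
    rw [Complex.neg_re]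
    linarith
  refine hmono.trans_lt ?_
  rw [volume_restrict_semiCylinder, lintegral_prod _ (by
      exact Measurable.aemeasurable (by fun_prop))]
  simp only [lintegral_const, Measure.restrict_apply_univ]
  rw [lintegral_mul_const _ (by fun_prop)]
  exact ENNReal.mul_lt_top (lintegral_exp_neg_lt_top (by linarith)) hΩ

theorem dense_compKappa (hs : IsScalingFunction s) (hα : 0 < α) (hα' : α < Real.pi / 4)
    (hr : 0 < r) (hlam : lam ∈ scalingDisk α) (hΩo : IsOpen Ω) (hΩb : Bornology.IsBounded Ω) :
    Dense {u : L2Space (semiCylinder Ω) |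
      ∃ F : ℂ → L2Section Ω, MemHardy Ω α F ∧ IsCompKappa Ω s lam r F u} := by
  have hlam' : ‖lam‖ < 1 := by
    have : ‖lam‖ < Real.sin α := by simpa [scalingDisk] using hlam
    exact this.trans_le (Real.sin_le_one _)
  have hTest : ∀ c δ h, MemHardy Ω α fun z => gaussTest c δ z • h := fun c δ h =>
    (sectorHardy_gaussTest_smul hα hα' c δ h).memHardy
  refine dense_of_inner_eq_zero ?_ ?_ ?_
  · refine ⟨fun z => gaussTest 0 0 z • 0, hTest 0 0 0, ?_⟩
    filter_upwards [ae_ae_of_ae_semiCylinder (Lp.coeFn_zero ℂ 2 _)] with x h1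
    filter_upwards [h1, Lp.coeFn_zero ℂ 2 (volume.restrict Ω)] with y h1 h2
    rw [h1, smul_zero, h2]
    rfl
  · rintro u ⟨F, hF, hu⟩ v ⟨G, hG, hv⟩ a
    exact ⟨_, (hF.sectorHardy.add_smul (by linarith [Real.pi_pos]) hG.sectorHardy a).memHardy,
      hu.add_smul hv a⟩
  · intro g hg
    have hgm := Lp.aestronglyMeasurable g
    have hcont := continuous_scaledPoint_right hs lam r
    have hzero : ∀ᵐ p ∂(volume.restrict (semiCylinder Ω)), star (g p) = 0 := by
      refine ae_eq_zero_of_gaussTest_integrals hs hα hα' hlam hΩo (r := r) ?_ ?_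
      · have h1 : MemLp (fun p : ℝ × E n => Complex.exp (-scaledPoint s lam r p.1)) 2
            (volume.restrict (semiCylinder Ω)) :=
          memLp_two_of_lintegral (Continuous.aestronglyMeasurable (by fun_prop))
            (lintegral_exp_scaledPoint_lt_top hs hr.le hlam' hΩb.measure_lt_top)
        exact h1.integrable_mul (Lp.memLp g).star
      · intro δ hδ c h hh hsupp
        have hmem : MemLp h 2 (volume.restrict Ω) := hh.memLp_of_hasCompactSupport hsupp
        have hF := hTest c δ (hmem.toLp h)
        have hK := hF.isCompKappa hs hα hα' hr hlam
        have := hg _ ⟨_, hF, hK⟩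
        rw [L2.inner_def] at this
        rw [← this]
        refine integral_congr_ae ?_
        have hae : compKappa Ω (fun z => gaussTest c δ z • hmem.toLp h) s r lam
            =ᵐ[volume.restrict (semiCylinder Ω)]
            fun p => gaussTest c δ (scaledPoint s lam r p.1) * h p.2 := by
          refine ae_semiCylinder_of_ae_ae (Lp.aestronglyMeasurable _)
            (Continuous.aestronglyMeasurable ?_) ?_
          · have := (differentiable_gaussTest c δ).continuous
            fun_prop
          · filter_upwards [hK] with x hx
            filter_upwards [hx, Lp.coeFn_smul (gaussTest c δ (scaledPoint s lam r x))
              (hmem.toLp h), hmem.coeFn_toLp] with y h1 h2 h3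
            rw [h1, h2, Pi.smul_apply, h3, smul_eq_mul]
        filter_upwards [hae] with p hp
        rw [hp, RCLike.inner_apply, mul_comm]
        rfl
    apply Lp.ext
    filter_upwards [hzero, Lp.coeFn_zero ℂ 2 (volume.restrict (semiCylinder Ω))] with p h1 h2
    rw [h2]
    simpa using h1

end Density
end PML

namespace PML

section Geometry

variable {n : ℕ} {Ω : Set (E n)} {G : Set (ℝ × E n)} {ϰ : ℝ × E n → ℝ × E n}

instance isAddHaarMeasure_volume_prod : (volume : Measure (ℝ × E n)).IsAddHaarMeasure :=
  inferInstanceAs ((volume : Measure ℝ).prod (volume : Measure (E n))).IsAddHaarMeasure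

/-- The absolute value of the Jacobian determinant. -/
def jac (ϰ : ℝ × E n → ℝ × E n) (p : ℝ × E n) : ℝ := |(fderiv ℝ ϰ p).det|

theorem measurable_jac (ϰ : ℝ × E n → ℝ × E n) : Measurable (jac ϰ) := by
  have h1 := (ContinuousLinearMap.continuous_det (𝕜 := ℝ) (E := ℝ × E n)).measurable.comp
    (measurable_fderiv ℝ ϰ)
  exact continuous_abs.measurable.comp h1

theorem jac_nonneg (ϰ : ℝ × E n → ℝ × E n) (p : ℝ × E n) : 0 ≤ jac ϰ p := abs_nonneg _

theorem isOpen_semiCylinder (hΩ : IsOpen Ω) : IsOpen (semiCylinder Ω) := isOpen_Ioi.prod hΩ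

namespace IsQuasiCylindrical

theorem semiCylinder_subset (Ω : Set (E n)) : semiCylinder Ω ⊆ Ioi 0 ×ˢ closure Ω :=
  prod_mono le_rfl subset_closure

theorem hasFDerivAt (hQ : IsQuasiCylindrical Ω G ϰ) (hΩ : IsOpen Ω) {p : ℝ × E n}
    (hp : p ∈ semiCylinder Ω) : HasFDerivAt ϰ (fderiv ℝ ϰ p) p := by
  have h1 := ((hQ.smooth.mono (semiCylinder_subset Ω)).contDiffAt
    ((isOpen_semiCylinder hΩ).mem_nhds hp)).differentiableAt (by simp)
  exact h1.hasFDerivAt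

theorem differentiableOn (hQ : IsQuasiCylindrical Ω G ϰ) (hΩ : IsOpen Ω) :
    DifferentiableOn ℝ ϰ (semiCylinder Ω) := fun _ hp =>
  (hQ.hasFDerivAt hΩ hp).differentiableAt.differentiableWithinAt

theorem injOn (hQ : IsQuasiCylindrical Ω G ϰ) : InjOn ϰ (semiCylinder Ω) := by
  obtain ⟨ϰinv, h, -⟩ := hQ.smooth_inv
  exact h.injOn.mono (semiCylinder_subset Ω)

theorem exists_inv (hQ : IsQuasiCylindrical Ω G ϰ) : ∃ ϰinv : ℝ × E n → ℝ × E n,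
    (∀ p ∈ semiCylinder Ω, ϰinv (ϰ p) = p) ∧ DifferentiableOn ℝ ϰinv {p ∈ G | 0 < p.1} := by
  obtain ⟨ϰinv, h, hd⟩ := hQ.smooth_inv
  refine ⟨ϰinv, fun p hp => h (semiCylinder_subset Ω hp), ?_⟩
  rw [← hQ.image_eq]
  exact (hd.differentiableOn (by simp)).mono (image_mono (semiCylinder_subset Ω))

theorem isOpen_cylinder (hQ : IsQuasiCylindrical Ω G ϰ) : IsOpen {p ∈ G | 0 < p.1} :=
  hQ.isOpen.inter (isOpen_lt continuous_const continuous_fst)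

theorem mapsTo (hQ : IsQuasiCylindrical Ω G ϰ) {p : ℝ × E n} (hp : p ∈ semiCylinder Ω) :
    ϰ p ∈ {p ∈ G | 0 < p.1} := hQ.image_eq ▸ mem_image_of_mem ϰ hp

theorem lintegral_cylinder (hQ : IsQuasiCylindrical Ω G ϰ) (hΩ : IsOpen Ω)
    (g : ℝ × E n → ℝ≥0∞) : ∫⁻ q in {p ∈ G | 0 < p.1}, g q =
      ∫⁻ p in semiCylinder Ω, ENNReal.ofReal (jac ϰ p) * g (ϰ p) := by
  rw [← hQ.image_eq]
  exact lintegral_image_eq_lintegral_abs_det_fderiv_mul volume (isOpen_semiCylinder hΩ).measurableSet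
    (fun p hp => (hQ.hasFDerivAt hΩ hp).hasFDerivWithinAt) hQ.injOn g

theorem integral_cylinder (hQ : IsQuasiCylindrical Ω G ϰ) (hΩ : IsOpen Ω)
    (g : ℝ × E n → ℂ) : ∫ q in {p ∈ G | 0 < p.1}, g q =
      ∫ p in semiCylinder Ω, jac ϰ p • g (ϰ p) := by
  rw [← hQ.image_eq]
  exact integral_image_eq_integral_abs_det_fderiv_smul volume (isOpen_semiCylinder hΩ).measurableSet
    (fun p hp => (hQ.hasFDerivAt hΩ hp).hasFDerivWithinAt) hQ.injOn g

theorem ae_cylinder_iff (hQ : IsQuasiCylindrical Ω G ϰ) (hΩ : IsOpen Ω) {P : ℝ × E n → Prop} :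
    (∀ᵐ q ∂(volume.restrict {p ∈ G | 0 < p.1}), P q) ↔
      ∀ᵐ p ∂(volume.restrict (semiCylinder Ω)), P (ϰ p) := by
  rw [ae_restrict_iff' hQ.isOpen_cylinder.measurableSet,
    ae_restrict_iff' (isOpen_semiCylinder hΩ).measurableSet, ae_iff, ae_iff]
  obtain ⟨ϰinv, hinv, hd⟩ := hQ.exists_inv
  constructor
  · intro h
    refine measure_mono_null ?_ (addHaar_image_eq_zero_of_differentiableOn_of_addHaar_eq_zero
      (f := ϰinv) volume (hd.mono ?_) h)
    · intro p hp
      have hp : ¬(p ∈ semiCylinder Ω → P (ϰ p)) := hp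
      rw [Classical.not_imp] at hp
      exact ⟨ϰ p, Classical.not_imp.2 ⟨hQ.mapsTo hp.1, hp.2⟩, hinv p hp.1⟩
    · intro q hq
      exact (Classical.not_imp.1 hq).1
  · intro h
    refine measure_mono_null ?_ (addHaar_image_eq_zero_of_differentiableOn_of_addHaar_eq_zero
      (f := ϰ) volume ((hQ.differentiableOn hΩ).mono ?_) h)
    · intro q hq
      obtain ⟨h1, h2⟩ := Classical.not_imp.1 hq
      obtain ⟨p, hp, rfl⟩ := hQ.image_eq.symm ▸ h1
      exact ⟨p, Classical.not_imp.2 ⟨hp, h2⟩, rfl⟩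
    · intro p hp
      exact (Classical.not_imp.1 hp).1

theorem aestronglyMeasurable_comp (hQ : IsQuasiCylindrical Ω G ϰ) (hΩ : IsOpen Ω)
    (g : L2Space G) :
    AEStronglyMeasurable (fun p => g (ϰ p)) (volume.restrict (semiCylinder Ω)) :=
  ((Lp.stronglyMeasurable g).measurable.comp_aemeasurable
    ((hQ.differentiableOn hΩ).continuousOn.aemeasurable
      (isOpen_semiCylinder hΩ).measurableSet)).aestronglyMeasurable

theorem union_eq (G : Set (ℝ × E n)) : {p ∈ G | p.1 ≤ 0} ∪ {p ∈ G | 0 < p.1} = G := by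
  ext p
  simp only [mem_union, mem_sep_iff]
  rcases le_or_gt p.1 0 with h | h
  · simp [h, not_lt.2 h]
  · simp [h, not_le.2 h]

theorem ae_iff_left_cylinder (hQ : IsQuasiCylindrical Ω G ϰ) (hΩ : IsOpen Ω)
    {P : ℝ × E n → Prop} : (∀ᵐ q ∂(volume.restrict G), P q) ↔
      (∀ᵐ q ∂(volume.restrict {p ∈ G | p.1 ≤ 0}), P q) ∧
      ∀ᵐ p ∂(volume.restrict (semiCylinder Ω)), P (ϰ p) := by
  rw [← hQ.ae_cylinder_iff hΩ]
  conv_lhs => rw [← union_eq G]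
  exact ae_restrict_union_iff _ _ _

theorem ext_iff (hQ : IsQuasiCylindrical Ω G ϰ) (hΩ : IsOpen Ω) {u v : L2Space G} :
    u = v ↔ (∀ᵐ q ∂(volume.restrict {p ∈ G | p.1 ≤ 0}), u q = v q) ∧
      ∀ᵐ p ∂(volume.restrict (semiCylinder Ω)), u (ϰ p) = v (ϰ p) := by
  rw [← hQ.ae_iff_left_cylinder hΩ]
  exact ⟨fun h => by simp [h], fun h => Lp.ext h⟩

/-- Functions on the semi-cylinder are transplanted to `G`, with zero values in the left part. -/
theorem exists_pushforward (hQ : IsQuasiCylindrical Ω G ϰ) (hΩ : IsOpen Ω) {a : ℝ × E n → ℂ}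
    (ha : AEStronglyMeasurable a (volume.restrict (semiCylinder Ω)))
    (hfin : ∫⁻ p in semiCylinder Ω, ENNReal.ofReal (jac ϰ p) * ‖a p‖ₑ ^ 2 < ⊤) :
    ∃ v : L2Space G, (∀ᵐ q ∂(volume.restrict {p ∈ G | p.1 ≤ 0}), v q = 0) ∧
      (∀ᵐ p ∂(volume.restrict (semiCylinder Ω)), v (ϰ p) = a p) ∧
      ‖v‖ₑ ^ 2 = ∫⁻ p in semiCylinder Ω, ENNReal.ofReal (jac ϰ p) * ‖a p‖ₑ ^ 2 := by
  obtain ⟨ϰinv, hinv, hd⟩ := hQ.exists_inv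
  set C : Set (ℝ × E n) := {p ∈ G | 0 < p.1} with hC
  have hCm : MeasurableSet C := hQ.isOpen_cylinder.measurableSet
  have hSm : MeasurableSet (semiCylinder Ω) := (isOpen_semiCylinder hΩ).measurableSet
  have hCG : C ⊆ G := fun p hp => hp.1
  set v₀ : ℝ × E n → ℂ := C.indicator fun q => ha.mk a (ϰinv q) with hv₀
  have hm : AEStronglyMeasurable v₀ (volume.restrict G) := by
    rw [hv₀, aestronglyMeasurable_indicator_iff hCm, Measure.restrict_restrict hCm,
      inter_eq_self_of_subset_left hCG]
    exact (ha.stronglyMeasurable_mk.measurable.comp_aemeasurable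
      (hd.continuousOn.aemeasurable hCm)).aestronglyMeasurable
  have hval : ∀ᵐ p ∂(volume.restrict (semiCylinder Ω)), v₀ (ϰ p) = a p := by
    filter_upwards [ha.ae_eq_mk, ae_restrict_mem hSm] with p hp hpS
    rw [hv₀, indicator_of_mem (hQ.mapsTo hpS), hinv p hpS, hp]
  have hnorm : ∫⁻ q in G, ‖v₀ q‖ₑ ^ 2 =
      ∫⁻ p in semiCylinder Ω, ENNReal.ofReal (jac ϰ p) * ‖a p‖ₑ ^ 2 := by
    have h1 : ∀ q, ‖v₀ q‖ₑ ^ 2 = C.indicator (fun q => ‖v₀ q‖ₑ ^ 2) q := fun q => by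
      by_cases hq : q ∈ C
      · rw [indicator_of_mem hq]
      · rw [indicator_of_notMem hq, hv₀, indicator_of_notMem hq]
        simp
    rw [lintegral_congr h1, lintegral_indicator hCm, Measure.restrict_restrict hCm,
      inter_eq_self_of_subset_left hCG, hQ.lintegral_cylinder hΩ]
    refine lintegral_congr_ae ?_
    filter_upwards [hval] with p hp
    rw [hp]
  have hmem := memLp_two_of_lintegral hm (hnorm.trans_lt hfin)
  have hae := (hQ.ae_iff_left_cylinder hΩ).1 hmem.coeFn_toLp
  refine ⟨hmem.toLp v₀, ?_, ?_, ?_⟩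
  · have hleft : MeasurableSet {p ∈ G | p.1 ≤ 0} :=
      hQ.isOpen.measurableSet.inter (measurableSet_le measurable_fst measurable_const)
    filter_upwards [hae.1, ae_restrict_mem hleft] with q hq hqL
    rw [hq, hv₀, indicator_of_notMem fun hqC => not_lt.2 hqL.2 hqC.2]
  · filter_upwards [hae.2, hval] with p h1 h2
    rw [h1, h2]
  · rw [enorm_toLp_two_sq, hnorm]

theorem exists_bound_fderiv_nhds (hQ : IsQuasiCylindrical Ω G ϰ) (hΩ : IsOpen Ω) {p : ℝ × E n}
    (hp : p ∈ Ioi (0 : ℝ) ×ˢ closure Ω) :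
    ∃ W ∈ 𝓝 p, ∃ B : ℝ, ∀ q ∈ semiCylinder Ω ∩ W, ‖fderiv ℝ ϰ q‖ ≤ B := by
  have h1 : ContDiffWithinAt ℝ (0 + 1) ϰ (Ioi 0 ×ˢ closure Ω) p := (hQ.smooth p hp).of_le (by simp)
  obtain ⟨u, hu, -, f', hf', hc⟩ := (contDiffWithinAt_succ_iff_hasFDerivWithinAt (by simp)).1 h1
  rw [insert_eq_of_mem hp] at hu
  have hb : ∀ᶠ q in 𝓝[u] p, ‖f' q‖ < ‖f' p‖ + 1 :=
    hc.continuousWithinAt.norm.eventually_lt_const (by linarith)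
  obtain ⟨W₁, hW₁, hW₁'⟩ := mem_nhdsWithin_iff_exists_mem_nhds_inter.1 hu
  obtain ⟨W₂, hW₂, hW₂'⟩ := mem_nhdsWithin_iff_exists_mem_nhds_inter.1 hb
  refine ⟨interior W₁ ∩ W₂, inter_mem (interior_mem_nhds.2 hW₁) hW₂, ‖f' p‖ + 1, ?_⟩
  rintro q ⟨hqS, hq1, hq2⟩
  have hqu : u ∈ 𝓝 q := by
    filter_upwards [isOpen_interior.mem_nhds hq1, (isOpen_semiCylinder hΩ).mem_nhds hqS]
      with z hz1 hz2
    exact hW₁' ⟨interior_subset hz1, semiCylinder_subset Ω hz2⟩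
  rw [((hf' q (mem_of_mem_nhds hqu)).hasFDerivAt hqu).fderiv]
  exact le_of_lt (hW₂' ⟨hq2, mem_of_mem_nhds hqu⟩)

theorem exists_bound_fderiv (hQ : IsQuasiCylindrical Ω G ϰ) (hΩ : IsOpen Ω)
    (hΩb : Bornology.IsBounded Ω) {r : ℝ} (hr : 0 < r) :
    ∃ B : ℝ, ∀ p ∈ semiCylinder Ω, r ≤ p.1 → ‖fderiv ℝ ϰ p‖ ≤ B := by
  have hev := Metric.tendstoUniformlyOn_iff.1 (hQ.tendsto_id 0) 1 one_pos
  obtain ⟨R, hR⟩ := eventually_atTop.1 hev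
  have hK : IsCompact (Icc r (max r R) ×ˢ closure Ω) :=
    isCompact_Icc.prod hΩb.isCompact_closure
  obtain ⟨B, hB⟩ : ∃ B : ℝ, ∀ q ∈ semiCylinder Ω ∩ (Icc r (max r R) ×ˢ closure Ω),
      ‖fderiv ℝ ϰ q‖ ≤ B := by
    refine hK.induction_on (p := fun A => ∃ B : ℝ, ∀ q ∈ semiCylinder Ω ∩ A, ‖fderiv ℝ ϰ q‖ ≤ B)
      ⟨0, by simp⟩ ?_ ?_ ?_
    · rintro A A' hAA' ⟨B, hB⟩
      exact ⟨B, fun q hq => hB q ⟨hq.1, hAA' hq.2⟩⟩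
    · rintro A A' ⟨B, hB⟩ ⟨B', hB'⟩
      refine ⟨max B B', ?_⟩
      rintro q ⟨hq, hq' | hq'⟩
      · exact (hB q ⟨hq, hq'⟩).trans (le_max_left _ _)
      · exact (hB' q ⟨hq, hq'⟩).trans (le_max_right _ _)
    · rintro p ⟨hp1, hp2⟩
      obtain ⟨W, hW, hB⟩ := hQ.exists_bound_fderiv_nhds hΩ (p := p) ⟨hr.trans_le hp1.1, hp2⟩
      exact ⟨W, mem_nhdsWithin_of_mem_nhds hW, hB⟩
  refine ⟨max B 2, fun p hp hpr => ?_⟩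
  rcases le_or_gt p.1 (max r R) with h | h
  · exact (hB p ⟨hp, ⟨hpr, h⟩, subset_closure hp.2⟩).trans (le_max_left _ _)
  · refine le_trans ?_ (le_max_right _ _)
    have h1 := hR p.1 ((le_max_right r R).trans h.le) p.2 hp.2
    rw [dist_zero_left, norm_iteratedFDeriv_zero] at h1
    have h2 := norm_le_norm_sub_add (fderiv ℝ ϰ p) (ContinuousLinearMap.id ℝ (ℝ × E n))
    have h3 : ‖ContinuousLinearMap.id ℝ (ℝ × E n)‖ ≤ 1 := ContinuousLinearMap.norm_id_le
    have h4 : (p.1, p.2) = p := rfl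
    rw [h4] at h1
    linarith

theorem exists_bound_jac (hQ : IsQuasiCylindrical Ω G ϰ) (hΩ : IsOpen Ω)
    (hΩb : Bornology.IsBounded Ω) {r : ℝ} (hr : 0 < r) :
    ∃ B : ℝ≥0, ∀ p ∈ semiCylinder Ω, r ≤ p.1 → jac ϰ p ≤ B := by
  obtain ⟨B, hB⟩ := hQ.exists_bound_fderiv hΩ hΩb hr
  have : ProperSpace ((ℝ × E n) →L[ℝ] (ℝ × E n)) := FiniteDimensional.proper ℝ _
  have hK := isCompact_closedBall (0 : (ℝ × E n) →L[ℝ] (ℝ × E n)) B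
  obtain ⟨D, hD⟩ := hK.exists_bound_of_continuousOn
    (ContinuousLinearMap.continuous_det (𝕜 := ℝ) (E := ℝ × E n)).continuousOn
  refine ⟨D.toNNReal, fun p hp hpr => le_trans ?_ (Real.le_coe_toNNReal D)⟩
  exact hD _ (mem_closedBall_zero_iff.2 (hB p hp hpr))

theorem lintegral_jac_exp_lt_top (hQ : IsQuasiCylindrical Ω G ϰ) (hΩ : IsOpen Ω)
    (hΩb : Bornology.IsBounded Ω) {k : ℝ} (hk : 0 < k) :
    ∫⁻ p in semiCylinder Ω, ENNReal.ofReal (jac ϰ p) * ENNReal.ofReal (Real.exp (-(k * p.1)))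
      < ⊤ := by
  obtain ⟨B, hB⟩ := hQ.exists_bound_jac hΩ hΩb one_pos
  have hSm : MeasurableSet (semiCylinder Ω) := (isOpen_semiCylinder hΩ).measurableSet
  set A : Set (ℝ × E n) := Ioc 0 1 ×ˢ Ω with hA
  have hAm : MeasurableSet A := measurableSet_Ioc.prod hΩ.measurableSet
  have hAS : A ⊆ semiCylinder Ω := prod_mono Ioc_subset_Ioi_self le_rfl
  have h1 : ∫⁻ p in A, ENNReal.ofReal (jac ϰ p) < ⊤ := by
    have := lintegral_image_eq_lintegral_abs_det_fderiv_mul volume hAm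
      (fun p hp => (hQ.hasFDerivAt hΩ (hAS hp)).hasFDerivWithinAt) (hQ.injOn.mono hAS) 1
    simp only [Pi.one_apply, mul_one, setLIntegral_const, one_mul] at this
    change _ = ∫⁻ p in A, ENNReal.ofReal (jac ϰ p) at this
    rw [← this]
    exact (hQ.bounded_image 1).measure_lt_top
  have h2 : ∫⁻ p in semiCylinder Ω, ENNReal.ofReal (Real.exp (-(k * p.1))) < ⊤ := by
    rw [volume_restrict_semiCylinder, lintegral_prod _ (by
      exact Measurable.aemeasurable (by fun_prop))]
    simp only [lintegral_const, Measure.restrict_apply_univ]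
    rw [lintegral_mul_const _ (by fun_prop)]
    exact ENNReal.mul_lt_top (lintegral_exp_neg_lt_top hk) hΩb.measure_lt_top
  have hle : ∫⁻ p in semiCylinder Ω,
      ENNReal.ofReal (jac ϰ p) * ENNReal.ofReal (Real.exp (-(k * p.1))) ≤
      ∫⁻ p in semiCylinder Ω, A.indicator (fun p => ENNReal.ofReal (jac ϰ p)) p +
        B * ENNReal.ofReal (Real.exp (-(k * p.1))) := by
    refine setLIntegral_mono' hSm fun p hp => ?_
    have hp0 : 0 < p.1 := hp.1
    by_cases hpA : p ∈ A
    · rw [indicator_of_mem hpA]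
      refine le_trans ?_ le_self_add
      calc _ ≤ ENNReal.ofReal (jac ϰ p) * 1 := by
            gcongr
            rw [ENNReal.ofReal_le_one, Real.exp_le_one_iff]
            nlinarith
        _ = _ := mul_one _
    · rw [indicator_of_notMem hpA, zero_add]
      have : 1 ≤ p.1 := by
        by_contra hlt
        exact hpA ⟨⟨hp0, (not_le.1 hlt).le⟩, hp.2⟩
      gcongr
      rw [← ENNReal.ofReal_coe_nnreal]
      exact ENNReal.ofReal_le_ofReal (hB p hp this)
  refine hle.trans_lt ?_
  rw [lintegral_add_left ((measurable_jac ϰ).ennreal_ofReal.indicator hAm),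
    lintegral_indicator hAm, Measure.restrict_restrict hAm, inter_eq_self_of_subset_left hAS,
    lintegral_const_mul' _ _ ENNReal.coe_ne_top]
  exact ENNReal.add_lt_top.2 ⟨h1, ENNReal.mul_lt_top ENNReal.coe_lt_top h2⟩

/-- Functions on the semi-cylinder that are cut off at `x ≤ r` are transplanted to `G` by a
bounded operator. -/
theorem exists_transplant (hQ : IsQuasiCylindrical Ω G ϰ) (hΩ : IsOpen Ω)
    (hΩb : Bornology.IsBounded Ω) {r : ℝ} (hr : 0 < r) :
    ∃ T : L2Space (semiCylinder Ω) →L[ℂ] L2Space G, ∀ u,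
      (∀ᵐ q ∂(volume.restrict {p ∈ G | p.1 ≤ 0}), T u q = 0) ∧
      ∀ᵐ p ∂(volume.restrict (semiCylinder Ω)), T u (ϰ p) = {p | r < p.1}.indicator u p := by
  obtain ⟨B, hB⟩ := hQ.exists_bound_jac hΩ hΩb hr
  have hSm : MeasurableSet (semiCylinder Ω) := (isOpen_semiCylinder hΩ).measurableSet
  have hRm : MeasurableSet {p : ℝ × E n | r < p.1} :=
    measurableSet_lt measurable_const measurable_fst
  have hle : ∀ u : L2Space (semiCylinder Ω), ∫⁻ p in semiCylinder Ω,
      ENNReal.ofReal (jac ϰ p) * ‖{p : ℝ × E n | r < p.1}.indicator u p‖ₑ ^ 2 ≤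
      B * ‖u‖ₑ ^ 2 := fun u => by
    rw [enorm_Lp_two_sq, ← lintegral_const_mul' _ _ ENNReal.coe_ne_top]
    refine setLIntegral_mono' hSm fun p hp => ?_
    by_cases hpr : r < p.1
    · rw [indicator_of_mem (by exact hpr)]
      gcongr
      rw [← ENNReal.ofReal_coe_nnreal]
      exact ENNReal.ofReal_le_ofReal (hB p hp hpr.le)
    · rw [indicator_of_notMem (by exact hpr)]
      simp
  have hex : ∀ u : L2Space (semiCylinder Ω), ∃ v : L2Space G,
      (∀ᵐ q ∂(volume.restrict {p ∈ G | p.1 ≤ 0}), v q = 0) ∧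
      (∀ᵐ p ∂(volume.restrict (semiCylinder Ω)),
        v (ϰ p) = {p : ℝ × E n | r < p.1}.indicator u p) ∧ ‖v‖ₑ ^ 2 ≤ B * ‖u‖ₑ ^ 2 := fun u => by
    obtain ⟨v, h1, h2, h3⟩ := hQ.exists_pushforward hΩ
      ((Lp.aestronglyMeasurable u).indicator hRm)
      ((hle u).trans_lt (ENNReal.mul_lt_top ENNReal.coe_lt_top
        (ENNReal.pow_lt_top enorm_lt_top)))
    exact ⟨v, h1, h2, h3 ▸ hle u⟩
  choose T hT1 hT2 hT3 using hex
  let T₀ : L2Space (semiCylinder Ω) →ₗ[ℂ] L2Space G :=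
    { toFun := T
      map_add' := fun u v => by
        have hae := (hQ.ae_iff_left_cylinder hΩ).1 (Lp.coeFn_add (T u) (T v))
        refine (hQ.ext_iff hΩ).2 ⟨?_, ?_⟩
        · filter_upwards [hT1 u, hT1 v, hT1 (u + v), hae.1] with q h1 h2 h3 h4
          rw [h3, h4, Pi.add_apply, h1, h2, add_zero]
        · filter_upwards [hT2 u, hT2 v, hT2 (u + v), hae.2, Lp.coeFn_add u v]
            with q h1 h2 h3 h4 h5
          rw [h3, h4, Pi.add_apply, h1, h2]
          by_cases hq : q ∈ {p : ℝ × E n | r < p.1}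
          · simp only [indicator_of_mem hq, h5, Pi.add_apply]
          · simp only [indicator_of_notMem hq, add_zero]
      map_smul' := fun a u => by
        have hae := (hQ.ae_iff_left_cylinder hΩ).1 (Lp.coeFn_smul a (T u))
        refine (hQ.ext_iff hΩ).2 ⟨?_, ?_⟩
        · filter_upwards [hT1 u, hT1 (a • u), hae.1] with q h1 h2 h3
          rw [RingHom.id_apply, h2, h3, Pi.smul_apply, h1, smul_zero]
        · filter_upwards [hT2 u, hT2 (a • u), hae.2, Lp.coeFn_smul a u]
            with q h1 h3 h4 h5
          rw [RingHom.id_apply, h3, h4, Pi.smul_apply, h1]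
          by_cases hq : q ∈ {p : ℝ × E n | r < p.1}
          · simp only [indicator_of_mem hq, h5, Pi.smul_apply]
          · simp only [indicator_of_notMem hq, smul_zero] }
  refine ⟨T₀.mkContinuous (Real.sqrt B) fun u => ?_, fun u => ⟨hT1 u, hT2 u⟩⟩
  refine (sq_le_sq₀ (norm_nonneg _) (by positivity)).1 ?_
  rw [mul_pow, Real.sq_sqrt B.coe_nonneg]
  have := hT3 u
  simp only [enorm_eq_nnnorm] at this
  exact_mod_cast this

end IsQuasiCylindrical

end Geometry
end PML

namespace PML

theorem isPreconnected_sector {α : ℝ} (hα : α ≤ Real.pi) : IsPreconnected (sector α) := by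
  have himg : Complex.exp '' strip α = sector α := by
    refine Subset.antisymm ?_ fun z hz => ⟨Complex.log z, log_mem_strip hz, Complex.exp_log hz.1⟩
    rintro _ ⟨w, hw, rfl⟩
    exact exp_mem_sector hα hw
  have hconv : Convex ℝ (strip α) := by
    have : strip α = {w | -α < w.im} ∩ {w | w.im < α} := by
      ext w
      exact abs_lt (a := w.im)
    rw [this]
    exact (convex_halfSpace_im_gt _).inter (convex_halfSpace_im_lt _)
  rw [← himg]
  exact hconv.isPreconnected.image _ Complex.continuous_exp.continuousOn

/-- An analytic function on the sector is determined by its values at almost all points of the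
half-axis. -/
theorem eqOn_sector_of_ae_eq {H : Type*} [NormedAddCommGroup H] [NormedSpace ℂ H] {α : ℝ}
    (hα : 0 < α) (hα' : α ≤ Real.pi) {F G : ℂ → H} (hF : AnalyticOnNhd ℂ F (sector α))
    (hG : AnalyticOnNhd ℂ G (sector α))
    (h : ∀ᵐ x : ℝ ∂(volume.restrict (Ioi 0)), F x = G x) : EqOn F G (sector α) := by
  have hmaps : MapsTo (fun x : ℝ => (x : ℂ)) (Ioi 0) (sector α) := fun x hx =>
    ofReal_mem_sector hα hx
  have h1 : EqOn (fun x : ℝ => F x) (fun x : ℝ => G x) (Ioi 0) :=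
    Measure.eqOn_open_of_ae_eq h isOpen_Ioi
      (hF.continuousOn.comp Complex.continuous_ofReal.continuousOn hmaps)
      (hG.continuousOn.comp Complex.continuous_ofReal.continuousOn hmaps)
  refine hF.eqOn_of_preconnected_of_frequently_eq hG (isPreconnected_sector hα')
    (hmaps (mem_Ioi.2 one_pos)) ?_
  have h2 : Tendsto (fun x : ℝ => (x : ℂ)) (𝓝[≠] 1) (𝓝[≠] ((1 : ℝ) : ℂ)) :=
    (Complex.continuous_ofReal.tendsto 1).inf (tendsto_principal_principal.2 fun x hx h =>
      hx (Complex.ofReal_injective h))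
  refine h2.frequently (Eventually.frequently ?_)
  filter_upwards [mem_nhdsWithin_of_mem_nhds (Ioi_mem_nhds one_pos)] with x hx
  exact h1 hx

section QuasiCylinder

variable {n : ℕ} {Ω : Set (E n)} {G : Set (ℝ × E n)} {ϰ : ℝ × E n → ℝ × E n} {s : ℝ → ℝ}
  {α r : ℝ} {lam : ℂ} {f : L2Space G} {F : ℂ → L2Section Ω}

theorem IsHardyContinuation.eqOn (hα : 0 < α) (hα' : α ≤ Real.pi) {F' : ℂ → L2Section Ω}
    (h : IsHardyContinuation Ω α ϰ f F) (h' : IsHardyContinuation Ω α ϰ f F') :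
    EqOn F F' (sector α) := by
  refine eqOn_sector_of_ae_eq hα hα' h.1.analytic h'.1.analytic ?_
  filter_upwards [h.2, h'.2] with x h1 h2
  apply Lp.ext
  filter_upwards [h1, h2] with y h1 h2
  rw [← h1, h2]

theorem isHardyContinuation_hardyContinuation (hf : f ∈ HAlpha Ω α G ϰ) :
    IsHardyContinuation Ω α ϰ f (hardyContinuation Ω α ϰ f) :=
  Classical.epsilon_spec (p := IsHardyContinuation Ω α ϰ f) hf

theorem IsHardyContinuation.hardyContinuation_eqOn (hα : 0 < α) (hα' : α ≤ Real.pi)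
    (h : IsHardyContinuation Ω α ϰ f F) : EqOn (hardyContinuation Ω α ϰ f) F (sector α) :=
  (isHardyContinuation_hardyContinuation ⟨F, h⟩).eqOn hα hα' h

theorem IsHardyContinuation.isCompTheta_iff (hs : IsScalingFunction s) (hα : 0 < α)
    (hα' : α < Real.pi / 4) (hr : 0 < r) (hlam : lam ∈ scalingDisk α)
    (h : IsHardyContinuation Ω α ϰ f F) {v : L2Space G} :
    IsCompTheta Ω α ϰ s lam r f v ↔
      (∀ᵐ p ∂(volume.restrict {p ∈ G | p.1 ≤ 0}), v p = f p) ∧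
      ∀ᵐ x ∂(volume.restrict (Ioi (0 : ℝ))), ∀ᵐ y ∂(volume.restrict Ω),
        v (ϰ (x, y)) = F (scaledPoint s lam r x) y := by
  refine and_congr_right fun _ => ?_
  have heq := h.hardyContinuation_eqOn hα (by linarith [Real.pi_pos])
  constructor <;> intro hv <;>
  · filter_upwards [hv, ae_restrict_mem measurableSet_Ioi] with x hx hx0
    have := heq (scaledPoint_mem_sector_of_mem_disk hs hα hα' hr hlam hx0)
    first | rwa [this] at hx | rwa [this]

theorem IsHardyContinuation.add_smul (hQ : IsQuasiCylindrical Ω G ϰ) (hΩ : IsOpen Ω)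
    (hα : α ≤ Real.pi) {f' : L2Space G} {F' : ℂ → L2Section Ω}
    (h : IsHardyContinuation Ω α ϰ f F) (h' : IsHardyContinuation Ω α ϰ f' F') (a : ℂ) :
    IsHardyContinuation Ω α ϰ (f + a • f') (fun z => F z + a • F' z) := by
  refine ⟨(h.1.sectorHardy.add_smul hα h'.1.sectorHardy a).memHardy, ?_⟩
  have e1 := ((hQ.ae_iff_left_cylinder hΩ).1 (Lp.coeFn_add f (a • f'))).2
  have e2 := ((hQ.ae_iff_left_cylinder hΩ).1 (Lp.coeFn_smul a f')).2
  filter_upwards [h.2, h'.2, ae_ae_of_ae_semiCylinder e1, ae_ae_of_ae_semiCylinder e2]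
    with x h1 h2 h3 h4
  filter_upwards [h1, h2, h3, h4, Lp.coeFn_add (F x) (a • F' x), Lp.coeFn_smul a (F' x)]
    with y h1 h2 h3 h4 h5 h6
  rw [h3, h5, Pi.add_apply, Pi.add_apply, h4, h6, Pi.smul_apply, Pi.smul_apply, h1, h2]

theorem IsCompTheta.unique (hQ : IsQuasiCylindrical Ω G ϰ) (hΩ : IsOpen Ω) {u v : L2Space G}
    (hu : IsCompTheta Ω α ϰ s lam r f u) (hv : IsCompTheta Ω α ϰ s lam r f v) : u = v := by
  refine (hQ.ext_iff hΩ).2 ⟨?_, ?_⟩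
  · filter_upwards [hu.1, hv.1] with p h1 h2
    rw [h1, h2]
  · refine ae_semiCylinder_of_ae_ae (hQ.aestronglyMeasurable_comp hΩ u)
      (hQ.aestronglyMeasurable_comp hΩ v) ?_
    filter_upwards [hu.2, hv.2] with x h1 h2
    filter_upwards [h1, h2] with y h1 h2
    rw [h1, h2]

theorem zero_mem_scalingDisk (hα : 0 < α) (hα' : α < Real.pi / 4) : (0 : ℂ) ∈ scalingDisk α :=
  Metric.mem_ball_self (Real.sin_pos_of_pos_of_lt_pi hα (by linarith [Real.pi_pos]))

/-- `f ∘ ϑ_{λ,r}` as an element of `L²(G)`, where `T` is the transplantation operator and `F` is the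
analytic continuation of `f ∘ ϰ`. -/
def compTheta (T : L2Space (semiCylinder Ω) →L[ℂ] L2Space G) (F : ℂ → L2Section Ω) (s : ℝ → ℝ)
    (r : ℝ) (f : L2Space G) (lam : ℂ) : L2Space G :=
  f + T (compKappa Ω F s r lam - compKappa Ω F s r 0)

theorem isCompTheta_compTheta (hQ : IsQuasiCylindrical Ω G ϰ) (hΩ : IsOpen Ω)
    (hs : IsScalingFunction s) (hα : 0 < α) (hα' : α < Real.pi / 4) (hr : 0 < r)
    (hlam : lam ∈ scalingDisk α) (h : IsHardyContinuation Ω α ϰ f F)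
    {T : L2Space (semiCylinder Ω) →L[ℂ] L2Space G}
    (hT : ∀ u, (∀ᵐ q ∂(volume.restrict {p ∈ G | p.1 ≤ 0}), T u q = 0) ∧
      ∀ᵐ p ∂(volume.restrict (semiCylinder Ω)), T u (ϰ p) = {p | r < p.1}.indicator u p) :
    IsCompTheta Ω α ϰ s lam r f (compTheta T F s r f lam) := by
  rw [h.isCompTheta_iff hs hα hα' hr hlam]
  set u := compKappa Ω F s r lam - compKappa Ω F s r 0 with hu
  have hadd := (hQ.ae_iff_left_cylinder hΩ).1 (Lp.coeFn_add f (T u))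
  constructor
  · filter_upwards [hadd.1, (hT u).1] with p h1 h2
    rw [compTheta, h1, Pi.add_apply, h2, add_zero]
  · filter_upwards [ae_ae_of_ae_semiCylinder hadd.2, ae_ae_of_ae_semiCylinder (hT u).2, h.2,
      ae_ae_of_ae_semiCylinder (Lp.coeFn_sub (compKappa Ω F s r lam) (compKappa Ω F s r 0)),
      h.1.isCompKappa hs hα hα' hr hlam,
      h.1.isCompKappa hs hα hα' hr (zero_mem_scalingDisk hα hα')] with x h1 h2 h3 h4 h5 h6
    filter_upwards [h1, h2, h3, h4, h5, h6] with y h1 h2 h3 h4 h5 h6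
    rw [compTheta, h1, Pi.add_apply, h2, h3]
    have h0 : scaledPoint s 0 r x = x := by simp [scaledPoint]
    by_cases hx : r < x
    · rw [indicator_of_mem (by exact hx), hu, h4, Pi.sub_apply, h5, h6, h0]
      ring
    · rw [indicator_of_notMem (by exact hx), add_zero, scaledPoint,
        hs.eq_zero _ (by linarith [not_lt.1 hx])]
      simp

theorem analyticOnNhd_compTheta (hs : IsScalingFunction s) (hα : 0 < α)
    (hα' : α < Real.pi / 4) (hr : 0 < r) (h : MemHardy Ω α F)
    (T : L2Space (semiCylinder Ω) →L[ℂ] L2Space G) (f : L2Space G) :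
    AnalyticOnNhd ℂ (compTheta T F s r f) (scalingDisk α) :=
  analyticOnNhd_const.add
    (T.comp_analyticOnNhd ((h.analyticOnNhd_compKappa hs hα hα' hr).sub analyticOnNhd_const))

theorem exists_bound_compTheta (hQ : IsQuasiCylindrical Ω G ϰ) (hΩ : IsOpen Ω)
    (hΩb : Bornology.IsBounded Ω) (hs : IsScalingFunction s) (hα : 0 < α)
    (hα' : α < Real.pi / 4) (hr : 0 < r) :
    ∃ C : ℝ, ∀ lam ∈ scalingDisk α, ∀ f ∈ HAlpha Ω α G ϰ, ∀ v : L2Space G,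
      IsCompTheta Ω α ϰ s lam r f v → ‖v‖ ≤ C * hAlphaNorm Ω α ϰ f := by
  obtain ⟨T, hT⟩ := hQ.exists_transplant hΩ hΩb hr
  obtain ⟨C, hC⟩ := exists_const_lintegral_le_hardyNorm (Ω := Ω) hs hα hα' hr
  have hU : ∀ lam ∈ scalingDisk α, ∀ F : ℂ → L2Section Ω, MemHardy Ω α F →
      ‖compKappa Ω F s r lam‖ ≤ Real.sqrt |C| * hardyNorm Ω α F := by
    intro lam hlam F hF
    have h1 := hC lam hlam F hF
    rw [← hF.norm_compKappa_sq hs hα hα' hr hlam, ← ofReal_norm,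
      ← ENNReal.ofReal_pow (norm_nonneg _)] at h1
    have h0 : 0 ≤ hardyNorm Ω α F := Real.sqrt_nonneg _
    refine (sq_le_sq₀ (norm_nonneg _) (by positivity)).1 ?_
    rw [mul_pow, Real.sq_sqrt (abs_nonneg C)]
    refine (ENNReal.ofReal_le_ofReal_iff (by positivity)).1 (h1.trans (ENNReal.ofReal_le_ofReal ?_))
    gcongr
    exact le_abs_self C
  refine ⟨1 + ‖T‖ * (2 * Real.sqrt |C|), fun lam hlam f hf v hv => ?_⟩
  have hF := isHardyContinuation_hardyContinuation hf
  rw [hv.unique hQ hΩ (isCompTheta_compTheta hQ hΩ hs hα hα' hr hlam hF hT), hAlphaNorm]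
  have h0 : 0 ≤ hardyNorm Ω α (hardyContinuation Ω α ϰ f) := Real.sqrt_nonneg _
  have h1 := hU lam hlam _ hF.1
  have h2 := hU 0 (zero_mem_scalingDisk hα hα') _ hF.1
  have h3 := norm_sub_le (compKappa Ω (hardyContinuation Ω α ϰ f) s r lam)
    (compKappa Ω (hardyContinuation Ω α ϰ f) s r 0)
  have h4 : 0 ≤ Real.sqrt |C| := Real.sqrt_nonneg _
  calc _ ≤ ‖f‖ + ‖T‖ * ‖compKappa Ω (hardyContinuation Ω α ϰ f) s r lam -
        compKappa Ω (hardyContinuation Ω α ϰ f) s r 0‖ :=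
        (norm_add_le _ _).trans (add_le_add le_rfl (T.le_opNorm _))
    _ ≤ ‖f‖ + ‖T‖ * (2 * Real.sqrt |C| * hardyNorm Ω α (hardyContinuation Ω α ϰ f)) := by
        gcongr
        linarith
    _ ≤ _ := by
        have : 0 ≤ ‖T‖ * (2 * Real.sqrt |C|) * ‖f‖ := by positivity
        nlinarith

theorem isHardyContinuation_zero (hα : 0 < α) (hα' : α < Real.pi / 4) {f : L2Space G}
    (hf : ∀ᵐ p ∂(volume.restrict (semiCylinder Ω)), f (ϰ p) = 0) :
    IsHardyContinuation Ω α ϰ f fun _ => 0 := by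
  refine ⟨?_, ?_⟩
  · have := (sectorHardy_gaussTest_smul (H := L2Section Ω) hα hα' 0 0 0).memHardy
    simpa using this
  · filter_upwards [ae_ae_of_ae_semiCylinder hf] with x hx
    filter_upwards [hx, Lp.coeFn_zero ℂ 2 (volume.restrict Ω)] with y h1 h2
    rw [h1, h2]
    rfl

theorem isCompTheta_self (hs : IsScalingFunction s) (hα : 0 < α) (hα' : α < Real.pi / 4)
    (hr : 0 < r) (hlam : lam ∈ scalingDisk α) {f : L2Space G}
    (hf : ∀ᵐ p ∂(volume.restrict (semiCylinder Ω)), f (ϰ p) = 0) :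
    IsCompTheta Ω α ϰ s lam r f f := by
  rw [(isHardyContinuation_zero hα hα' hf).isCompTheta_iff hs hα hα' hr hlam]
  exact ⟨ae_of_all _ fun _ => rfl, (isHardyContinuation_zero hα hα' hf).2⟩

theorem exists_left_part (hQ : IsQuasiCylindrical Ω G ϰ) (hΩ : IsOpen Ω) (g : L2Space G) :
    ∃ v : L2Space G, (∀ᵐ q ∂(volume.restrict {p ∈ G | p.1 ≤ 0}), v q = g q) ∧
      ∀ᵐ p ∂(volume.restrict (semiCylinder Ω)), v (ϰ p) = 0 := by
  have hm : MeasurableSet {p : ℝ × E n | p.1 ≤ 0} :=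
    measurableSet_le measurable_fst measurable_const
  have hmem := (Lp.memLp g).indicator hm
  have hae := (hQ.ae_iff_left_cylinder hΩ).1 hmem.coeFn_toLp
  have hleft : MeasurableSet {p ∈ G | p.1 ≤ 0} := hQ.isOpen.measurableSet.inter hm
  refine ⟨hmem.toLp _, ?_, ?_⟩
  · filter_upwards [hae.1, ae_restrict_mem hleft] with q h1 h2
    rw [h1, indicator_of_mem (by exact h2.2)]
  · filter_upwards [hae.2, ae_restrict_mem (isOpen_semiCylinder hΩ).measurableSet] with p h1 h2
    have h3 : ϰ p ∉ {p : ℝ × E n | p.1 ≤ 0} := not_le.2 (hQ.mapsTo h2).2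
    rw [h1, indicator_of_notMem h3]

/-- For the test functions, `f` and `F` exist and the pairing with `f ∘ ϑ_{λ,r}` is an integral over
the semi-cylinder. -/
theorem exists_test (hQ : IsQuasiCylindrical Ω G ϰ) (hΩ : IsOpen Ω)
    (hΩb : Bornology.IsBounded Ω) (hα : 0 < α) (hα' : α < Real.pi / 4) (c : ℂ) (δ : ℝ)
    {h : E n → ℂ} (hh : Continuous h) (hsupp : HasCompactSupport h)
    (hmem : MemLp h 2 (volume.restrict Ω)) :
    ∃ f : L2Space G, (∀ᵐ q ∂(volume.restrict {p ∈ G | p.1 ≤ 0}), f q = 0) ∧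
      IsHardyContinuation Ω α ϰ f fun z => gaussTest c δ z • hmem.toLp h := by
  obtain ⟨M, hM⟩ := hh.bounded_above_of_compact_support hsupp
  obtain ⟨C, hC0, hC⟩ := exists_bound_gaussTest hα hα' c δ
  have hcont : Continuous fun p : ℝ × E n => gaussTest c δ (p.1 : ℂ) * h p.2 := by
    have := (differentiable_gaussTest c δ).continuous
    fun_prop
  have hfin : ∫⁻ p in semiCylinder Ω, ENNReal.ofReal (jac ϰ p) *
      ‖gaussTest c δ (p.1 : ℂ) * h p.2‖ₑ ^ 2 < ⊤ := by
    have hle : ∫⁻ p in semiCylinder Ω, ENNReal.ofReal (jac ϰ p) *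
        ‖gaussTest c δ (p.1 : ℂ) * h p.2‖ₑ ^ 2 ≤ ∫⁻ p in semiCylinder Ω,
        ENNReal.ofReal ((C * M) ^ 2) *
          (ENNReal.ofReal (jac ϰ p) * ENNReal.ofReal (Real.exp (-(2 * p.1)))) := by
      refine setLIntegral_mono' (isOpen_semiCylinder hΩ).measurableSet fun p hp => ?_
      rw [mul_left_comm]
      gcongr
      rw [← ofReal_norm, ← ENNReal.ofReal_pow (by positivity),
        ← ENNReal.ofReal_mul (by positivity)]
      refine ENNReal.ofReal_le_ofReal ?_
      have h1 := hC _ (ofReal_mem_sector hα hp.1)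
      rw [show -(2 * p.1) = (2 : ℕ) * -p.1 by push_cast; ring, Real.exp_nat_mul, ← mul_pow,
        norm_mul, mul_right_comm]
      rw [Complex.ofReal_re] at h1
      gcongr
      exact hM _
    refine hle.trans_lt ?_
    rw [lintegral_const_mul' _ _ ENNReal.ofReal_ne_top]
    exact ENNReal.mul_lt_top ENNReal.ofReal_lt_top (hQ.lintegral_jac_exp_lt_top hΩ hΩb two_pos)
  obtain ⟨f, hf1, hf2, -⟩ := hQ.exists_pushforward hΩ hcont.aestronglyMeasurable hfin
  refine ⟨f, hf1, (sectorHardy_gaussTest_smul hα hα' c δ _).memHardy, ?_⟩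
  filter_upwards [ae_ae_of_ae_semiCylinder hf2] with x hx
  filter_upwards [hx, Lp.coeFn_smul (gaussTest c δ (x : ℂ)) (hmem.toLp h), hmem.coeFn_toLp]
    with y h1 h2 h3
  rw [h1, h2, Pi.smul_apply, h3, smul_eq_mul]

theorem integrableOn_exp_mul_jac (hQ : IsQuasiCylindrical Ω G ϰ) (hΩ : IsOpen Ω)
    (hΩb : Bornology.IsBounded Ω) (hs : IsScalingFunction s) (hr : 0 ≤ r) (hlam : ‖lam‖ < 1)
    (g : L2Space G) :
    IntegrableOn (fun p => Complex.exp (-scaledPoint s lam r p.1) * (jac ϰ p • star (g (ϰ p))))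
      (semiCylinder Ω) := by
  have hSm : MeasurableSet (semiCylinder Ω) := (isOpen_semiCylinder hΩ).measurableSet
  have hJm : AEStronglyMeasurable (fun p => ((Real.sqrt (jac ϰ p) : ℝ) : ℂ))
      (volume.restrict (semiCylinder Ω)) :=
    (Complex.measurable_ofReal.comp (measurable_jac ϰ).sqrt).aestronglyMeasurable
  have hsq : ∀ p (z : ℂ), ‖((Real.sqrt (jac ϰ p) : ℝ) : ℂ) * z‖ₑ ^ 2 =
      ENNReal.ofReal (jac ϰ p) * ‖z‖ₑ ^ 2 := fun p z => by
    rw [enorm_mul, mul_pow, ← ofReal_norm (_ : ℂ), ← ENNReal.ofReal_pow (norm_nonneg _),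
      Complex.norm_real, Real.norm_eq_abs, sq_abs, Real.sq_sqrt (jac_nonneg ϰ p)]
  have hcont := continuous_scaledPoint_right hs lam r
  have h1 : MemLp (fun p : ℝ × E n => ((Real.sqrt (jac ϰ p) : ℝ) : ℂ) *
      Complex.exp (-scaledPoint s lam r p.1)) 2 (volume.restrict (semiCylinder Ω)) := by
    refine memLp_two_of_lintegral
      (hJm.mul (Continuous.aestronglyMeasurable (by fun_prop))) ?_
    have hk : 0 < 2 * (1 - ‖lam‖) := by linarith
    refine lt_of_le_of_lt ?_ (hQ.lintegral_jac_exp_lt_top hΩ hΩb hk)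
    refine setLIntegral_mono' hSm fun p hp => ?_
    rw [hsq]
    gcongr
    have := scaledPoint_re_ge hs (lam := lam) hr (le_of_lt hp.1)
    rw [← ofReal_norm, ← ENNReal.ofReal_pow (by positivity), Complex.norm_exp, ← Real.exp_nat_mul]
    refine ENNReal.ofReal_le_ofReal (Real.exp_le_exp.2 ?_)
    push_cast
    rw [Complex.neg_re]
    linarith
  have h2 : MemLp (fun p : ℝ × E n => ((Real.sqrt (jac ϰ p) : ℝ) : ℂ) * g (ϰ p)) 2
      (volume.restrict (semiCylinder Ω)) := by
    refine memLp_two_of_lintegral (hJm.mul (hQ.aestronglyMeasurable_comp hΩ g)) ?_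
    simp only [hsq]
    rw [← hQ.lintegral_cylinder hΩ fun q => ‖g q‖ₑ ^ 2]
    refine (lintegral_mono_set (fun q hq => hq.1 : {p ∈ G | 0 < p.1} ⊆ G)).trans_lt ?_
    rw [← enorm_Lp_two_sq]
    exact ENNReal.pow_lt_top enorm_lt_top
  refine (h1.integrable_mul h2.star).congr (ae_of_all _ fun p => ?_)
  have hj : ((jac ϰ p : ℝ) : ℂ) =
      ((Real.sqrt (jac ϰ p) : ℝ) : ℂ) * ((Real.sqrt (jac ϰ p) : ℝ) : ℂ) := by
    rw [← Complex.ofReal_mul, Real.mul_self_sqrt (jac_nonneg ϰ p)]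
  simp only [Pi.mul_apply, Pi.star_apply, star_mul', RCLike.star_def, Complex.conj_ofReal,
    Complex.real_smul]
  rw [hj]
  ring

theorem dense_compTheta (hQ : IsQuasiCylindrical Ω G ϰ) (hΩ : IsOpen Ω)
    (hΩb : Bornology.IsBounded Ω) (hs : IsScalingFunction s) (hα : 0 < α)
    (hα' : α < Real.pi / 4) (hr : 0 < r) (hlam : lam ∈ scalingDisk α) :
    Dense {v : L2Space G | ∃ f ∈ HAlpha Ω α G ϰ, IsCompTheta Ω α ϰ s lam r f v} := by
  have hlam' : ‖lam‖ < 1 := by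
    have : ‖lam‖ < Real.sin α := by simpa [scalingDisk] using hlam
    exact this.trans_le (Real.sin_le_one _)
  have hαpi : α ≤ Real.pi := by linarith [Real.pi_pos]
  have hself : ∀ v : L2Space G, (∀ᵐ p ∂(volume.restrict (semiCylinder Ω)), v (ϰ p) = 0) →
      ∃ f ∈ HAlpha Ω α G ϰ, IsCompTheta Ω α ϰ s lam r f v := fun v hv =>
    ⟨v, ⟨_, isHardyContinuation_zero hα hα' hv⟩, isCompTheta_self hs hα hα' hr hlam hv⟩
  refine dense_of_inner_eq_zero ?_ ?_ ?_
  · refine hself 0 ?_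
    exact ((hQ.ae_iff_left_cylinder hΩ).1 (Lp.coeFn_zero ℂ 2 (volume.restrict G))).2
  · rintro u ⟨f, hf, hu⟩ v ⟨f', hf', hv⟩ a
    have hF := isHardyContinuation_hardyContinuation hf
    have hF' := isHardyContinuation_hardyContinuation hf'
    have hsum := hF.add_smul hQ hΩ hαpi hF' a
    refine ⟨f + a • f', ⟨_, hsum⟩, (hsum.isCompTheta_iff hs hα hα' hr hlam).2 ⟨?_, ?_⟩⟩
    · have e1 := ((hQ.ae_iff_left_cylinder hΩ).1 (Lp.coeFn_add f (a • f'))).1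
      have e2 := ((hQ.ae_iff_left_cylinder hΩ).1 (Lp.coeFn_smul a f')).1
      have e3 := ((hQ.ae_iff_left_cylinder hΩ).1 (Lp.coeFn_add u (a • v))).1
      have e4 := ((hQ.ae_iff_left_cylinder hΩ).1 (Lp.coeFn_smul a v)).1
      filter_upwards [e1, e2, e3, e4, hu.1, hv.1] with p h1 h2 h3 h4 h5 h6
      rw [h1, h3, Pi.add_apply, Pi.add_apply, h2, h4, Pi.smul_apply, Pi.smul_apply, h5, h6]
    · have e3 := ((hQ.ae_iff_left_cylinder hΩ).1 (Lp.coeFn_add u (a • v))).2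
      have e4 := ((hQ.ae_iff_left_cylinder hΩ).1 (Lp.coeFn_smul a v)).2
      filter_upwards [ae_ae_of_ae_semiCylinder e3, ae_ae_of_ae_semiCylinder e4, hu.2, hv.2]
        with x h1 h2 h3 h4
      filter_upwards [h1, h2, h3, h4,
        Lp.coeFn_add (hardyContinuation Ω α ϰ f (scaledPoint s lam r x))
          (a • hardyContinuation Ω α ϰ f' (scaledPoint s lam r x)),
        Lp.coeFn_smul a (hardyContinuation Ω α ϰ f' (scaledPoint s lam r x))]
        with y h1 h2 h3 h4 h5 h6
      rw [h1, h5, Pi.add_apply, Pi.add_apply, h2, h6, Pi.smul_apply, Pi.smul_apply, h3, h4]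
  · intro g hg
    have hleft : ∀ᵐ q ∂(volume.restrict {p ∈ G | p.1 ≤ 0}), g q = 0 := by
      obtain ⟨v, hv1, hv2⟩ := exists_left_part hQ hΩ g
      have hgv := hg v (hself v hv2)
      have hvv : inner ℂ v v = (0 : ℂ) := by
        rw [← hgv, L2.inner_def, L2.inner_def]
        refine integral_congr_ae ((hQ.ae_iff_left_cylinder hΩ).2 ⟨?_, ?_⟩)
        · filter_upwards [hv1] with q hq
          rw [hq]
        · filter_upwards [hv2] with p hp
          rw [hp, inner_zero_right, inner_zero_right]
      have hv0 : v = 0 := inner_self_eq_zero.1 hvv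
      have e := ((hQ.ae_iff_left_cylinder hΩ).1 (Lp.coeFn_zero ℂ 2 (volume.restrict G))).1
      filter_upwards [hv1, e] with q h1 h2
      rw [← h1, hv0, h2]
      rfl
    have hjac : ∀ᵐ p ∂(volume.restrict (semiCylinder Ω)), jac ϰ p • star (g (ϰ p)) = 0 := by
      refine ae_eq_zero_of_gaussTest_integrals hs hα hα' hlam hΩ (r := r)
        (integrableOn_exp_mul_jac hQ hΩ hΩb hs hr.le hlam' g) ?_
      intro δ hδ c h hh hsupp
      have hmem : MemLp h 2 (volume.restrict Ω) := hh.memLp_of_hasCompactSupport hsupp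
      obtain ⟨f, hf, hF⟩ := exists_test hQ hΩ hΩb hα hα' c δ hh hsupp hmem
      obtain ⟨T, hT⟩ := hQ.exists_transplant hΩ hΩb hr
      have hV := isCompTheta_compTheta hQ hΩ hs hα hα' hr hlam hF hT
      have hgV := hg _ ⟨f, ⟨_, hF⟩, hV⟩
      set v := compTheta T (fun z => gaussTest c δ z • hmem.toLp h) s r f lam
      rw [hF.isCompTheta_iff hs hα hα' hr hlam] at hV
      have hv0 : ∀ᵐ q ∂(volume.restrict {p ∈ G | p.1 ≤ 0}), v q = 0 := by
        filter_upwards [hV.1, hf] with q h1 h2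
        rw [h1, h2]
      have hv : ∀ᵐ p ∂(volume.restrict (semiCylinder Ω)),
          v (ϰ p) = gaussTest c δ (scaledPoint s lam r p.1) * h p.2 := by
        refine ae_semiCylinder_of_ae_ae (hQ.aestronglyMeasurable_comp hΩ v)
          (Continuous.aestronglyMeasurable ?_) ?_
        · have h1 := (differentiable_gaussTest c δ).continuous
          have h2 := continuous_scaledPoint_right hs lam r
          fun_prop
        · filter_upwards [hV.2] with x hx
          filter_upwards [hx, Lp.coeFn_smul (gaussTest c δ (scaledPoint s lam r x))
            (hmem.toLp h), hmem.coeFn_toLp] with y h1 h2 h3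
          rw [h1, h2, Pi.smul_apply, h3, smul_eq_mul]
      have hCm : MeasurableSet {p ∈ G | 0 < p.1} := hQ.isOpen_cylinder.measurableSet
      have hind : ∫ q in G, inner ℂ (g q) (v q) =
          ∫ q in {p ∈ G | 0 < p.1}, inner ℂ (g q) (v q) := by
        rw [← inter_eq_self_of_subset_left (fun q hq => hq.1 : {p ∈ G | 0 < p.1} ⊆ G),
          ← Measure.restrict_restrict hCm, ← integral_indicator hCm]
        refine integral_congr_ae ((hQ.ae_iff_left_cylinder hΩ).2 ⟨?_, ?_⟩)
        · filter_upwards [hv0] with q hq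
          by_cases hqC : q ∈ {p ∈ G | 0 < p.1}
          · rw [indicator_of_mem hqC]
          · rw [indicator_of_notMem hqC, hq, inner_zero_right]
        · filter_upwards [ae_restrict_mem (isOpen_semiCylinder hΩ).measurableSet] with p hp
          rw [indicator_of_mem (hQ.mapsTo hp)]
      rw [L2.inner_def, hind, hQ.integral_cylinder hΩ] at hgV
      rw [← hgV]
      refine integral_congr_ae ?_
      filter_upwards [hv] with p hp
      rw [hp, RCLike.inner_apply, Complex.real_smul, Complex.real_smul, RCLike.star_def]
      ring
    have hcyl : ∀ᵐ q ∂(volume.restrict {p ∈ G | 0 < p.1}), g q = 0 := by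
      have hz : ∫⁻ q in {p ∈ G | 0 < p.1}, ‖g q‖ₑ = 0 := by
        rw [hQ.lintegral_cylinder hΩ]
        refine (lintegral_congr_ae ?_).trans lintegral_zero
        filter_upwards [hjac] with p hp
        rcases smul_eq_zero.1 hp with h | h
        · simp [h]
        · simp [star_eq_zero.1 h]
      have hm := (Lp.stronglyMeasurable g).measurable.enorm
      rw [lintegral_eq_zero_iff hm] at hz
      filter_upwards [hz] with q hq
      simpa using hq
    refine (hQ.ext_iff hΩ).2 ?_
    have e := (hQ.ae_iff_left_cylinder hΩ).1 (Lp.coeFn_zero ℂ 2 (volume.restrict G))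
    refine ⟨?_, ?_⟩
    · filter_upwards [hleft, e.1] with q h1 h2
      rw [h1, h2]
      rfl
    · filter_upwards [(hQ.ae_cylinder_iff hΩ).1 hcyl, e.2] with p h1 h2
      rw [h1, h2]
      rfl

end QuasiCylinder
end PML

end

theorem proposition5p3 {n : ℕ} (hn : 1 ≤ n) (Ω : Set (PML.E n)) (hΩo : IsOpen Ω)
    (hΩc : IsConnected Ω) (hΩb : Bornology.IsBounded Ω) (α : ℝ) (hα : 0 < α)
    (hα' : α < Real.pi / 4) (s : ℝ → ℝ) (hs : PML.IsScalingFunction s) :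
    -- the boundary limits that define the norm of the Hardy class exist
    (∀ F : ℂ → PML.L2Section Ω, PML.MemHardy Ω α F →
      (∃ u, PML.IsBoundaryLimit Ω F (𝓝[>] (-α)) u) ∧
      (∃ u, PML.IsBoundaryLimit Ω F (𝓝[<] α) u)) ∧
    -- uniform estimate
    (∀ r : ℝ, 0 < r → ∃ C : ℝ, ∀ lam ∈ PML.scalingDisk α, ∀ F : ℂ → PML.L2Section Ω,
      PML.MemHardy Ω α F →
      ∫⁻ x in Ioi (0 : ℝ), ‖F (PML.scaledPoint s lam r x)‖ₑ ^ 2 ≤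
        ENNReal.ofReal (C * PML.hardyNorm Ω α F ^ 2)) ∧
    -- density of the range
    (∀ lam ∈ PML.scalingDisk α, ∀ r : ℝ, 0 < r →
      Dense {u : PML.L2Space (PML.semiCylinder Ω) |
        ∃ F : ℂ → PML.L2Section Ω, PML.MemHardy Ω α F ∧ PML.IsCompKappa Ω s lam r F u}) ∧
    -- analyticity in the scaling parameter
    (∀ F : ℂ → PML.L2Section Ω, PML.MemHardy Ω α F → ∀ r : ℝ, 0 < r →
      ∃ U : ℂ → PML.L2Space (PML.semiCylinder Ω),
        (∀ lam ∈ PML.scalingDisk α, PML.IsCompKappa Ω s lam r F (U lam)) ∧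
        AnalyticOnNhd ℂ U (PML.scalingDisk α)) ∧
    -- the same properties for quasi-cylindrical domains
    (∀ (G : Set (ℝ × PML.E n)) (ϰ : ℝ × PML.E n → ℝ × PML.E n),
      PML.IsQuasiCylindrical Ω G ϰ →
      (∀ r : ℝ, 0 < r → ∃ C : ℝ, ∀ lam ∈ PML.scalingDisk α, ∀ f ∈ PML.HAlpha Ω α G ϰ,
        ∀ v : PML.L2Space G, PML.IsCompTheta Ω α ϰ s lam r f v →
          ‖v‖ ≤ C * PML.hAlphaNorm Ω α ϰ f) ∧
      (∀ lam ∈ PML.scalingDisk α, ∀ r : ℝ, 0 < r →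
        Dense {v : PML.L2Space G |
          ∃ f ∈ PML.HAlpha Ω α G ϰ, PML.IsCompTheta Ω α ϰ s lam r f v}) ∧
      (∀ f ∈ PML.HAlpha Ω α G ϰ, ∀ r : ℝ, 0 < r →
        ∃ V : ℂ → PML.L2Space G,
          (∀ lam ∈ PML.scalingDisk α, PML.IsCompTheta Ω α ϰ s lam r f (V lam)) ∧
          AnalyticOnNhd ℂ V (PML.scalingDisk α))) := by
  refine ⟨fun F hF => ?_, fun r hr => PML.exists_const_lintegral_le_hardyNorm hs hα hα' hr,
    fun lam hlam r hr => PML.dense_compKappa hs hα hα' hr hlam hΩo hΩb,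
    fun F hF r hr => ⟨PML.compKappa Ω F s r, fun lam hlam => hF.isCompKappa hs hα hα' hr hlam,
      hF.analyticOnNhd_compKappa hs hα hα' hr⟩, fun G ϰ hQ => ⟨fun r hr =>
      PML.exists_bound_compTheta hQ hΩo hΩb hs hα hα' hr, fun lam hlam r hr =>
      PML.dense_compTheta hQ hΩo hΩb hs hα hα' hr hlam, fun f hf r hr => ?_⟩⟩
  · obtain ⟨u, v, -, -, hu, hv, -⟩ := hF.exists_limits hα (by linarith [Real.pi_pos])
    exact ⟨⟨_, hu⟩, ⟨_, hv⟩⟩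
  · obtain ⟨T, hT⟩ := hQ.exists_transplant hΩo hΩb hr
    have hF := PML.isHardyContinuation_hardyContinuation hf
    exact ⟨PML.compTheta T (PML.hardyContinuation Ω α ϰ f) s r f, fun lam hlam =>
      PML.isCompTheta_compTheta hQ hΩo hs hα hα' hr hlam hF hT,
      PML.analyticOnNhd_compTheta hs hα hα' hr hF.1 T f⟩
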